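/- Let $\Phi_0$ be the set of convex functions $\phi:\mathbb R\to[0,\infty]$ with $\phi(1)=0$ whose effective domain $\mathrm{dom}(\phi)=\{\phi<\infty\}$ is contained in $[0,\infty)$ and contains a neighbourhood of $1$. Write $\phi^*(s)=\sup_t\{st-\phi(t)\}$ (with $\phi^*(\infty)=\infty$), and, for $\phi\in\Phi_0$, $0\,\phi^*(s/0):=0$ if $s\le 0$ and $:=\infty$ if $s>0$. For probability measures let $I_\phi(\mathbb Q,\mathbb P)=\int\phi(d\mathbb Q/d\mathbb P)\,d\mathbb P$ if $\mathbb Q\ll\mathbb P$ and $+\infty$ otherwise. Let $(\Omega,\mathcal F,\mathbb P_0)$ be a probability space, $X\in L^1(\mathbb P_0)$, $r>0$, and let $\phi_1,\phi_2\in\Phi_0$ be lower semicontinuous. Define, with suprema over probability measures and with the convention $\infty-\infty=-\infty$, $$\rho^l=\sup_{\mathbb Q\ll\mathbb P_0}\ \sup_{\bar{\mathbb Q}\ll\mathbb Q}\ \mathbb E_{\bar{\mathbb Q}}[-X]-I_{\phi_1}(\bar{\mathbb Q},\mathbb Q)-I_{\phi_2}(\mathbb Q,\mathbb P_0),\qquad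 \rho^s=\sup_{\mathbb Q:\,I_{\phi_2}(\mathbb Q,\mathbb P_0)\le r}\ \sup_{\bar{\mathbb Q}\ll\mathbb Q}\ \mathbb E_{\bar{\mathbb Q}}[-X]-I_{\phi_1}(\bar{\mathbb Q},\mathbb Q).$$ Put $\beta^*(\omega,\theta)=\phi_2^*(\phi_1^*(\theta_2-X(\omega))+\theta_1)$ and $\tilde\beta^*(\omega,\theta,\lambda)=\lambda\,\phi_2^*\big((\phi_1^*(\theta_2-X(\omega))+\theta_1)/\lambda\big)$. Then, in $[-\infty,\infty]$, $$\text{(1)}\quad\rho^l=\inf_{\theta\in\mathbb R^2}\{-\theta_1-\theta_2+\mathbb E_{\mathbb P_0}[\beta^*(\cdot,\theta)]\},\qquad\text{(2)}\quad\rho^s=\inf_{\lambda\ge0,\ \theta\in\mathbb R^2}\{-\theta_1-\theta_2+\lambda r+\mathbb E_{\mathbb P_0}[\tilde\beta^*(\cdot,\theta,\lambda)]\}.$$ Suppose moreover that $\phi_1^*$ and $\phi_2^*$ are finite and differentiable on $\mathbb R$, and let $F=\{\theta\in\mathbb R^2:\int\beta^*(\cdot,\theta)\,d\mathbb P_0<\infty\}$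 and $\tilde F=\{(\theta,\lambda)\in\mathbb R^2\times[0,\infty):\int\tilde\beta^*(\cdot,\theta,\lambda)\,d\mathbb P_0<\infty\}$; interiors are taken in $\mathbb R^2$ and $\mathbb R^3$. (a) If $\mathrm{int}\,F\ne\emptyset$, the infimum in (1) is attained. If a minimizer $\theta^*$ of (1) lies in $\mathrm{int}\,F$, then the partial derivatives $g^*(\omega)=\partial_{\theta_1}\beta^*(\omega,\theta^*)$ and $\bar g^*(\omega)=\partial_{\theta_2}\beta^*(\omega,\theta^*)$ exist for every $\omega$ and are the densities with respect to $\mathbb P_0$ of probability measures $\mathbb Q^*$ and $\bar{\mathbb Q}^*$ that attain the maximum in the primal problem $\rho^l$. (b) If $\mathrm{int}\,\tilde F\ne\emptyset$, the infimum in (2) is attained provided that $(0,\infty)\subset\mathrm{dom}(\phi_2)$; for arbitrary $\phi_2$ it is attained, with the same value $\rho^s$, if $0\,\phi_2^*(s/0)$ is read in (2) as the limit $\lim_{\lambda\downarrow0}\lambda\phi_2^*(s/\lambda)=\sup_{t\in\mathrm{dom}(\phi_2)}ts$. If a minimizer $(\tilde\theta^*,\lambda^*)$ of (2) lies in $\mathrm{int}\,\tilde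 F$, then the partial derivatives $\partial_{\theta_1}\tilde\beta^*$ and $\partial_{\theta_2}\tilde\beta^*$ at $(\omega,\tilde\theta^*,\lambda^*)$ exist for every $\omega$ and are the densities with respect to $\mathbb P_0$ of probability measures $\mathbb Q^*$ and $\bar{\mathbb Q}^*$ that attain the maximum in the primal problem $\rho^s$. In (a) and (b), attaining the maximum is meant for the objective written as a single integral over the densities $g=d\mathbb Q/d\mathbb P_0$ and $\bar g=d\bar{\mathbb Q}/d\mathbb P_0$, namely $\int(-X\bar g-g\,\phi_1(\bar g/g)-\phi_2(g))\,d\mathbb P_0$, respectively $\int(-X\bar g-g\,\phi_1(\bar g/g))\,d\mathbb P_0$ (where $0\,\phi_1(0/0)=0$): the value at $(\mathbb Q^*,\bar{\mathbb Q}^*)$ is $\rho^l$, respectively $\rho^s$, and is maximal among all feasible pairs. The objective written as a difference of separate terms has the same value at $(\mathbb Q^*,\bar{\mathbb Q}^*)$ unless it has the form $\infty-\infty$. -/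

import Mathlib

open MeasureTheory
open scoped ENNReal NNReal

namespace RobustOCE

/-- The class `Φ₀` of divergence functions: convex functions `φ : ℝ → [0, ∞]` with `φ 1 = 0`, whose
effective domain is contained in `[0, ∞)` and contains a neighbourhood of `1`. -/
structure IsDivergenceFunction (φ : ℝ → ℝ≥0∞) : Prop where
  convex : ConvexOn ℝ≥0 Set.univ φ
  map_one : φ 1 = 0
  eq_top_of_neg : ∀ t : ℝ, t < 0 → φ t = ⊤
  lt_top_near_one : ∀ᶠ t in nhds (1 : ℝ), φ t < ⊤

/-- The convex conjugate `φ* y = sup_t (t y - φ t)`. The argument is allowed to be an extended real,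
so that conjugates can be composed; for a divergence function `φ* ∞ = ∞`. -/
noncomputable def conjugate (φ : ℝ → ℝ≥0∞) (y : EReal) : EReal :=
  ⨆ t : ℝ, (t : EReal) * y - (φ t : EReal)

/-- `φ*` is (finite and) differentiable on all of `ℝ`. -/
def DifferentiableConjugate (φ : ℝ → ℝ≥0∞) : Prop :=
  (∀ s : ℝ, conjugate φ (s : EReal) < ⊤) ∧
    Differentiable ℝ (fun s : ℝ => (conjugate φ (s : EReal)).toReal)

/-- The function `s ↦ lam φ*(s / lam)` for `lam ≥ 0`, where `0 φ*(s / 0)` is `0` for `s ≤ 0` and `∞`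
for `s > 0`. -/
noncomputable def scaledConjugate (φ : ℝ → ℝ≥0∞) (lam : ℝ) (s : EReal) : EReal :=
  if lam = 0 then (if s ≤ 0 then 0 else ⊤)
  else (lam : EReal) * conjugate φ (s / (lam : EReal))

/-- The function `s ↦ lam φ*(s / lam)` for `lam ≥ 0`, where at `lam = 0` it is given by its limit as
`lam ↓ 0`, which is the support function of the effective domain of `φ`. -/
noncomputable def closedScaledConjugate (φ : ℝ → ℝ≥0∞) (lam : ℝ) (s : EReal) : EReal :=
  if lam = 0 then ⨆ t : {t : ℝ // φ t < ⊤}, ((t : ℝ) : EReal) * s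
  else (lam : EReal) * conjugate φ (s / (lam : EReal))

variable {Ω : Type*} [MeasurableSpace Ω]

/-- The integral of an extended-real-valued function, positive part minus negative part. It is `-∞`
as soon as the integral of the negative part is infinite (so `∞ - ∞ = -∞`). -/
noncomputable def extIntegral (μ : Measure Ω) (f : Ω → EReal) : EReal :=
  ((∫⁻ ω, (f ω).toENNReal ∂μ : ℝ≥0∞) : EReal) - ((∫⁻ ω, (-f ω).toENNReal ∂μ : ℝ≥0∞) : EReal)

open Classical in
/-- The divergence `I_φ(Q, P) = ∫ φ(dQ/dP) dP` if `Q ≪ P`, and `∞` otherwise. -/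
noncomputable def divergence (φ : ℝ → ℝ≥0∞) (Q P : Measure Ω) : ℝ≥0∞ :=
  if Q ≪ P then ∫⁻ ω, φ (Q.rnDeriv P ω).toReal ∂P else ⊤

/-- `E_Q[-X]` in the extended reals. -/
noncomputable def expLoss (Q : Measure Ω) (X : Ω → ℝ) : EReal :=
  extIntegral Q (fun ω => ((-X ω : ℝ) : EReal))

/-! ### The primal problems -/

/-- `E_{Qbar}[-X] - I_{φ₁}(Qbar, Q) - I_{φ₂}(Q, P₀)`, with `∞ - ∞ = -∞`. -/
noncomputable def penObjective (P₀ : Measure Ω) (φ₁ φ₂ : ℝ → ℝ≥0∞) (X : Ω → ℝ)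
    (Q Qbar : Measure Ω) : EReal :=
  expLoss Qbar X - (divergence φ₁ Qbar Q : EReal) - (divergence φ₂ Q P₀ : EReal)

/-- `E_{Qbar}[-X] - I_{φ₁}(Qbar, Q)`, with `∞ - ∞ = -∞`. -/
noncomputable def ballObjective (φ₁ : ℝ → ℝ≥0∞) (X : Ω → ℝ) (Q Qbar : Measure Ω) : EReal :=
  expLoss Qbar X - (divergence φ₁ Qbar Q : EReal)

/-- Pairs of probability measures with `Qbar ≪ Q ≪ P₀`. -/
structure PenFeasible (P₀ Q Qbar : Measure Ω) : Prop where
  prob : IsProbabilityMeasure Q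
  prob_bar : IsProbabilityMeasure Qbar
  ac : Q ≪ P₀
  ac_bar : Qbar ≪ Q

/-- Pairs of probability measures with `Qbar ≪ Q` and `I_{φ₂}(Q, P₀) ≤ r`. -/
structure BallFeasible (P₀ : Measure Ω) (φ₂ : ℝ → ℝ≥0∞) (r : ℝ) (Q Qbar : Measure Ω) : Prop where
  prob : IsProbabilityMeasure Q
  prob_bar : IsProbabilityMeasure Qbar
  div_le : divergence φ₂ Q P₀ ≤ ENNReal.ofReal r
  ac_bar : Qbar ≪ Q

/-- The penalized robust optimized certainty equivalent `ρ^l`. -/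
noncomputable def robustOCEPen (P₀ : Measure Ω) (φ₁ φ₂ : ℝ → ℝ≥0∞) (X : Ω → ℝ) : EReal :=
  ⨆ (Q : Measure Ω) (Qbar : Measure Ω) (_ : PenFeasible P₀ Q Qbar), penObjective P₀ φ₁ φ₂ X Q Qbar

/-- The robust optimized certainty equivalent `ρ^s` over a divergence ball of radius `r`. -/
noncomputable def robustOCEBall (P₀ : Measure Ω) (φ₁ φ₂ : ℝ → ℝ≥0∞) (X : Ω → ℝ) (r : ℝ) : EReal :=
  ⨆ (Q : Measure Ω) (Qbar : Measure Ω) (_ : BallFeasible P₀ φ₂ r Q Qbar),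
    ballObjective φ₁ X Q Qbar

/-- The penalized objective as a single integral
`∫ (-X gbar - g φ₁(gbar / g) - φ₂(g)) dP₀`, where `g = dQ/dP₀`, `gbar = dQbar/dP₀`, and
`gbar / g = dQbar/dQ`. It agrees with `penObjective` unless the latter has the form `∞ - ∞`. -/
noncomputable def penObjectiveJoint (P₀ : Measure Ω) (φ₁ φ₂ : ℝ → ℝ≥0∞) (X : Ω → ℝ)
    (Q Qbar : Measure Ω) : EReal :=
  extIntegral P₀ (fun ω =>
    ((-X ω * (Qbar.rnDeriv P₀ ω).toReal : ℝ) : EReal)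
      - ((Q.rnDeriv P₀ ω * φ₁ (Qbar.rnDeriv Q ω).toReal : ℝ≥0∞) : EReal)
      - (φ₂ (Q.rnDeriv P₀ ω).toReal : EReal))

/-- The objective of the ball problem as a single integral `∫ (-X gbar - g φ₁(gbar / g)) dP₀`. -/
noncomputable def ballObjectiveJoint (P₀ : Measure Ω) (φ₁ : ℝ → ℝ≥0∞) (X : Ω → ℝ)
    (Q Qbar : Measure Ω) : EReal :=
  extIntegral P₀ (fun ω =>
    ((-X ω * (Qbar.rnDeriv P₀ ω).toReal : ℝ) : EReal)
      - ((Q.rnDeriv P₀ ω * φ₁ (Qbar.rnDeriv Q ω).toReal : ℝ≥0∞) : EReal))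

/-- `(Q, Qbar)` attains the maximum of the penalized primal problem. The objective is read as a
single integral; it also attains the maximum termwise unless the terms are of the form `∞ - ∞`. -/
structure AttainsPen (P₀ : Measure Ω) (φ₁ φ₂ : ℝ → ℝ≥0∞) (X : Ω → ℝ) (Q Qbar : Measure Ω) :
    Prop where
  feasible : PenFeasible P₀ Q Qbar
  joint_eq : penObjectiveJoint P₀ φ₁ φ₂ X Q Qbar = robustOCEPen P₀ φ₁ φ₂ X
  joint_max : ∀ Q' Qbar' : Measure Ω, PenFeasible P₀ Q' Qbar' →
    penObjectiveJoint P₀ φ₁ φ₂ X Q' Qbar' ≤ penObjectiveJoint P₀ φ₁ φ₂ X Q Qbar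
  termwise_eq : expLoss Qbar X < ⊤ ∨ divergence φ₁ Qbar Q + divergence φ₂ Q P₀ < ⊤ →
    penObjective P₀ φ₁ φ₂ X Q Qbar = robustOCEPen P₀ φ₁ φ₂ X

/-- `(Q, Qbar)` attains the maximum of the primal problem over the divergence ball. -/
structure AttainsBall (P₀ : Measure Ω) (φ₁ φ₂ : ℝ → ℝ≥0∞) (X : Ω → ℝ) (r : ℝ)
    (Q Qbar : Measure Ω) : Prop where
  feasible : BallFeasible P₀ φ₂ r Q Qbar
  joint_eq : ballObjectiveJoint P₀ φ₁ X Q Qbar = robustOCEBall P₀ φ₁ φ₂ X r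
  joint_max : ∀ Q' Qbar' : Measure Ω, BallFeasible P₀ φ₂ r Q' Qbar' →
    ballObjectiveJoint P₀ φ₁ X Q' Qbar' ≤ ballObjectiveJoint P₀ φ₁ X Q Qbar
  termwise_eq : expLoss Qbar X < ⊤ ∨ divergence φ₁ Qbar Q < ⊤ →
    ballObjective φ₁ X Q Qbar = robustOCEBall P₀ φ₁ φ₂ X r

/-! ### The dual problems -/

/-- `β*(ω, θ) = φ₂*(φ₁*(θ₂ - X ω) + θ₁)`. -/
noncomputable def betaPen (φ₁ φ₂ : ℝ → ℝ≥0∞) (X : Ω → ℝ) (θ₁ θ₂ : ℝ) (ω : Ω) : EReal :=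
  conjugate φ₂ (conjugate φ₁ ((θ₂ - X ω : ℝ) : EReal) + (θ₁ : EReal))

/-- `lam φ₂*((φ₁*(θ₂ - X ω) + θ₁) / lam)`. -/
noncomputable def betaBall (φ₁ φ₂ : ℝ → ℝ≥0∞) (X : Ω → ℝ) (θ₁ θ₂ lam : ℝ) (ω : Ω) : EReal :=
  scaledConjugate φ₂ lam (conjugate φ₁ ((θ₂ - X ω : ℝ) : EReal) + (θ₁ : EReal))

/-- `-θ₁ - θ₂ + E[φ₂*(φ₁*(θ₂ - X) + θ₁)]`. -/
noncomputable def dualPen (P₀ : Measure Ω) (φ₁ φ₂ : ℝ → ℝ≥0∞) (X : Ω → ℝ) (θ₁ θ₂ : ℝ) : EReal :=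
  ((-θ₁ - θ₂ : ℝ) : EReal) + extIntegral P₀ (betaPen φ₁ φ₂ X θ₁ θ₂)

/-- `-θ₁ - θ₂ + lam r + E[lam φ₂*((φ₁*(θ₂ - X) + θ₁) / lam)]`. -/
noncomputable def dualBall (P₀ : Measure Ω) (φ₁ φ₂ : ℝ → ℝ≥0∞) (X : Ω → ℝ) (r : ℝ)
    (θ₁ θ₂ lam : ℝ) : EReal :=
  ((-θ₁ - θ₂ + lam * r : ℝ) : EReal) + extIntegral P₀ (betaBall φ₁ φ₂ X θ₁ θ₂ lam)

/-- The same dual objective, with the integrand at `lam = 0` given by its limit as `lam ↓ 0`. -/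
noncomputable def closedDualBall (P₀ : Measure Ω) (φ₁ φ₂ : ℝ → ℝ≥0∞) (X : Ω → ℝ) (r : ℝ)
    (θ₁ θ₂ lam : ℝ) : EReal :=
  ((-θ₁ - θ₂ + lam * r : ℝ) : EReal) + extIntegral P₀ (fun ω =>
    closedScaledConjugate φ₂ lam (conjugate φ₁ ((θ₂ - X ω : ℝ) : EReal) + (θ₁ : EReal)))

/-- The set of `(θ₁, θ₂)` at which the integral of `β*` is finite. -/
def domPen (P₀ : Measure Ω) (φ₁ φ₂ : ℝ → ℝ≥0∞) (X : Ω → ℝ) : Set (ℝ × ℝ) :=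
  {p | extIntegral P₀ (betaPen φ₁ φ₂ X p.1 p.2) < ⊤}

/-- The set of `(θ₁, θ₂, lam)`, `lam ≥ 0`, at which the integral in the dual of the ball problem is
finite, as a subset of `ℝ³`. -/
def domBall (P₀ : Measure Ω) (φ₁ φ₂ : ℝ → ℝ≥0∞) (X : Ω → ℝ) : Set (ℝ × ℝ × ℝ) :=
  {p | 0 ≤ p.2.2 ∧ extIntegral P₀ (betaBall φ₁ φ₂ X p.1 p.2.1 p.2.2) < ⊤}

/-- The measure with density `g` with respect to `P₀`. -/
noncomputable def ofDensity (P₀ : Measure Ω) (g : Ω → ℝ) : Measure Ω :=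
  P₀.withDensity (fun ω => ENNReal.ofReal (g ω))

end RobustOCE

namespace RobustOCE

/-! ### Divergence functions and their conjugates -/

/-! Both identities are instances of Lagrange duality for a concave maximization over densities.
With `g = dQ/dP₀` and `gbar = g * u`, the penalty `g φ₁(gbar / g)` becomes `g φ₁(u)`, which is
jointly convex in `(g, g * u)`. The constraints are `∫ g = 1` and `∫ g u = 1`, together with `∫
φ₂(g) ≤ r` in the ball problem. The numbers `θ₁`, `θ₂`, `lam` are their multipliers, and the
pointwise supremum of the Lagrangian, first over `u` and then over `g`, is the dual integrand.

Weak duality is this pointwise Fenchel inequality (`joint_integrand_le`), integrated. For strong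
duality one restricts to bounded pairs (`AdmissiblePair`), for which every integral is finite. The
constraint values of such pairs, with the objective values below them, form a convex set. Constants
near `1` show that it surrounds the required constraint value, which is Slater's condition. When the
primal value is finite, Hahn-Banach (`exists_linear_le_of_convex`) gives a multiplier bounding the
integrated Lagrangian on all admissible pairs, and `extIntegral_dualIntegrand_le` moves the supremum
inside the integral. The multiplier then has dual value at most the primal one, so it is a dual
minimizer: attainment comes together with the duality.

At `lam = 0` the multiplier argument produces the support function of `dom φ₂`, so
`supportConjugate` is the form used throughout. It is at most the convention `0 φ₂*(s / 0)`, and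
coincides with it for `s ≠ -∞` once `(0, ∞)` lies in the domain. In general a multiplier with `lam =
0` is approximated by small positive ones, which gives the infimum in (2) without its attainment.

When the conjugates are differentiable, their derivatives are the pointwise maximizers
(`realConjugate_eq_deriv`). The Lagrangian is affine in the multipliers, so the dual integrand is
convex along lines, and one may differentiate under the integral at an interior minimizer.
Stationarity in `θ₁` and `θ₂` says that the two densities have mass one, and stationarity in `lam`
says that `∫ φ₂(g) = r`. Equality in Fenchel's inequality then makes the primal and dual values
agree. -/

/-- The function `s ↦ sup_t (t s - lam φ t)` over the effective domain of `φ`. -/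
noncomputable def supportConjugate (φ : ℝ → ℝ≥0∞) (lam : ℝ) (s : EReal) : EReal :=
  ⨆ t : {t : ℝ // φ t < ⊤}, ((t : ℝ) : EReal) * s - ((lam * (φ t).toReal : ℝ) : EReal)

namespace IsDivergenceFunction

variable {φ : ℝ → ℝ≥0∞} (hφ : IsDivergenceFunction φ)
include hφ

lemma nonneg_of_lt_top {t : ℝ} (ht : φ t < ⊤) : 0 ≤ t := by
  by_contra h
  rw [hφ.eq_top_of_neg t (not_le.mp h)] at ht
  exact lt_irrefl _ ht

lemma one_lt_top : φ 1 < ⊤ := by simp [hφ.map_one]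

lemma le_combo {x y a b : ℝ} (ha : 0 ≤ a) (hb : 0 ≤ b) (hab : a + b = 1) :
    φ (a * x + b * y) ≤ ENNReal.ofReal a * φ x + ENNReal.ofReal b * φ y := by
  lift a to ℝ≥0 using ha
  lift b to ℝ≥0 using hb
  have := hφ.convex.2 (Set.mem_univ x) (Set.mem_univ y) a.2 b.2
    (by exact_mod_cast hab : a + b = 1)
  simpa [NNReal.smul_def, ENNReal.smul_def] using this

lemma convexOn_toReal : ConvexOn ℝ {t | φ t < ⊤} (fun t => (φ t).toReal) := by
  have key : ∀ x, φ x < ⊤ → ∀ y, φ y < ⊤ → ∀ a b : ℝ, 0 ≤ a → 0 ≤ b → a + b = 1 →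
      ENNReal.ofReal a * φ x + ENNReal.ofReal b * φ y < ⊤ := fun x hx y hy a b _ _ _ =>
    ENNReal.add_lt_top.2 ⟨ENNReal.mul_lt_top ENNReal.ofReal_lt_top hx,
      ENNReal.mul_lt_top ENNReal.ofReal_lt_top hy⟩
  refine ⟨fun x hx y hy a b ha hb hab => ?_, fun x hx y hy a b ha hb hab => ?_⟩
  · exact (hφ.le_combo ha hb hab).trans_lt (key x hx y hy a b ha hb hab)
  · have h := ENNReal.toReal_mono (key x hx y hy a b ha hb hab).ne
      (hφ.le_combo (x := x) (y := y) ha hb hab)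
    rw [ENNReal.toReal_add (ENNReal.mul_lt_top ENNReal.ofReal_lt_top hx).ne
      (ENNReal.mul_lt_top ENNReal.ofReal_lt_top hy).ne, ENNReal.toReal_mul, ENNReal.toReal_mul,
      ENNReal.toReal_ofReal ha, ENNReal.toReal_ofReal hb] at h
    simpa using h

/-- Convexity with `φ 1 = 0` gives `φ q ≤ s φ t`, so `φ` cannot increase on the way towards `1`.
Rational approximation can therefore move towards `1`, and no continuity at the boundary of the
domain is needed. -/
lemma le_of_between {t q : ℝ} {s : ℝ} (hs : 0 ≤ s) (hs1 : s ≤ 1) (hq : q = s * t + (1 - s)) :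
    φ q ≤ φ t := by
  have := hφ.le_combo (x := t) (y := 1) hs (sub_nonneg.2 hs1) (by ring)
  rw [hφ.map_one, mul_zero, add_zero, mul_one, ← hq] at this
  refine this.trans ?_
  calc ENNReal.ofReal s * φ t ≤ 1 * φ t := by
        gcongr
        simpa using hs1
    _ = φ t := one_mul _

/-- Every point of the domain can be approximated by positive rationals at which `φ` is not
larger. -/
lemma exists_rat_near {t δ : ℝ} (ht : φ t < ⊤) (hδ : 0 < δ) :
    ∃ q : ℚ, 0 < (q : ℝ) ∧ |(q : ℝ) - t| < δ ∧ φ q ≤ φ t := by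
  have ht0 := hφ.nonneg_of_lt_top ht
  rcases lt_trichotomy t 1 with h | h | h
  · obtain ⟨q, hq1, hq2⟩ := exists_rat_btwn (lt_min h (lt_add_of_pos_right t hδ))
    rw [lt_min_iff] at hq2
    refine ⟨q, by linarith, by rw [abs_lt]; constructor <;> linarith, ?_⟩
    refine hφ.le_of_between (s := (1 - q) / (1 - t)) (div_nonneg (by linarith) (by linarith))
      ((div_le_one (by linarith)).2 (by linarith)) ?_
    have : (1 - t) ≠ 0 := by linarith
    field_simp
    ring
  · exact ⟨1, by simp, by simpa [h] using hδ, by simp [h]⟩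
  · obtain ⟨q, hq1, hq2⟩ := exists_rat_btwn (max_lt h (sub_lt_self t hδ))
    rw [max_lt_iff] at hq1
    refine ⟨q, by linarith, by rw [abs_lt]; constructor <;> linarith, ?_⟩
    refine hφ.le_of_between (s := (q - 1) / (t - 1)) (div_nonneg (by linarith) (by linarith))
      ((div_le_one (by linarith)).2 (by linarith)) ?_
    have : (t - 1) ≠ 0 := by linarith
    field_simp
    ring

lemma eventually_toReal_lt {ε : ℝ} (hε : 0 < ε) : ∀ᶠ t in nhds (1 : ℝ), (φ t).toReal < ε := by
  have h1 : (1 : ℝ) ∈ interior {t | φ t < ⊤} := mem_interior_iff_mem_nhds.2 hφ.lt_top_near_one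
  have hc := hφ.convexOn_toReal.continuousOn_interior.continuousAt
    (isOpen_interior.mem_nhds h1)
  have : (φ 1).toReal < ε := by simpa [hφ.map_one] using hε
  exact hc.eventually_lt continuousAt_const this

/-! Elementary properties of `supportConjugate`. -/

lemma le_supportConjugate (lam : ℝ) (s : EReal) : s ≤ supportConjugate φ lam s := by
  refine le_trans ?_ (le_iSup _ ⟨1, hφ.one_lt_top⟩)
  simp [hφ.map_one]

lemma supportConjugate_top (lam : ℝ) : supportConjugate φ lam ⊤ = ⊤ :=
  top_le_iff.1 (hφ.le_supportConjugate lam ⊤)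

omit hφ in
lemma _root_.RobustOCE.mul_sub_le_supportConjugate {t : ℝ} (ht : φ t < ⊤) (lam : ℝ) (s : EReal) :
    (t : EReal) * s - ((lam * (φ t).toReal : ℝ) : EReal) ≤ supportConjugate φ lam s :=
  le_iSup (fun t : {t : ℝ // φ t < ⊤} =>
    ((t : ℝ) : EReal) * s - ((lam * (φ t).toReal : ℝ) : EReal)) ⟨t, ht⟩

omit hφ in
lemma _root_.RobustOCE.supportConjugate_anti {lam lam' : ℝ} (h : lam ≤ lam') (s : EReal) :
    supportConjugate φ lam' s ≤ supportConjugate φ lam s := by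
  refine iSup_mono fun t => EReal.sub_le_sub le_rfl ?_
  exact_mod_cast mul_le_mul_of_nonneg_right h ENNReal.toReal_nonneg

omit hφ in
lemma _root_.RobustOCE.conjugate_eq_supportConjugate (φ : ℝ → ℝ≥0∞) (s : EReal) :
    conjugate φ s = supportConjugate φ 1 s := by
  refine le_antisymm (iSup_le fun t => ?_) (iSup_le fun t => ?_)
  · rcases eq_or_ne (φ t) ⊤ with h | h
    · simp [h]
    · refine le_trans (le_of_eq ?_) (mul_sub_le_supportConjugate (lt_top_iff_ne_top.2 h) 1 s)
      rw [one_mul, EReal.coe_ennreal_toReal h]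
  · refine le_trans (le_of_eq ?_) (le_iSup _ (t : ℝ))
    rw [one_mul, EReal.coe_ennreal_toReal t.2.ne]

lemma le_conjugate (s : EReal) : s ≤ conjugate φ s := by
  rw [conjugate_eq_supportConjugate]
  exact hφ.le_supportConjugate 1 s

/-- Multiplication by a positive finite `lam` commutes with the supremum and turns `t (s / lam) - φ
t` into `t s - lam φ t`. At `s = ⊤` both sides are `⊤`, because `t = 1` lies in the domain. -/
lemma mul_conjugate_div {lam : ℝ} (hlam : 0 < lam) {s : EReal} (hs : s ≠ ⊥) :
    (lam : EReal) * conjugate φ (s / (lam : EReal)) = supportConjugate φ lam s := by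
  have hl : (0 : EReal) < (lam : EReal) := by exact_mod_cast hlam
  rw [conjugate_eq_supportConjugate]
  induction s with
  | bot => exact absurd rfl hs
  | top =>
    rw [EReal.top_div_of_pos_ne_top hl (EReal.coe_ne_top _), hφ.supportConjugate_top,
      hφ.supportConjugate_top, EReal.coe_mul_top_of_pos hlam]
  | coe s =>
    rw [← EReal.coe_div]
    apply le_antisymm
    · rw [mul_comm, ← EReal.le_div_iff_mul_le hl (EReal.coe_ne_top _)]
      refine iSup_le fun t => ?_
      rw [EReal.le_div_iff_mul_le hl (EReal.coe_ne_top _)]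
      refine le_trans (le_of_eq ?_) (mul_sub_le_supportConjugate t.2 lam s)
      norm_cast
      field_simp
    · refine iSup_le fun t => ?_
      rw [← EReal.div_le_iff_le_mul hl (EReal.coe_ne_top _)]
      refine le_trans (le_of_eq ?_) (mul_sub_le_supportConjugate t.2 1 _)
      rw [← EReal.coe_mul, ← EReal.coe_sub, ← EReal.coe_div]
      norm_cast
      field_simp

lemma closedScaledConjugate_eq {lam : ℝ} (hlam : 0 ≤ lam) {s : EReal} (hs : s ≠ ⊥) :
    closedScaledConjugate φ lam s = supportConjugate φ lam s := by
  unfold closedScaledConjugate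
  split_ifs with h
  · simp [supportConjugate, h]
  · exact hφ.mul_conjugate_div (lt_of_le_of_ne hlam (Ne.symm h)) hs

lemma scaledConjugate_eq {lam : ℝ} (hlam : 0 < lam) {s : EReal} (hs : s ≠ ⊥) :
    scaledConjugate φ lam s = supportConjugate φ lam s := by
  rw [scaledConjugate, if_neg hlam.ne', hφ.mul_conjugate_div hlam hs]

/-- The domain lies in `[0, ∞)`, so no product `t s` is positive when `s ≤ 0`. For `s > 0` the right
side is `⊤`. -/
lemma supportConjugate_zero_le (s : EReal) : supportConjugate φ 0 s ≤ scaledConjugate φ 0 s := by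
  rw [scaledConjugate, if_pos rfl]
  split_ifs with h
  · refine iSup_le fun t => ?_
    have ht : (0 : EReal) ≤ ((t : ℝ) : EReal) := by exact_mod_cast hφ.nonneg_of_lt_top t.2
    simpa using EReal.mul_nonpos_iff.2 (Or.inl ⟨ht, h⟩)
  · exact le_top

lemma supportConjugate_le_scaledConjugate {lam : ℝ} (hlam : 0 ≤ lam) {s : EReal} (hs : s ≠ ⊥) :
    supportConjugate φ lam s ≤ scaledConjugate φ lam s := by
  rcases hlam.eq_or_lt with rfl | h
  · exact hφ.supportConjugate_zero_le s
  · exact (hφ.scaledConjugate_eq h hs).ge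

/-- When every positive `t` is allowed, `t → 0` gives the value `0` for `s ≤ 0`, and `t → ∞` gives
`∞` for `s > 0`. -/
lemma scaledConjugate_zero_eq (hdom : ∀ t : ℝ, 0 < t → φ t < ⊤) {s : EReal} (hs : s ≠ ⊥) :
    scaledConjugate φ 0 s = supportConjugate φ 0 s := by
  refine le_antisymm ?_ (hφ.supportConjugate_zero_le s)
  rw [scaledConjugate, if_pos rfl]
  induction s with
  | bot => exact absurd rfl hs
  | top => rw [hφ.supportConjugate_top]; exact le_top
  | coe s =>
    split_ifs with h
    · have hs0 : s ≤ 0 := by exact_mod_cast h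
      refine EReal.ge_of_forall_gt_iff_ge.1 fun z hz => ?_
      have hz0 : z < 0 := by exact_mod_cast hz
      -- The witness `t = z / (s - 1)` is positive and satisfies `t s ≥ z`. The shift by `1` covers
      -- `s = 0`.
      have hpos : 0 < z / (s - 1) := div_pos_of_neg_of_neg hz0 (by linarith)
      refine le_trans ?_ (mul_sub_le_supportConjugate (hdom _ hpos) 0 s)
      norm_cast
      rw [zero_mul, sub_zero, div_mul_eq_mul_div, le_div_iff_of_neg (by linarith)]
      linarith
    · have hs0 : 0 < s := by
        rw [not_le] at h
        exact_mod_cast h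
      refine EReal.ge_of_forall_gt_iff_ge.1 fun z hz => ?_
      have hpos : 0 < (|z| + 1) / s := by positivity
      refine le_trans ?_ (mul_sub_le_supportConjugate (hdom _ hpos) 0 s)
      norm_cast
      rw [zero_mul, sub_zero, div_mul_cancel₀ _ hs0.ne']
      linarith [le_abs_self z]

/-- In `supportConjugate`, only positive rational arguments matter. -/
lemma exists_rat_lt {lam c : ℝ} (hlam : 0 ≤ lam) {s : EReal} (hs : s ≠ ⊥)
    (hc : (c : EReal) < supportConjugate φ lam s) :
    ∃ q : ℚ, 0 < (q : ℝ) ∧ φ q < ⊤ ∧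
      (c : EReal) < (q : ℝ) * s - ((lam * (φ q).toReal : ℝ) : EReal) := by
  obtain ⟨⟨t, ht⟩, hlt⟩ := lt_iSup_iff.1 hc
  induction s with
  | bot => exact absurd rfl hs
  | top =>
    refine ⟨1, by simp, by simp [hφ.map_one], ?_⟩
    simp [hφ.map_one]
  | coe s =>
    norm_cast at hlt
    -- Moving `t` by less than this changes `t * s` by less than the slack in the strict inequality;
    -- the `+ 1` allows `s = 0`. The penalty does not grow under the move.
    have h0 : 0 < (t * s - lam * (φ t).toReal - c) / (|s| + 1) :=
      div_pos (by linarith) (by positivity)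
    obtain ⟨q, hq0, hqt, hq⟩ := hφ.exists_rat_near ht h0
    refine ⟨q, hq0, hq.trans_lt ht, ?_⟩
    norm_cast
    have h1 : lam * (φ q).toReal ≤ lam * (φ t).toReal :=
      mul_le_mul_of_nonneg_left (ENNReal.toReal_mono ht.ne hq) hlam
    rw [lt_div_iff₀ (by positivity)] at hqt
    have h2 : (t - q) * s ≤ |(q : ℝ) - t| * (|s| + 1) := by
      calc (t - q) * s ≤ |(t - q) * s| := le_abs_self _
        _ = |(q : ℝ) - t| * |s| := by rw [abs_mul, abs_sub_comm]
        _ ≤ _ := by gcongr; linarith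
    nlinarith

end IsDivergenceFunction

variable {Ω : Type*} [MeasurableSpace Ω]

/-! ### The extended integral -/

section ExtIntegral

variable {μ : Measure Ω}

lemma extIntegral_congr {f h : Ω → EReal} (hfh : f =ᵐ[μ] h) :
    extIntegral μ f = extIntegral μ h := by
  unfold extIntegral
  congr 2
  · exact lintegral_congr_ae (hfh.mono fun ω hω => by simp [hω])
  · exact lintegral_congr_ae (hfh.mono fun ω hω => by simp [hω])

lemma extIntegral_mono {f h : Ω → EReal} (hfh : ∀ᵐ ω ∂μ, f ω ≤ h ω) :
    extIntegral μ f ≤ extIntegral μ h := by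
  refine EReal.sub_le_sub ?_ ?_
  · exact_mod_cast lintegral_mono_ae (hfh.mono fun ω hω => EReal.toENNReal_le_toENNReal hω)
  · exact_mod_cast lintegral_mono_ae
      (hfh.mono fun ω hω => EReal.toENNReal_le_toENNReal (EReal.neg_le_neg_iff.2 hω))

lemma extIntegral_of_nonneg {f : Ω → EReal} (hf : ∀ ω, 0 ≤ f ω) :
    extIntegral μ f = ((∫⁻ ω, (f ω).toENNReal ∂μ : ℝ≥0∞) : EReal) := by
  have : ∀ ω, (-f ω).toENNReal = 0 := fun ω =>
    EReal.toENNReal_of_nonpos (EReal.neg_le_zero.2 (hf ω))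
  simp [extIntegral, this]

lemma coe_toReal_sub_toReal {a b : ℝ≥0∞} (ha : a ≠ ⊤) (hb : b ≠ ⊤) :
    ((a.toReal - b.toReal : ℝ) : EReal) = (a : EReal) - (b : EReal) := by
  rw [EReal.coe_sub, EReal.coe_ennreal_toReal ha, EReal.coe_ennreal_toReal hb]

lemma extIntegral_coe {f : Ω → ℝ} (hf : Integrable f μ) :
    extIntegral μ (fun ω => (f ω : EReal)) = ((∫ ω, f ω ∂μ : ℝ) : EReal) := by
  have h1 : ∫⁻ ω, ENNReal.ofReal (f ω) ∂μ ≠ ⊤ := by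
    refine ne_top_of_le_ne_top hf.2.ne (lintegral_mono fun ω => ?_)
    exact Real.ofReal_le_enorm _
  have h2 : ∫⁻ ω, ENNReal.ofReal (-f ω) ∂μ ≠ ⊤ := by
    refine ne_top_of_le_ne_top hf.2.ne (lintegral_mono fun ω => ?_)
    rw [← enorm_neg]
    exact Real.ofReal_le_enorm _
  rw [integral_eq_lintegral_pos_part_sub_lintegral_neg_part hf, coe_toReal_sub_toReal h1 h2]
  rfl

/-- The relation `x + y = (x + y)⁺ - (x + y)⁻` with all negative parts moved across, so that it
holds at `x = ±∞` and can be integrated in `ℝ≥0∞`. -/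
lemma posPart_negPart_identity (x : EReal) (y : ℝ) :
    (x + (y : EReal)).toENNReal + (-x).toENNReal + ENNReal.ofReal (-y)
      = (-(x + (y : EReal))).toENNReal + x.toENNReal + ENNReal.ofReal y := by
  induction x with
  | bot => simp
  | top => simp
  | coe x =>
    rw [← EReal.coe_add, ← EReal.coe_neg, ← EReal.coe_neg]
    simp only [EReal.real_coe_toENNReal]
    rw [← ENNReal.toReal_eq_toReal_iff' (by finiteness) (by finiteness)]
    repeat rw [ENNReal.toReal_add (by finiteness) (by finiteness)]
    simp only [ENNReal.toReal_ofReal']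
    have h1 := max_zero_sub_max_neg_zero_eq_self (x + y)
    have h2 := max_zero_sub_max_neg_zero_eq_self x
    have h3 := max_zero_sub_max_neg_zero_eq_self y
    linarith

/-- An integrable `h` has finite positive and negative parts, so it cannot change which of the two
parts of `f` has infinite integral. When both are finite, the integrated pointwise identity is
solved in `ℝ`. -/
lemma extIntegral_add {f : Ω → EReal} {h : Ω → ℝ} (hf : AEMeasurable f μ) (hh : Integrable h μ) :
    extIntegral μ (fun ω => f ω + (h ω : EReal))
      = extIntegral μ f + ((∫ ω, h ω ∂μ : ℝ) : EReal) := by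
  rw [← extIntegral_coe hh]
  have hp : ∫⁻ ω, ENNReal.ofReal (h ω) ∂μ ≠ ⊤ :=
    ne_top_of_le_ne_top hh.2.ne (lintegral_mono fun ω => Real.ofReal_le_enorm _)
  have hn : ∫⁻ ω, ENNReal.ofReal (-h ω) ∂μ ≠ ⊤ := by
    refine ne_top_of_le_ne_top hh.2.ne (lintegral_mono fun ω => ?_)
    rw [← enorm_neg]
    exact Real.ofReal_le_enorm _
  have mneg : AEMeasurable (fun ω => ENNReal.ofReal (-h ω)) μ := hh.aemeasurable.neg.ennreal_ofReal
  have mn : ∀ {k : Ω → EReal}, AEMeasurable k μ → AEMeasurable (fun ω => (-k ω).toENNReal) μ :=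
    fun hk => (measurable_ereal_toENNReal.comp measurable_neg).comp_aemeasurable hk
  have key : (∫⁻ ω, (f ω + (h ω : EReal)).toENNReal ∂μ) + (∫⁻ ω, (-f ω).toENNReal ∂μ)
        + ∫⁻ ω, ENNReal.ofReal (-h ω) ∂μ
      = (∫⁻ ω, (-(f ω + (h ω : EReal))).toENNReal ∂μ) + (∫⁻ ω, (f ω).toENNReal ∂μ)
        + ∫⁻ ω, ENNReal.ofReal (h ω) ∂μ := by
    rw [← lintegral_add_right' _ (mn hf), ← lintegral_add_right' _ hf.ereal_toENNReal,
      ← lintegral_add_right' _ mneg,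
      ← lintegral_add_right' _ hh.aemeasurable.ennreal_ofReal]
    exact lintegral_congr fun ω => posPart_negPart_identity _ _
  have hP : (∫⁻ ω, (f ω).toENNReal ∂μ) ≤ (∫⁻ ω, (f ω + (h ω : EReal)).toENNReal ∂μ)
      + ∫⁻ ω, ENNReal.ofReal (-h ω) ∂μ := by
    rw [← lintegral_add_right' _ mneg]
    refine lintegral_mono fun ω => ?_
    have := EReal.toENNReal_add_le (x := f ω + (h ω : EReal)) (y := ((-h ω : ℝ) : EReal))
    rwa [EReal.coe_neg, ← sub_eq_add_neg, EReal.add_sub_cancel_right, ← EReal.coe_neg] at this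
  have hN : (∫⁻ ω, (-f ω).toENNReal ∂μ) ≤ (∫⁻ ω, (-(f ω + (h ω : EReal))).toENNReal ∂μ)
      + ∫⁻ ω, ENNReal.ofReal (h ω) ∂μ := by
    rw [← lintegral_add_right' _ hh.aemeasurable.ennreal_ofReal]
    refine lintegral_mono fun ω => ?_
    have := EReal.toENNReal_add_le (x := -(f ω + (h ω : EReal))) (y := ((h ω : ℝ) : EReal))
    rw [EReal.neg_add (by simp) (by simp)] at this ⊢
    rwa [EReal.sub_add_cancel] at this
  have hP' : (∫⁻ ω, (f ω + (h ω : EReal)).toENNReal ∂μ) ≤ (∫⁻ ω, (f ω).toENNReal ∂μ)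
      + ∫⁻ ω, ENNReal.ofReal (h ω) ∂μ := by
    rw [← lintegral_add_right' _ hh.aemeasurable.ennreal_ofReal]
    exact lintegral_mono fun ω => EReal.toENNReal_add_le
  have hN' : (∫⁻ ω, (-(f ω + (h ω : EReal))).toENNReal ∂μ) ≤ (∫⁻ ω, (-f ω).toENNReal ∂μ)
      + ∫⁻ ω, ENNReal.ofReal (-h ω) ∂μ := by
    rw [← lintegral_add_right' _ mneg]
    refine lintegral_mono fun ω => ?_
    rw [EReal.neg_add (by simp) (by simp), sub_eq_add_neg]
    exact EReal.toENNReal_add_le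
  unfold extIntegral
  simp only [EReal.real_coe_toENNReal, ← EReal.coe_neg] at *
  generalize (∫⁻ ω, (f ω + (h ω : EReal)).toENNReal ∂μ) = P' at *
  generalize (∫⁻ ω, (-(f ω + (h ω : EReal))).toENNReal ∂μ) = N' at *
  generalize (∫⁻ ω, (f ω).toENNReal ∂μ) = P at *
  generalize (∫⁻ ω, (-f ω).toENNReal ∂μ) = N at *
  generalize (∫⁻ ω, ENNReal.ofReal (h ω) ∂μ) = p at *
  generalize (∫⁻ ω, ENNReal.ofReal (-h ω) ∂μ) = n at *
  rw [← coe_toReal_sub_toReal hp hn]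
  -- The negative part is treated first because `∞ - ∞ = -∞`: if it is infinite, both sides are `⊥`
  -- whatever the positive part.
  rcases eq_or_ne N ⊤ with hNt | hNt
  · have : N' = ⊤ := by
      by_contra hc
      rw [hNt] at hN
      exact (ENNReal.add_ne_top.2 ⟨hc, hp⟩) (top_le_iff.1 hN)
    simp [hNt, this]
  · have hNt' : N' ≠ ⊤ := ne_top_of_le_ne_top (ENNReal.add_ne_top.2 ⟨hNt, hn⟩) hN'
    rcases eq_or_ne P ⊤ with hPt | hPt
    · have : P' = ⊤ := by
        by_contra hc
        rw [hPt] at hP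
        exact (ENNReal.add_ne_top.2 ⟨hc, hn⟩) (top_le_iff.1 hP)
      rw [hPt, this, ← EReal.coe_ennreal_toReal hNt, ← EReal.coe_ennreal_toReal hNt']
      simp only [EReal.coe_ennreal_top, EReal.top_sub_coe, EReal.top_add_coe]
    · have hPt' : P' ≠ ⊤ := ne_top_of_le_ne_top (ENNReal.add_ne_top.2 ⟨hPt, hp⟩) hP'
      rw [← coe_toReal_sub_toReal hPt hNt, ← coe_toReal_sub_toReal hPt' hNt']
      have := congrArg ENNReal.toReal key
      repeat rw [ENNReal.toReal_add (by finiteness) (by finiteness)] at this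
      norm_cast
      linarith

/-- The integrable lower bound makes the negative part finite, so an infinite positive part would
force the value `⊤`. -/
lemma integrable_of_extIntegral_lt_top {f h : Ω → ℝ} (hf : AEMeasurable f μ) (hh : Integrable h μ)
    (hhf : ∀ᵐ ω ∂μ, h ω ≤ f ω) (hlt : extIntegral μ (fun ω => (f ω : EReal)) < ⊤) :
    Integrable f μ := by
  have hn : ∫⁻ ω, ENNReal.ofReal (-f ω) ∂μ ≠ ⊤ := by
    refine ne_top_of_le_ne_top hh.2.ne (lintegral_mono_ae (hhf.mono fun ω hω => ?_))
    rw [← enorm_neg]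
    exact (ENNReal.ofReal_le_ofReal (neg_le_neg hω)).trans (Real.ofReal_le_enorm _)
  have hp : ∫⁻ ω, ENNReal.ofReal (f ω) ∂μ ≠ ⊤ := by
    intro h
    refine hlt.ne ?_
    change ((∫⁻ ω, ENNReal.ofReal (f ω) ∂μ : ℝ≥0∞) : EReal)
      - ((∫⁻ ω, ENNReal.ofReal (-f ω) ∂μ : ℝ≥0∞) : EReal) = ⊤
    rw [h, ← EReal.coe_ennreal_toReal hn]
    simp
  refine ⟨hf.aestronglyMeasurable, ?_⟩
  have : ∀ ω, ‖f ω‖ₑ = ENNReal.ofReal (f ω) + ENNReal.ofReal (-f ω) := by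
    intro ω
    rw [Real.enorm_eq_ofReal_abs]
    rcases le_total 0 (f ω) with h | h
    · rw [abs_of_nonneg h, ENNReal.ofReal_of_nonpos (neg_nonpos.2 h), add_zero]
    · rw [abs_of_nonpos h, ENNReal.ofReal_of_nonpos h, zero_add]
  rw [HasFiniteIntegral]
  simp_rw [this]
  have mneg : AEMeasurable (fun ω => ENNReal.ofReal (-f ω)) μ := hf.neg.ennreal_ofReal
  rw [lintegral_add_right' _ mneg]
  exact ENNReal.add_lt_top.2 ⟨hp.lt_top, hn.lt_top⟩

lemma extIntegral_sub_of_lintegral_ne_top {a : Ω → ℝ} {b : Ω → ℝ≥0∞} (ha : AEMeasurable a μ)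
    (hb : AEMeasurable b μ) (hbt : ∫⁻ ω, b ω ∂μ ≠ ⊤) :
    extIntegral μ (fun ω => (a ω : EReal) - (b ω : EReal))
      = extIntegral μ (fun ω => (a ω : EReal)) - ((∫⁻ ω, b ω ∂μ : ℝ≥0∞) : EReal) := by
  have hfin := ae_lt_top' hb hbt
  have hint : Integrable (fun ω => -(b ω).toReal) μ :=
    (integrable_toReal_of_lintegral_ne_top hb hbt).neg
  rw [extIntegral_congr (h := fun ω => (a ω : EReal) + ((-(b ω).toReal : ℝ) : EReal)),
    extIntegral_add ha.coe_real_ereal hint, integral_neg, integral_toReal hb hfin, EReal.coe_neg,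
    EReal.coe_ennreal_toReal hbt, sub_eq_add_neg]
  filter_upwards [hfin] with ω hω
  rw [EReal.coe_neg, EReal.coe_ennreal_toReal hω.ne, sub_eq_add_neg]

/-- An infinite total penalty makes the termwise value `-∞`, while cancellation under a single
integral may leave more. This is why joint objectives dominate termwise ones. -/
lemma extIntegral_sub_lintegral_le {a : Ω → ℝ} {b : Ω → ℝ≥0∞} (ha : AEMeasurable a μ)
    (hb : AEMeasurable b μ) :
    extIntegral μ (fun ω => (a ω : EReal)) - ((∫⁻ ω, b ω ∂μ : ℝ≥0∞) : EReal)
      ≤ extIntegral μ (fun ω => (a ω : EReal) - (b ω : EReal)) := by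
  rcases eq_or_ne (∫⁻ ω, b ω ∂μ) ⊤ with h | h
  · simp [h]
  · exact (extIntegral_sub_of_lintegral_ne_top ha hb h).ge

lemma extIntegral_sub_lintegral_eq {a : Ω → ℝ} {b : Ω → ℝ≥0∞} (ha : AEMeasurable a μ)
    (hb : AEMeasurable b μ)
    (h : extIntegral μ (fun ω => (a ω : EReal)) < ⊤ ∨ ∫⁻ ω, b ω ∂μ < ⊤) :
    extIntegral μ (fun ω => (a ω : EReal)) - ((∫⁻ ω, b ω ∂μ : ℝ≥0∞) : EReal)
      = extIntegral μ (fun ω => (a ω : EReal) - (b ω : EReal)) := by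
  rcases eq_or_ne (∫⁻ ω, b ω ∂μ) ⊤ with hb' | hb'
  · have hlt := h.resolve_right (by simp [hb'])
    rw [hb', EReal.coe_ennreal_top, EReal.sub_top]
    symm
    -- If this integral were finite, `a⁻ ≤ (a - b)⁻` would make `∫ a⁻` finite, hence also `∫ a⁺`,
    -- since the value of `a` is below `⊤`. Then `b ≤ (a - b)⁻ + a⁺` contradicts `∫ b = ∞`.
    have hneg : ∫⁻ ω, (-((a ω : EReal) - (b ω : EReal))).toENNReal ∂μ = ⊤ := by
      by_contra hc
      have h1 : ∫⁻ ω, ENNReal.ofReal (-a ω) ∂μ ≠ ⊤ := by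
        refine ne_top_of_le_ne_top hc (lintegral_mono fun ω => ?_)
        rw [← EReal.real_coe_toENNReal, EReal.coe_neg]
        refine EReal.toENNReal_le_toENNReal (EReal.neg_le_neg_iff.2 ?_)
        exact EReal.sub_le_of_le_add (le_add_of_nonneg_right (EReal.coe_ennreal_nonneg _))
      have h2 : ∫⁻ ω, ENNReal.ofReal (a ω) ∂μ ≠ ⊤ := by
        intro h2
        refine hlt.ne ?_
        change ((∫⁻ ω, ENNReal.ofReal (a ω) ∂μ : ℝ≥0∞) : EReal)
          - ((∫⁻ ω, ENNReal.ofReal (-a ω) ∂μ : ℝ≥0∞) : EReal) = ⊤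
        rw [h2, ← EReal.coe_ennreal_toReal h1]
        simp
      refine ENNReal.add_ne_top.2 ⟨hc, h2⟩ ?_
      rw [← lintegral_add_right' _ ha.ennreal_ofReal, ← top_le_iff, ← hb']
      refine lintegral_mono fun ω => ?_
      have := EReal.toENNReal_add_le (x := -((a ω : EReal) - (b ω : EReal))) (y := (a ω : EReal))
      rw [EReal.real_coe_toENNReal, EReal.neg_sub (by simp) (by simp), add_comm (-(a ω : EReal)),
        ← sub_eq_add_neg, EReal.sub_add_cancel, EReal.toENNReal_coe] at this
      convert this using 4
      rw [EReal.neg_sub (by simp) (by simp), add_comm, sub_eq_add_neg]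
    rw [extIntegral, hneg]
    simp
  · exact (extIntegral_sub_of_lintegral_ne_top ha hb hb').symm

end ExtIntegral

/-! ### A supporting hyperplane for a convex set of values -/

/-- Lagrange multipliers: a convex set `A` of points and values whose points surround `x₀` and whose
values over `x₀` are at most `ρ` lies below an affine function with value `ρ` at `x₀`. -/
theorem exists_linear_le_of_convex {E : Type*} [AddCommGroup E] [Module ℝ E] {A : Set (E × ℝ)}
    (hA : Convex ℝ A) {x₀ : E} {ρ : ℝ} (habs : ∀ d : E, ∃ t : ℝ, 0 < t ∧ ∃ c, (x₀ + t • d, c) ∈ A)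
    (hρ : ∀ c, (x₀, c) ∈ A → c ≤ ρ) :
    ∃ ℓ : E →ₗ[ℝ] ℝ, ∀ x c, (x, c) ∈ A → c ≤ ρ + ℓ (x - x₀) := by
  -- The slopes at which the values fall below `ρ` in direction `d`. Their infimum is a sublinear
  -- function of `d`, and a linear minorant of it is a supporting hyperplane up to sign.
  set S : E → Set ℝ := fun d => {z | ∃ t : ℝ, 0 < t ∧ ∃ c, (x₀ + t • d, c) ∈ A ∧ z = (ρ - c) / t}
    with hS
  have hne : ∀ d, (S d).Nonempty := fun d => by
    obtain ⟨t, ht, c, hc⟩ := habs d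
    exact ⟨_, t, ht, c, hc, rfl⟩
  have hadd : ∀ d e z w, z ∈ S d → w ∈ S e → z + w ∈ S (d + e) := by
    rintro d e _ _ ⟨t, ht, c, hc, rfl⟩ ⟨t', ht', c', hc', rfl⟩
    have hs : 0 < t + t' := by positivity
    -- The weights `t' / (t + t')` and `t / (t + t')` equalize the two step lengths, so the combined
    -- point lies in direction `d + e` and the slopes add exactly.
    refine ⟨t * t' / (t + t'), by positivity, (t' * c + t * c') / (t + t'), ?_, ?_⟩
    · have := hA hc hc' (a := t' / (t + t')) (b := t / (t + t')) (by positivity) (by positivity)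
        (by field_simp; ring)
      convert this using 1
      ext1
      · simp only [Prod.fst_add, Prod.smul_fst, smul_add, smul_smul]
        have e1 : t' / (t + t') * t = t * t' / (t + t') := by ring
        have e2 : t / (t + t') * t' = t * t' / (t + t') := by ring
        have e3 : (t' / (t + t')) • x₀ + (t / (t + t')) • x₀ = x₀ := by
          rw [← add_smul, ← add_div, add_comm t', div_self hs.ne', one_smul]
        rw [e1, e2]
        nth_rewrite 1 [← e3]
        abel
      · simp only [Prod.snd_add, Prod.smul_snd, smul_eq_mul]
        ring
    · field_simp
      ring
  have hzero : ∀ z ∈ S 0, 0 ≤ z := by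
    rintro _ ⟨t, ht, c, hc, rfl⟩
    rw [smul_zero, add_zero] at hc
    exact div_nonneg (sub_nonneg.2 (hρ c hc)) ht.le
  have hbdd : ∀ d, BddBelow (S d) := fun d => by
    obtain ⟨w, hw⟩ := hne (-d)
    refine ⟨-w, fun z hz => ?_⟩
    have := hzero (z + w) (by simpa using hadd _ _ _ _ hz hw)
    linarith
  have hsmul : ∀ (a : ℝ), 0 < a → ∀ d, S (a • d) = (fun z => a * z) '' S d := by
    intro a ha d
    ext z
    constructor
    · rintro ⟨t, ht, c, hc, rfl⟩
      refine ⟨(ρ - c) / (t * a), ⟨t * a, by positivity, c, by rwa [mul_smul], rfl⟩, ?_⟩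
      field_simp
    · rintro ⟨_, ⟨t, ht, c, hc, rfl⟩, rfl⟩
      refine ⟨t / a, by positivity, c, by rwa [smul_smul, div_mul_cancel₀ _ ha.ne'], ?_⟩
      field_simp
  -- Hahn-Banach from the zero subspace. It is purely algebraic, so `E` needs no topology.
  obtain ⟨g, -, hg⟩ := exists_extension_of_le_sublinear (E := E) ⟨⊥, 0⟩ (fun d => sInf (S d))
    (fun a ha d => by
      rw [hsmul a ha, ← smul_eq_mul, ← Real.sInf_smul_of_nonneg ha.le]
      rfl)
    (fun d e => by
      rw [← sub_le_iff_le_add]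
      refine le_csInf (hne d) fun z hz => ?_
      rw [sub_le_comm]
      refine le_csInf (hne e) fun w hw => ?_
      have := csInf_le (hbdd _) (hadd _ _ _ _ hz hw)
      linarith)
    (fun x => by
      have hx : (x : E) = 0 := (Submodule.mem_bot ℝ).1 x.2
      rw [hx]
      exact le_csInf (hne 0) hzero)
  refine ⟨-g, fun x c hc => ?_⟩
  have h1 : g (x - x₀) ≤ ρ - c :=
    (hg (x - x₀)).trans (csInf_le (hbdd _) ⟨1, one_pos, c, by simpa using hc, by simp⟩)
  simp only [LinearMap.neg_apply]
  linarith

/-! ### The integrand of the Lagrangian -/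

/-- The Lagrangian integrand at the densities `g = t` and `gbar = t * u`. -/
noncomputable def lagrangian (φ₁ φ₂ : ℝ → ℝ≥0∞) (lam θ₁ θ₂ x t u : ℝ) : ℝ :=
  t * (u * (θ₂ - x) - (φ₁ u).toReal + θ₁) - lam * (φ₂ t).toReal

/-- The dual integrand `sup_t (t (φ₁*(θ₂ - x) + θ₁) - lam φ₂ t)`. -/
noncomputable def dualIntegrand (φ₁ φ₂ : ℝ → ℝ≥0∞) (lam θ₁ θ₂ x : ℝ) : EReal :=
  supportConjugate φ₂ lam (conjugate φ₁ ((θ₂ - x : ℝ) : EReal) + (θ₁ : EReal))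

section Lagrangian

variable {φ₁ φ₂ : ℝ → ℝ≥0∞}

lemma inner_ne_bot (hφ₁ : IsDivergenceFunction φ₁) (y θ₁ : ℝ) :
    conjugate φ₁ (y : EReal) + (θ₁ : EReal) ≠ ⊥ := by
  rw [EReal.add_ne_bot_iff]
  exact ⟨((EReal.bot_lt_coe _).trans_le (hφ₁.le_conjugate _)).ne', EReal.coe_ne_bot _⟩

lemma le_conjugate_of_lt_top {u : ℝ} (hu : φ₁ u < ⊤) (y : ℝ) :
    ((u * y - (φ₁ u).toReal : ℝ) : EReal) ≤ conjugate φ₁ (y : EReal) := by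
  rw [conjugate_eq_supportConjugate]
  refine le_trans (le_of_eq ?_) (mul_sub_le_supportConjugate hu 1 _)
  rw [one_mul]
  norm_cast

lemma lagrangian_le_dualIntegrand (hφ₂ : IsDivergenceFunction φ₂) {t u : ℝ} (ht : φ₂ t < ⊤)
    (hu : φ₁ u < ⊤) (lam θ₁ θ₂ x : ℝ) :
    (lagrangian φ₁ φ₂ lam θ₁ θ₂ x t u : EReal) ≤ dualIntegrand φ₁ φ₂ lam θ₁ θ₂ x := by
  refine le_trans ?_ (mul_sub_le_supportConjugate ht lam _)
  rw [lagrangian, EReal.coe_sub, EReal.coe_mul]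
  refine EReal.sub_le_sub ?_ le_rfl
  have ht0 : (0 : EReal) ≤ (t : EReal) := by exact_mod_cast hφ₂.nonneg_of_lt_top ht
  refine mul_le_mul_of_nonneg_left ?_ ht0
  rw [EReal.coe_add]
  exact add_le_add_left (le_conjugate_of_lt_top hu _) _

/-- Restricting to rational `t` and `u` makes the supremum countable, as the interchange with the
integral requires. -/
lemma exists_rat_lt_lagrangian (hφ₁ : IsDivergenceFunction φ₁) (hφ₂ : IsDivergenceFunction φ₂)
    {lam : ℝ} (hlam : 0 ≤ lam) {θ₁ θ₂ x c : ℝ}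
    (hc : (c : EReal) < dualIntegrand φ₁ φ₂ lam θ₁ θ₂ x) :
    ∃ p : ℚ × ℚ, (0 < (p.1 : ℝ) ∧ φ₂ p.1 < ⊤ ∧ φ₁ p.2 < ⊤) ∧
      c < lagrangian φ₁ φ₂ lam θ₁ θ₂ x p.1 p.2 := by
  obtain ⟨q, hq0, hq, hlt⟩ := hφ₂.exists_rat_lt hlam (inner_ne_bot hφ₁ _ _) hc
  have hq0' : (0 : EReal) < ((q : ℝ) : EReal) := by exact_mod_cast hq0
  -- With the outer `q > 0` fixed, the strict inequality is solved for the inner conjugate, which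
  -- leaves a threshold that some rational `u` still exceeds.
  have h1 : (((c + lam * (φ₂ q).toReal) / q - θ₁ : ℝ) : EReal)
      < conjugate φ₁ ((θ₂ - x : ℝ) : EReal) := by
    rw [EReal.coe_sub]
    refine EReal.sub_lt_of_lt_add ?_
    rw [EReal.coe_div, EReal.div_lt_iff hq0' (EReal.coe_ne_top _), EReal.coe_add,
      mul_comm (conjugate φ₁ ((θ₂ - x : ℝ) : EReal) + (θ₁ : EReal))]
    exact EReal.add_lt_of_lt_sub hlt
  rw [conjugate_eq_supportConjugate] at h1
  obtain ⟨p, -, hp, hlt'⟩ := hφ₁.exists_rat_lt zero_le_one (EReal.coe_ne_bot _) h1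
  refine ⟨(q, p), ⟨hq0, hq, hp⟩, ?_⟩
  norm_cast at hlt'
  rw [sub_lt_iff_lt_add, div_lt_iff₀ hq0] at hlt'
  rw [lagrangian]
  linarith

end Lagrangian

/-! ### Admissible densities -/

/-- Bounded densities `g > 0` and `gbar = g * u` with values in the effective domains. -/
structure AdmissiblePair (φ₁ φ₂ : ℝ → ℝ≥0∞) (g u : Ω → ℝ) : Prop where
  meas_g : Measurable g
  meas_u : Measurable u
  pos : ∀ ω, 0 < g ω
  dom₁ : ∀ ω, φ₁ (u ω) < ⊤
  dom₂ : ∀ ω, φ₂ (g ω) < ⊤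
  bdd : ∃ B : ℝ, ∀ ω, g ω ≤ B ∧ g ω * u ω ≤ B ∧ g ω * (φ₁ (u ω)).toReal ≤ B ∧
    (φ₂ (g ω)).toReal ≤ B

namespace AdmissiblePair

variable {φ₁ φ₂ : ℝ → ℝ≥0∞} {g u g' u' : Ω → ℝ}

lemma const {t s : ℝ} (ht : 0 < t) (h₂ : φ₂ t < ⊤) (h₁ : φ₁ s < ⊤) :
    AdmissiblePair φ₁ φ₂ (fun _ : Ω => t) (fun _ : Ω => s) :=
  ⟨measurable_const, measurable_const, fun _ => ht, fun _ => h₁, fun _ => h₂,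
    max (max t (t * s)) (max (t * (φ₁ s).toReal) (φ₂ t).toReal), fun _ => by simp⟩

open Classical in
lemma piecewise (h : AdmissiblePair φ₁ φ₂ g u) (h' : AdmissiblePair φ₁ φ₂ g' u') {s : Set Ω}
    (hs : MeasurableSet s) : AdmissiblePair φ₁ φ₂ (s.piecewise g g') (s.piecewise u u') := by
  obtain ⟨B, hB⟩ := h.bdd
  obtain ⟨B', hB'⟩ := h'.bdd
  refine ⟨h.meas_g.piecewise hs h'.meas_g, h.meas_u.piecewise hs h'.meas_u, fun ω => ?_,
    fun ω => ?_, fun ω => ?_, max B B', fun ω => ?_⟩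
  all_goals by_cases hω : ω ∈ s
  all_goals simp only [hω, Set.piecewise_eq_of_mem, Set.piecewise_eq_of_notMem, not_false_eq_true,
    h.pos, h'.pos, h.dom₁, h'.dom₁, h.dom₂, h'.dom₂, le_max_iff, (hB ω).1, (hB ω).2.1,
    (hB ω).2.2.1, (hB ω).2.2.2, (hB' ω).1, (hB' ω).2.1, (hB' ω).2.2.1, (hB' ω).2.2.2, true_or,
    or_true, and_self]

variable (hφ₁ : IsDivergenceFunction φ₁) (hφ₂ : IsDivergenceFunction φ₂)
  (hm₁ : Measurable φ₁) (hm₂ : Measurable φ₂)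

section Integrability

variable {P₀ : Measure Ω} [IsProbabilityMeasure P₀] {X : Ω → ℝ}

include hφ₁ in
lemma u_nonneg (h : AdmissiblePair φ₁ φ₂ g u) (ω : Ω) : 0 ≤ u ω :=
  hφ₁.nonneg_of_lt_top (h.dom₁ ω)

lemma integrable_g (h : AdmissiblePair φ₁ φ₂ g u) : Integrable g P₀ := by
  obtain ⟨B, hB⟩ := h.bdd
  refine Integrable.of_bound h.meas_g.aestronglyMeasurable B (.of_forall fun ω => ?_)
  rw [Real.norm_of_nonneg (h.pos ω).le]
  exact (hB ω).1

include hφ₁ in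
lemma integrable_mul (h : AdmissiblePair φ₁ φ₂ g u) : Integrable (fun ω => g ω * u ω) P₀ := by
  obtain ⟨B, hB⟩ := h.bdd
  refine Integrable.of_bound (h.meas_g.mul h.meas_u).aestronglyMeasurable B (.of_forall fun ω => ?_)
  rw [Real.norm_of_nonneg (mul_nonneg (h.pos ω).le (h.u_nonneg hφ₁ ω))]
  exact (hB ω).2.1

omit [IsProbabilityMeasure P₀] in
include hφ₁ in
lemma integrable_mul_X (h : AdmissiblePair φ₁ φ₂ g u) (hX : Integrable X P₀) :
    Integrable (fun ω => X ω * (g ω * u ω)) P₀ := by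
  obtain ⟨B, hB⟩ := h.bdd
  refine hX.mul_bdd (c := B) (h.meas_g.mul h.meas_u).aestronglyMeasurable (.of_forall fun ω => ?_)
  rw [Real.norm_of_nonneg (mul_nonneg (h.pos ω).le (h.u_nonneg hφ₁ ω))]
  exact (hB ω).2.1

include hm₁ in
lemma integrable_mul_phi (h : AdmissiblePair φ₁ φ₂ g u) :
    Integrable (fun ω => g ω * (φ₁ (u ω)).toReal) P₀ := by
  obtain ⟨B, hB⟩ := h.bdd
  refine Integrable.of_bound
    (h.meas_g.mul (hm₁.comp h.meas_u).ennreal_toReal).aestronglyMeasurable B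
    (.of_forall fun ω => ?_)
  rw [Real.norm_of_nonneg (mul_nonneg (h.pos ω).le ENNReal.toReal_nonneg)]
  exact (hB ω).2.2.1

include hm₂ in
lemma integrable_phi (h : AdmissiblePair φ₁ φ₂ g u) :
    Integrable (fun ω => (φ₂ (g ω)).toReal) P₀ := by
  obtain ⟨B, hB⟩ := h.bdd
  refine Integrable.of_bound (hm₂.comp h.meas_g).ennreal_toReal.aestronglyMeasurable B
    (.of_forall fun ω => ?_)
  rw [Real.norm_of_nonneg ENNReal.toReal_nonneg]
  exact (hB ω).2.2.2

include hφ₁ hm₁ in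
lemma integrable_ball (h : AdmissiblePair φ₁ φ₂ g u) (hX : Integrable X P₀) :
    Integrable (fun ω => -X ω * (g ω * u ω) - g ω * (φ₁ (u ω)).toReal) P₀ := by
  simp_rw [neg_mul]
  exact (h.integrable_mul_X hφ₁ hX).neg.sub (h.integrable_mul_phi hm₁)

lemma lagrangian_eq (lam θ₁ θ₂ x t s : ℝ) : lagrangian φ₁ φ₂ lam θ₁ θ₂ x t s
    = θ₁ * t + θ₂ * (t * s) + (-x * (t * s) - t * (φ₁ s).toReal) - lam * (φ₂ t).toReal := by
  rw [lagrangian]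
  ring

include hφ₁ hm₁ hm₂ in
lemma integrable_lagrangian (h : AdmissiblePair φ₁ φ₂ g u) (hX : Integrable X P₀)
    (lam θ₁ θ₂ : ℝ) :
    Integrable (fun ω => lagrangian φ₁ φ₂ lam θ₁ θ₂ (X ω) (g ω) (u ω)) P₀ := by
  simp_rw [lagrangian_eq]
  exact (((h.integrable_g.const_mul _).add ((h.integrable_mul hφ₁).const_mul _)).add
    (h.integrable_ball hφ₁ hm₁ hX)).sub ((h.integrable_phi hm₂).const_mul _)

include hφ₁ hm₁ hm₂ in
lemma integral_lagrangian (h : AdmissiblePair φ₁ φ₂ g u) (hX : Integrable X P₀)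
    (lam θ₁ θ₂ : ℝ) :
    ∫ ω, lagrangian φ₁ φ₂ lam θ₁ θ₂ (X ω) (g ω) (u ω) ∂P₀
      = θ₁ * (∫ ω, g ω ∂P₀) + θ₂ * (∫ ω, g ω * u ω ∂P₀)
        + (∫ ω, (-X ω * (g ω * u ω) - g ω * (φ₁ (u ω)).toReal) ∂P₀)
        - lam * (∫ ω, (φ₂ (g ω)).toReal ∂P₀) := by
  simp_rw [lagrangian_eq]
  have i1 := (h.integrable_g (P₀ := P₀)).const_mul θ₁
  have i2 := (h.integrable_mul hφ₁ (P₀ := P₀)).const_mul θ₂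
  have i3 := h.integrable_ball hφ₁ hm₁ hX
  have i4 := (h.integrable_phi hm₂ (P₀ := P₀)).const_mul lam
  have i12 : Integrable (fun ω => θ₁ * g ω + θ₂ * (g ω * u ω)) P₀ := i1.add i2
  have i123 : Integrable (fun ω => θ₁ * g ω + θ₂ * (g ω * u ω)
    + (-X ω * (g ω * u ω) - g ω * (φ₁ (u ω)).toReal)) P₀ := i12.add i3
  rw [integral_sub i123 i4, integral_add i12 i3, integral_add i1 i2, integral_const_mul,
    integral_const_mul, integral_const_mul]

include hφ₁ hφ₂ hm₁ hm₂ in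
/-- The values of admissible pairs are convex, up to improvement. -/
lemma exists_combo (h : AdmissiblePair φ₁ φ₂ g u) (h' : AdmissiblePair φ₁ φ₂ g' u')
    (hX : Integrable X P₀) {a b : ℝ} (ha : 0 ≤ a) (hb : 0 ≤ b) (hab : a + b = 1) :
    ∃ k v : Ω → ℝ, AdmissiblePair φ₁ φ₂ k v ∧
      ∫ ω, k ω ∂P₀ = a * (∫ ω, g ω ∂P₀) + b * (∫ ω, g' ω ∂P₀) ∧
      ∫ ω, k ω * v ω ∂P₀ = a * (∫ ω, g ω * u ω ∂P₀) + b * (∫ ω, g' ω * u' ω ∂P₀) ∧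
      ∫ ω, (φ₂ (k ω)).toReal ∂P₀
        ≤ a * (∫ ω, (φ₂ (g ω)).toReal ∂P₀) + b * (∫ ω, (φ₂ (g' ω)).toReal ∂P₀) ∧
      a * (∫ ω, (-X ω * (g ω * u ω) - g ω * (φ₁ (u ω)).toReal) ∂P₀)
        + b * (∫ ω, (-X ω * (g' ω * u' ω) - g' ω * (φ₁ (u' ω)).toReal) ∂P₀)
        ≤ ∫ ω, (-X ω * (k ω * v ω) - k ω * (φ₁ (v ω)).toReal) ∂P₀ := by
  set k : Ω → ℝ := fun ω => a * g ω + b * g' ω with hk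
  -- The ratio of the averaged `gbar` to the averaged `g`. It is a convex combination of `u` and
  -- `u'` with weights `a g / k` and `b g' / k`, which is the joint convexity of the perspective
  -- `(g, gbar) ↦ g φ₁(gbar / g)`.
  set v : Ω → ℝ := fun ω => (a * g ω / k ω) * u ω + (b * g' ω / k ω) * u' ω with hv
  have kpos : ∀ ω, 0 < k ω := fun ω => by
    have h1 := h.pos ω
    have h2 := h'.pos ω
    rcases ha.eq_or_lt with rfl | ha
    · have : b = 1 := by linarith
      simp [hk, this, h2]
    · exact add_pos_of_pos_of_nonneg (mul_pos ha h1) (mul_nonneg hb h2.le)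
  have w0 : ∀ ω, 0 ≤ a * g ω / k ω := fun ω => div_nonneg (mul_nonneg ha (h.pos ω).le) (kpos ω).le
  have w0' : ∀ ω, 0 ≤ b * g' ω / k ω :=
    fun ω => div_nonneg (mul_nonneg hb (h'.pos ω).le) (kpos ω).le
  have w1 : ∀ ω, a * g ω / k ω + b * g' ω / k ω = 1 := fun ω => by
    rw [← add_div, div_self (kpos ω).ne']
  have kv : ∀ ω, k ω * v ω = a * (g ω * u ω) + b * (g' ω * u' ω) := fun ω => by
    have := (kpos ω).ne'
    rw [hv]
    field_simp
  have d1 : ∀ ω, φ₁ (v ω) < ⊤ := fun ω =>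
    hφ₁.convexOn_toReal.1 (h.dom₁ ω) (h'.dom₁ ω) (w0 ω) (w0' ω) (w1 ω)
  have d2 : ∀ ω, φ₂ (k ω) < ⊤ := fun ω =>
    hφ₂.convexOn_toReal.1 (h.dom₂ ω) (h'.dom₂ ω) ha hb hab
  have c2 : ∀ ω, (φ₂ (k ω)).toReal ≤ a * (φ₂ (g ω)).toReal + b * (φ₂ (g' ω)).toReal := fun ω =>
    hφ₂.convexOn_toReal.2 (h.dom₂ ω) (h'.dom₂ ω) ha hb hab
  have c1 : ∀ ω, k ω * (φ₁ (v ω)).toReal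
      ≤ a * (g ω * (φ₁ (u ω)).toReal) + b * (g' ω * (φ₁ (u' ω)).toReal) := fun ω => by
    have := hφ₁.convexOn_toReal.2 (h.dom₁ ω) (h'.dom₁ ω) (w0 ω) (w0' ω) (w1 ω)
    calc k ω * (φ₁ (v ω)).toReal
        ≤ k ω * ((a * g ω / k ω) * (φ₁ (u ω)).toReal + (b * g' ω / k ω) * (φ₁ (u' ω)).toReal) :=
          mul_le_mul_of_nonneg_left this (kpos ω).le
      _ = _ := by
          have := (kpos ω).ne'
          field_simp
  have mk : Measurable k := (h.meas_g.const_mul a).add (h'.meas_g.const_mul b)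
  obtain ⟨B, hB⟩ := h.bdd
  obtain ⟨B', hB'⟩ := h'.bdd
  have bd : ∀ {y y' : ℝ}, y ≤ B → y' ≤ B' → a * y + b * y' ≤ a * B + b * B' := fun hy hy' =>
    add_le_add (mul_le_mul_of_nonneg_left hy ha) (mul_le_mul_of_nonneg_left hy' hb)
  have hadm : AdmissiblePair φ₁ φ₂ k v :=
    ⟨mk, (((h.meas_g.const_mul a).div mk).mul h.meas_u).add
        (((h'.meas_g.const_mul b).div mk).mul h'.meas_u), kpos, d1, d2, a * B + b * B', fun ω =>
      ⟨bd (hB ω).1 (hB' ω).1, (kv ω).le.trans (bd (hB ω).2.1 (hB' ω).2.1),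
        (c1 ω).trans (bd (hB ω).2.2.1 (hB' ω).2.2.1),
        (c2 ω).trans (bd (hB ω).2.2.2 (hB' ω).2.2.2)⟩⟩
  refine ⟨k, v, hadm, ?_, ?_, ?_, ?_⟩
  · rw [hk, integral_add (h.integrable_g.const_mul a) (h'.integrable_g.const_mul b),
      integral_const_mul, integral_const_mul]
  · simp_rw [kv]
    rw [integral_add ((h.integrable_mul hφ₁).const_mul a) ((h'.integrable_mul hφ₁).const_mul b),
      integral_const_mul, integral_const_mul]
  · rw [← integral_const_mul, ← integral_const_mul,
      ← integral_add ((h.integrable_phi hm₂).const_mul a) ((h'.integrable_phi hm₂).const_mul b)]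
    exact integral_mono (hadm.integrable_phi hm₂)
      (((h.integrable_phi hm₂).const_mul a).add ((h'.integrable_phi hm₂).const_mul b)) c2
  · rw [← integral_const_mul, ← integral_const_mul,
      ← integral_add ((h.integrable_ball hφ₁ hm₁ hX).const_mul a)
        ((h'.integrable_ball hφ₁ hm₁ hX).const_mul b)]
    refine integral_mono (((h.integrable_ball hφ₁ hm₁ hX).const_mul a).add
      ((h'.integrable_ball hφ₁ hm₁ hX).const_mul b)) (hadm.integrable_ball hφ₁ hm₁ hX) fun ω => ?_
    have h1 := c1 ω
    simp only [kv ω]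
    linarith

end Integrability

end AdmissiblePair

/-! ### Interchange of supremum and integral -/

section Interchange

variable {φ₁ φ₂ : ℝ → ℝ≥0∞} {P₀ : Measure Ω} [IsProbabilityMeasure P₀] {X : Ω → ℝ}

lemma measurable_lagrangian (hm₁ : Measurable φ₁) (hm₂ : Measurable φ₂) (lam θ₁ θ₂ : ℝ)
    {g u : Ω → ℝ} (hX : Measurable X) (hg : Measurable g) (hu : Measurable u) :
    Measurable fun ω => lagrangian φ₁ φ₂ lam θ₁ θ₂ (X ω) (g ω) (u ω) := by
  unfold lagrangian
  have h1 := (hm₁.comp hu).ennreal_toReal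
  have h2 := (hm₂.comp hg).ennreal_toReal
  exact (hg.mul (((hu.mul (hX.const_sub _)).sub h1).add_const _)).sub (h2.const_mul _)

/-- Gluing: on the measurable set where the old pair is at least as good it is kept, and elsewhere
it is replaced by the next constant pair. Finitely many gluings preserve boundedness. -/
lemma exists_admissiblePair_forall_le (hm₁ : Measurable φ₁) (hm₂ : Measurable φ₂)
    (hX : Measurable X) (lam θ₁ θ₂ : ℝ) {t s : ℕ → ℝ} (ht : ∀ n, 0 < t n) (ht' : ∀ n, φ₂ (t n) < ⊤)
    (hs : ∀ n, φ₁ (s n) < ⊤) (N : ℕ) :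
    ∃ g u : Ω → ℝ, AdmissiblePair φ₁ φ₂ g u ∧ ∀ ω, ∀ n ≤ N,
      lagrangian φ₁ φ₂ lam θ₁ θ₂ (X ω) (t n) (s n)
        ≤ lagrangian φ₁ φ₂ lam θ₁ θ₂ (X ω) (g ω) (u ω) := by
  classical
  induction N with
  | zero =>
    refine ⟨_, _, AdmissiblePair.const (ht 0) (ht' 0) (hs 0), fun ω n hn => ?_⟩
    rw [Nat.le_zero.1 hn]
  | succ N ih =>
    obtain ⟨g, u, hgu, hle⟩ := ih
    set S : Set Ω := {ω | lagrangian φ₁ φ₂ lam θ₁ θ₂ (X ω) (t (N + 1)) (s (N + 1))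
        ≤ lagrangian φ₁ φ₂ lam θ₁ θ₂ (X ω) (g ω) (u ω)} with hS
    have mS : MeasurableSet S := measurableSet_le
      (measurable_lagrangian hm₁ hm₂ _ _ _ hX measurable_const measurable_const)
      (measurable_lagrangian hm₁ hm₂ _ _ _ hX hgu.meas_g hgu.meas_u)
    refine ⟨_, _, hgu.piecewise (AdmissiblePair.const (ht (N + 1)) (ht' (N + 1)) (hs (N + 1))) mS,
      fun ω n hn => ?_⟩
    by_cases hω : ω ∈ S
    · simp only [hω, Set.piecewise_eq_of_mem]
      rcases Nat.le_succ_iff.1 hn with h | h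
      · exact hle ω n h
      · rw [h]; exact hω
    · simp only [hω, Set.piecewise_eq_of_notMem, not_false_eq_true]
      rcases Nat.le_succ_iff.1 hn with h | h
      · exact (hle ω n h).trans (not_le.1 hω).le
      · rw [h]

/-- The dual integrand is a countable supremum of Lagrangians at constant pairs. A maximum of
finitely many of them is dominated by the Lagrangian of one admissible pair, so its integral is at
most `K`; monotone convergence gives the full supremum. The bound must hold for all admissible
pairs, not only normalized ones, because gluing does not preserve the mass. -/
theorem extIntegral_dualIntegrand_le (hφ₁ : IsDivergenceFunction φ₁)
    (hφ₂ : IsDivergenceFunction φ₂) (hm₁ : Measurable φ₁) (hm₂ : Measurable φ₂)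
    (hX : Integrable X P₀) {lam : ℝ} (hlam : 0 ≤ lam) {θ₁ θ₂ K : ℝ}
    (hK : ∀ g u, AdmissiblePair φ₁ φ₂ g u →
      ∫ ω, lagrangian φ₁ φ₂ lam θ₁ θ₂ (X ω) (g ω) (u ω) ∂P₀ ≤ K) :
    extIntegral P₀ (fun ω => dualIntegrand φ₁ φ₂ lam θ₁ θ₂ (X ω)) ≤ (K : EReal) := by
  -- Gluing needs measurable comparison sets, so `X` is replaced by a measurable version, which
  -- changes no integral.
  wlog hXm : Measurable X generalizing X
  · have hae := hX.1.ae_eq_mk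
    have h1 := this (X := hX.1.mk X) (hX.congr hae) (fun g u hgu => by
      refine le_trans (le_of_eq (integral_congr_ae ?_)) (hK g u hgu)
      filter_upwards [hae] with ω hω
      rw [hω]) hX.1.stronglyMeasurable_mk.measurable
    refine le_trans (le_of_eq (extIntegral_congr ?_)) h1
    filter_upwards [hae] with ω hω
    rw [← hω]
  let I := {p : ℚ × ℚ // 0 < (p.1 : ℝ) ∧ φ₂ p.1 < ⊤ ∧ φ₁ p.2 < ⊤}
  have : Nonempty I := ⟨⟨(1, 1), by simp [hφ₁.map_one, hφ₂.map_one]⟩⟩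
  obtain ⟨e, he⟩ := exists_surjective_nat I
  set F : ℕ → Ω → ℝ := fun n ω => lagrangian φ₁ φ₂ lam θ₁ θ₂ (X ω) ((e n).1.1 : ℝ) ((e n).1.2 : ℝ)
    with hF
  have hFadm : ∀ n,
      AdmissiblePair φ₁ φ₂ (fun _ : Ω => ((e n).1.1 : ℝ)) (fun _ => ((e n).1.2 : ℝ)) :=
    fun n => AdmissiblePair.const (e n).2.1 (e n).2.2.1 (e n).2.2.2
  have hFm : ∀ n, Measurable (F n) := fun n =>
    measurable_lagrangian hm₁ hm₂ _ _ _ hXm measurable_const measurable_const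
  have hFi : Integrable (F 0) P₀ := (hFadm 0).integrable_lagrangian hφ₁ hm₁ hm₂ hX _ _ _
  -- Subtracting the integrable `F 0` makes the partial maxima nonnegative, hence suitable for
  -- monotone convergence.
  set M : ℕ → Ω → ℝ≥0∞ := fun N ω =>
    (Finset.range (N + 1)).sup fun n => ENNReal.ofReal (F n ω - F 0 ω) with hM
  have hMm : ∀ N, Measurable (M N) := fun N => by
    have : M N = (Finset.range (N + 1)).sup fun n ω => ENNReal.ofReal (F n ω - F 0 ω) := by
      ext ω
      rw [Finset.sup_apply]
    rw [this]
    exact Finset.sup_induction (p := Measurable) measurable_const (fun _ h _ h' => h.sup h')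
      fun n _ => ((hFm n).sub (hFm 0)).ennreal_ofReal
  have hMmono : Monotone M := fun N N' h ω =>
    Finset.sup_mono (Finset.range_mono (by omega))
  have hMle : ∀ N, ∫⁻ ω, M N ω ∂P₀ ≤ ENNReal.ofReal (K - ∫ ω, F 0 ω ∂P₀) := fun N => by
    obtain ⟨g, u, hgu, hle⟩ := exists_admissiblePair_forall_le hm₁ hm₂ hXm lam θ₁ θ₂
      (fun n => (e n).2.1) (fun n => (e n).2.2.1) (fun n => (e n).2.2.2) N
    have hi := hgu.integrable_lagrangian hφ₁ hm₁ hm₂ hX lam θ₁ θ₂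
    calc ∫⁻ ω, M N ω ∂P₀
        ≤ ∫⁻ ω, ENNReal.ofReal (lagrangian φ₁ φ₂ lam θ₁ θ₂ (X ω) (g ω) (u ω) - F 0 ω) ∂P₀ := by
          refine lintegral_mono fun ω => Finset.sup_le fun n hn => ?_
          refine ENNReal.ofReal_le_ofReal (sub_le_sub_right (hle ω n ?_) _)
          have := Finset.mem_range.1 hn
          omega
      _ = ENNReal.ofReal (∫ ω, (lagrangian φ₁ φ₂ lam θ₁ θ₂ (X ω) (g ω) (u ω) - F 0 ω) ∂P₀) := by
          refine (ofReal_integral_eq_lintegral_ofReal (hi.sub hFi) (.of_forall fun ω => ?_)).symm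
          exact sub_nonneg.2 (hle ω 0 (Nat.zero_le N))
      _ ≤ _ := by
          rw [integral_sub hi hFi]
          exact ENNReal.ofReal_le_ofReal (sub_le_sub_right (hK g u hgu) _)
  have hpt : ∀ ω, dualIntegrand φ₁ φ₂ lam θ₁ θ₂ (X ω)
      ≤ ((⨆ N, M N ω : ℝ≥0∞) : EReal) + (F 0 ω : EReal) := fun ω => by
    refine EReal.ge_of_forall_gt_iff_ge.1 fun c hc => ?_
    obtain ⟨p, hp, hlt⟩ := exists_rat_lt_lagrangian hφ₁ hφ₂ hlam hc
    obtain ⟨n, hn⟩ := he ⟨p, hp⟩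
    have h1 : c < F n ω := by
      rw [hF]
      simp only [hn]
      exact hlt
    have h2 : ENNReal.ofReal (F n ω - F 0 ω) ≤ ⨆ N, M N ω :=
      le_trans (Finset.le_sup (f := fun n => ENNReal.ofReal (F n ω - F 0 ω))
        (Finset.self_mem_range_succ n)) (le_iSup (fun N => M N ω) n)
    calc (c : EReal) ≤ ((F n ω - F 0 ω : ℝ) : EReal) + (F 0 ω : EReal) := by
          norm_cast
          linarith
      _ ≤ (ENNReal.ofReal (F n ω - F 0 ω) : EReal) + (F 0 ω : EReal) := by
          gcongr
          rw [EReal.coe_ennreal_ofReal]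
          exact_mod_cast le_max_left _ _
      _ ≤ _ := by
          gcongr
          exact_mod_cast h2
  have hsup : ∫⁻ ω, ⨆ N, M N ω ∂P₀ ≤ ENNReal.ofReal (K - ∫ ω, F 0 ω ∂P₀) := by
    rw [lintegral_iSup hMm hMmono]
    exact iSup_le hMle
  have hK0 : ∫ ω, F 0 ω ∂P₀ ≤ K := hK _ _ (hFadm 0)
  calc extIntegral P₀ (fun ω => dualIntegrand φ₁ φ₂ lam θ₁ θ₂ (X ω))
      ≤ extIntegral P₀ (fun ω => ((⨆ N, M N ω : ℝ≥0∞) : EReal) + (F 0 ω : EReal)) :=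
        extIntegral_mono (.of_forall hpt)
    _ = ((∫⁻ ω, ⨆ N, M N ω ∂P₀ : ℝ≥0∞) : EReal) + ((∫ ω, F 0 ω ∂P₀ : ℝ) : EReal) := by
        rw [extIntegral_add (Measurable.iSup hMm).coe_ereal_ennreal.aemeasurable hFi,
          extIntegral_of_nonneg fun ω => EReal.coe_ennreal_nonneg _]
        simp only [EReal.toENNReal_coe]
    _ ≤ (ENNReal.ofReal (K - ∫ ω, F 0 ω ∂P₀) : EReal) + ((∫ ω, F 0 ω ∂P₀ : ℝ) : EReal) := by
        gcongr
        exact_mod_cast hsup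
    _ = (K : EReal) := by
        rw [EReal.coe_ennreal_ofReal, max_eq_left (sub_nonneg.2 hK0), ← EReal.coe_add,
          sub_add_cancel]

end Interchange

/-! ### Objectives in terms of densities -/

lemma sub_sub_coe_ennreal (x : EReal) (b c : ℝ≥0∞) :
    x - (b : EReal) - (c : EReal) = x - ((b + c : ℝ≥0∞) : EReal) := by
  rw [EReal.coe_ennreal_add, sub_eq_add_neg, sub_eq_add_neg, sub_eq_add_neg, add_assoc,
    EReal.neg_add (by simp) (by simp), sub_eq_add_neg]

section Objectives

variable {P₀ Q Qbar : Measure Ω} [IsProbabilityMeasure P₀] [IsProbabilityMeasure Q]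
  [IsProbabilityMeasure Qbar] {φ₁ φ₂ : ℝ → ℝ≥0∞} {X : Ω → ℝ}

omit [IsProbabilityMeasure Q] in
lemma expLoss_eq (hac : Qbar ≪ P₀) (hX : AEMeasurable X P₀) :
    expLoss Qbar X
      = extIntegral P₀ (fun ω => ((-X ω * (Qbar.rnDeriv P₀ ω).toReal : ℝ) : EReal)) := by
  have key : ∀ Y : Ω → ℝ, AEMeasurable Y P₀ → ∫⁻ ω, ENNReal.ofReal (Y ω) ∂Qbar
      = ∫⁻ ω, ENNReal.ofReal (Y ω * (Qbar.rnDeriv P₀ ω).toReal) ∂P₀ := fun Y hY => by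
    rw [← lintegral_rnDeriv_mul hac hY.ennreal_ofReal]
    refine lintegral_congr_ae ?_
    filter_upwards [Measure.rnDeriv_lt_top Qbar P₀] with ω hω
    rw [ENNReal.ofReal_mul' ENNReal.toReal_nonneg, ENNReal.ofReal_toReal hω.ne, mul_comm]
  unfold expLoss extIntegral
  congr 2
  · exact key _ hX.neg
  · refine Eq.trans (key (fun ω => - -X ω) hX.neg.neg) (lintegral_congr fun ω => ?_)
    rw [← EReal.coe_neg, EReal.real_coe_toENNReal, neg_mul (-X ω)]

omit [IsProbabilityMeasure P₀] [IsProbabilityMeasure Qbar] in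
lemma divergence_eq_lintegral_mul [SigmaFinite P₀] (hac : Q ≪ P₀) (hacb : Qbar ≪ Q)
    (hm₁ : Measurable φ₁) :
    divergence φ₁ Qbar Q
      = ∫⁻ ω, Q.rnDeriv P₀ ω * φ₁ (Qbar.rnDeriv Q ω).toReal ∂P₀ := by
  have hm : Measurable fun ω => φ₁ (Qbar.rnDeriv Q ω).toReal :=
    hm₁.comp (Measure.measurable_rnDeriv _ _).ennreal_toReal
  rw [divergence, if_pos hacb, lintegral_rnDeriv_mul hac hm.aemeasurable]

lemma ballObjective_le_joint (hac : Q ≪ P₀) (hacb : Qbar ≪ Q) (hm₁ : Measurable φ₁)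
    (hX : AEMeasurable X P₀) :
    ballObjective φ₁ X Q Qbar ≤ ballObjectiveJoint P₀ φ₁ X Q Qbar := by
  rw [ballObjective, expLoss_eq (hacb.trans hac) hX, divergence_eq_lintegral_mul hac hacb hm₁]
  exact extIntegral_sub_lintegral_le
    (hX.neg.mul (Measure.measurable_rnDeriv _ _).ennreal_toReal.aemeasurable)
    ((Measure.measurable_rnDeriv _ _).mul
      (hm₁.comp (Measure.measurable_rnDeriv _ _).ennreal_toReal)).aemeasurable

lemma ballObjective_eq_joint (hac : Q ≪ P₀) (hacb : Qbar ≪ Q) (hm₁ : Measurable φ₁)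
    (hX : AEMeasurable X P₀) (h : expLoss Qbar X < ⊤ ∨ divergence φ₁ Qbar Q < ⊤) :
    ballObjective φ₁ X Q Qbar = ballObjectiveJoint P₀ φ₁ X Q Qbar := by
  rw [expLoss_eq (hacb.trans hac) hX, divergence_eq_lintegral_mul hac hacb hm₁] at h
  rw [ballObjective, expLoss_eq (hacb.trans hac) hX, divergence_eq_lintegral_mul hac hacb hm₁]
  exact extIntegral_sub_lintegral_eq
    (hX.neg.mul (Measure.measurable_rnDeriv _ _).ennreal_toReal.aemeasurable)
    ((Measure.measurable_rnDeriv _ _).mul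
      (hm₁.comp (Measure.measurable_rnDeriv _ _).ennreal_toReal)).aemeasurable h

omit [IsProbabilityMeasure P₀] [IsProbabilityMeasure Qbar] in
lemma divergence_add_eq [SigmaFinite P₀] (hac : Q ≪ P₀) (hacb : Qbar ≪ Q) (hm₁ : Measurable φ₁)
    (hm₂ : Measurable φ₂) :
    divergence φ₁ Qbar Q + divergence φ₂ Q P₀
      = ∫⁻ ω, (Q.rnDeriv P₀ ω * φ₁ (Qbar.rnDeriv Q ω).toReal + φ₂ (Q.rnDeriv P₀ ω).toReal) ∂P₀ := by
  rw [divergence_eq_lintegral_mul hac hacb hm₁, divergence, if_pos hac, lintegral_add_right]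
  exact hm₂.comp (Measure.measurable_rnDeriv _ _).ennreal_toReal

omit [IsProbabilityMeasure P₀] [IsProbabilityMeasure Q] [IsProbabilityMeasure Qbar] in
lemma aemeasurable_penalty (hm₁ : Measurable φ₁) (hm₂ : Measurable φ₂) :
    AEMeasurable (fun ω => Q.rnDeriv P₀ ω * φ₁ (Qbar.rnDeriv Q ω).toReal
      + φ₂ (Q.rnDeriv P₀ ω).toReal) P₀ :=
  (((Measure.measurable_rnDeriv _ _).mul
      (hm₁.comp (Measure.measurable_rnDeriv _ _).ennreal_toReal)).add
      (hm₂.comp (Measure.measurable_rnDeriv _ _).ennreal_toReal)).aemeasurable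

lemma penObjective_le_joint (hac : Q ≪ P₀) (hacb : Qbar ≪ Q) (hm₁ : Measurable φ₁)
    (hm₂ : Measurable φ₂) (hX : AEMeasurable X P₀) :
    penObjective P₀ φ₁ φ₂ X Q Qbar ≤ penObjectiveJoint P₀ φ₁ φ₂ X Q Qbar := by
  rw [penObjective, sub_sub_coe_ennreal, divergence_add_eq hac hacb hm₁ hm₂,
    expLoss_eq (hacb.trans hac) hX, penObjectiveJoint]
  simp_rw [sub_sub_coe_ennreal]
  exact extIntegral_sub_lintegral_le
    (hX.neg.mul (Measure.measurable_rnDeriv _ _).ennreal_toReal.aemeasurable)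
    (aemeasurable_penalty hm₁ hm₂)

lemma penObjective_eq_joint (hac : Q ≪ P₀) (hacb : Qbar ≪ Q) (hm₁ : Measurable φ₁)
    (hm₂ : Measurable φ₂) (hX : AEMeasurable X P₀)
    (h : expLoss Qbar X < ⊤ ∨ divergence φ₁ Qbar Q + divergence φ₂ Q P₀ < ⊤) :
    penObjective P₀ φ₁ φ₂ X Q Qbar = penObjectiveJoint P₀ φ₁ φ₂ X Q Qbar := by
  rw [divergence_add_eq hac hacb hm₁ hm₂, expLoss_eq (hacb.trans hac) hX] at h
  rw [penObjective, sub_sub_coe_ennreal, divergence_add_eq hac hacb hm₁ hm₂,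
    expLoss_eq (hacb.trans hac) hX, penObjectiveJoint]
  simp_rw [sub_sub_coe_ennreal]
  exact extIntegral_sub_lintegral_eq
    (hX.neg.mul (Measure.measurable_rnDeriv _ _).ennreal_toReal.aemeasurable)
    (aemeasurable_penalty hm₁ hm₂) h

/-! ### Weak duality -/

/-- The pointwise Fenchel inequality at arbitrary densities, where `U` stands for `dQbar/dQ`. An
infinite first penalty makes the left side `⊥`. -/
lemma joint_integrand_le (hφ₁ : IsDivergenceFunction φ₁) (hφ₂ : IsDivergenceFunction φ₂)
    {G Gb U : ℝ≥0∞} (hU : U * G = Gb) (hφG : φ₂ G.toReal < ⊤)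
    (lam θ₁ θ₂ x : ℝ) :
    ((-x * Gb.toReal : ℝ) : EReal) - ((G * φ₁ U.toReal : ℝ≥0∞) : EReal)
        + ((θ₁ * G.toReal + θ₂ * Gb.toReal - lam * (φ₂ G.toReal).toReal : ℝ) : EReal)
      ≤ dualIntegrand φ₁ φ₂ lam θ₁ θ₂ x := by
  rcases eq_or_ne (G * φ₁ U.toReal) ⊤ with hb | hb
  · simp [hb]
  obtain ⟨u, hu, hgu, hbu⟩ : ∃ u, φ₁ u < ⊤ ∧ Gb.toReal = G.toReal * u ∧
      (G * φ₁ U.toReal).toReal = G.toReal * (φ₁ u).toReal := by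
    rcases eq_or_ne G 0 with h0 | h0
    · refine ⟨1, hφ₁.one_lt_top, ?_, ?_⟩
      · rw [← hU, h0]
        simp
      · rw [h0]
        simp
    · refine ⟨U.toReal, ?_, ?_, ?_⟩
      · rw [lt_top_iff_ne_top]
        intro h
        rw [h, ENNReal.mul_top h0] at hb
        exact hb rfl
      · rw [← hU, ENNReal.toReal_mul, mul_comm]
      · rw [ENNReal.toReal_mul]
  refine le_trans (le_of_eq ?_) (lagrangian_le_dualIntegrand hφ₂ hφG hu lam θ₁ θ₂ x)
  rw [← EReal.coe_ennreal_toReal hb, hbu, hgu, lagrangian]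
  norm_cast
  ring

lemma integral_rnDeriv_eq_one (hac : Q ≪ P₀) : ∫ ω, (Q.rnDeriv P₀ ω).toReal ∂P₀ = 1 := by
  rw [Measure.integral_toReal_rnDeriv hac]
  simp

lemma le_neg_add_of_add_le {a b : EReal} {m : ℝ} (h : a + (m : EReal) ≤ b) :
    a ≤ ((-m : ℝ) : EReal) + b := by
  rw [add_comm, EReal.coe_neg, ← sub_eq_add_neg]
  exact (EReal.le_sub_iff_add_le (by simp) (by simp)).2 h

omit [IsProbabilityMeasure P₀] in
lemma aemeasurable_coe_sub {a : Ω → EReal} {b : Ω → ℝ≥0∞} (ha : AEMeasurable a P₀)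
    (hb : AEMeasurable b P₀) : AEMeasurable (fun ω => a ω - (b ω : EReal)) P₀ := by
  simp_rw [sub_eq_add_neg]
  exact ha.add (measurable_neg.comp_aemeasurable hb.coe_ereal_ennreal)

omit [IsProbabilityMeasure P₀] [IsProbabilityMeasure Q] [IsProbabilityMeasure Qbar] in
lemma aemeasurable_ball_integrand (hm₁ : Measurable φ₁) (hX : AEMeasurable X P₀) :
    AEMeasurable (fun ω => ((-X ω * (Qbar.rnDeriv P₀ ω).toReal : ℝ) : EReal)
      - ((Q.rnDeriv P₀ ω * φ₁ (Qbar.rnDeriv Q ω).toReal : ℝ≥0∞) : EReal)) P₀ :=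
  aemeasurable_coe_sub
    (hX.neg.mul (Measure.measurable_rnDeriv _ _).ennreal_toReal.aemeasurable).coe_real_ereal
    ((Measure.measurable_rnDeriv _ _).mul
      (hm₁.comp (Measure.measurable_rnDeriv _ _).ennreal_toReal)).aemeasurable

/-- The term `θ₁ g + θ₂ gbar` is added to the integrand before applying Fenchel; its integral is `θ₁
+ θ₂` because both measures have mass one. -/
theorem penObjectiveJoint_le_dual (hφ₁ : IsDivergenceFunction φ₁) (hφ₂ : IsDivergenceFunction φ₂)
    (hm₁ : Measurable φ₁) (hm₂ : Measurable φ₂) (hX : AEMeasurable X P₀) (hac : Q ≪ P₀)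
    (hacb : Qbar ≪ Q) (θ₁ θ₂ : ℝ) :
    penObjectiveJoint P₀ φ₁ φ₂ X Q Qbar ≤ ((-θ₁ - θ₂ : ℝ) : EReal)
      + extIntegral P₀ (fun ω => dualIntegrand φ₁ φ₂ 1 θ₁ θ₂ (X ω)) := by
  have i1 : Integrable (fun ω => θ₁ * (Q.rnDeriv P₀ ω).toReal) P₀ :=
    Measure.integrable_toReal_rnDeriv.const_mul θ₁
  have i2 : Integrable (fun ω => θ₂ * (Qbar.rnDeriv P₀ ω).toReal) P₀ :=
    Measure.integrable_toReal_rnDeriv.const_mul θ₂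
  have hle : extIntegral P₀ (fun ω => (((-X ω * (Qbar.rnDeriv P₀ ω).toReal : ℝ) : EReal)
      - ((Q.rnDeriv P₀ ω * φ₁ (Qbar.rnDeriv Q ω).toReal : ℝ≥0∞) : EReal)
      - (φ₂ (Q.rnDeriv P₀ ω).toReal : EReal))
        + ((θ₁ * (Q.rnDeriv P₀ ω).toReal + θ₂ * (Qbar.rnDeriv P₀ ω).toReal : ℝ) : EReal))
      ≤ extIntegral P₀ (fun ω => dualIntegrand φ₁ φ₂ 1 θ₁ θ₂ (X ω)) := by
    refine extIntegral_mono ?_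
    filter_upwards [Measure.rnDeriv_mul_rnDeriv (κ := P₀) hacb] with ω h
    rcases eq_or_ne (φ₂ (Q.rnDeriv P₀ ω).toReal) ⊤ with hc | hc
    · simp [hc]
    · refine le_trans (le_of_eq ?_)
        (joint_integrand_le hφ₁ hφ₂ h hc.lt_top 1 θ₁ θ₂ (X ω))
      rw [← EReal.coe_ennreal_toReal hc, one_mul, EReal.coe_sub _ (ENNReal.toReal _),
        sub_eq_add_neg _ (((φ₂ _).toReal : ℝ) : EReal),
        sub_eq_add_neg _ (((φ₂ _).toReal : ℝ) : EReal),
        add_assoc, add_comm (-_ : EReal)]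
  have i12 : Integrable (fun ω => θ₁ * (Q.rnDeriv P₀ ω).toReal
    + θ₂ * (Qbar.rnDeriv P₀ ω).toReal) P₀ := i1.add i2
  have hm : AEMeasurable (fun ω => φ₂ (Q.rnDeriv P₀ ω).toReal) P₀ :=
    (hm₂.comp (Measure.measurable_rnDeriv _ _).ennreal_toReal).aemeasurable
  rw [extIntegral_add (aemeasurable_coe_sub (aemeasurable_ball_integrand hm₁ hX) hm) i12,
    integral_add i1 i2, integral_const_mul, integral_const_mul,
    integral_rnDeriv_eq_one hac, integral_rnDeriv_eq_one (hacb.trans hac)] at hle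
  have := le_neg_add_of_add_le hle
  rwa [show -(θ₁ * 1 + θ₂ * 1) = -θ₁ - θ₂ by ring] at this

/-- The ball constraint makes `φ₂(g)` integrable with integral at most `r`, so the relaxation term
`-lam φ₂(g)` costs at most `lam r`. -/
theorem ballObjectiveJoint_le_dual (hφ₁ : IsDivergenceFunction φ₁)
    (hφ₂ : IsDivergenceFunction φ₂)
    (hm₁ : Measurable φ₁) (hm₂ : Measurable φ₂) (hX : AEMeasurable X P₀) {r : ℝ} (hr : 0 ≤ r)
    (hdiv : divergence φ₂ Q P₀ ≤ ENNReal.ofReal r) 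
    (hacb : Qbar ≪ Q) (θ₁ θ₂ : ℝ) {lam : ℝ} (hlam : 0 ≤ lam) :
    ballObjectiveJoint P₀ φ₁ X Q Qbar ≤ ((-θ₁ - θ₂ + lam * r : ℝ) : EReal)
      + extIntegral P₀ (fun ω => dualIntegrand φ₁ φ₂ lam θ₁ θ₂ (X ω)) := by
  have hac : Q ≪ P₀ := by
    by_contra hn
    rw [divergence, if_neg hn] at hdiv
    exact ENNReal.ofReal_ne_top (top_le_iff.1 hdiv)
  rw [divergence, if_pos hac] at hdiv
  have hm : AEMeasurable (fun ω => φ₂ (Q.rnDeriv P₀ ω).toReal) P₀ :=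
    (hm₂.comp (Measure.measurable_rnDeriv _ _).ennreal_toReal).aemeasurable
  have hfin : ∫⁻ ω, φ₂ (Q.rnDeriv P₀ ω).toReal ∂P₀ ≠ ⊤ :=
    ne_top_of_le_ne_top ENNReal.ofReal_ne_top hdiv
  have hae := ae_lt_top' hm hfin
  have hphi : ∫ ω, (φ₂ (Q.rnDeriv P₀ ω).toReal).toReal ∂P₀ ≤ r := by
    rw [integral_toReal hm hae]
    exact ENNReal.toReal_le_of_le_ofReal hr hdiv
  have i1 : Integrable (fun ω => θ₁ * (Q.rnDeriv P₀ ω).toReal) P₀ :=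
    Measure.integrable_toReal_rnDeriv.const_mul θ₁
  have i2 : Integrable (fun ω => θ₂ * (Qbar.rnDeriv P₀ ω).toReal) P₀ :=
    Measure.integrable_toReal_rnDeriv.const_mul θ₂
  have i3 : Integrable (fun ω => lam * (φ₂ (Q.rnDeriv P₀ ω).toReal).toReal) P₀ :=
    (integrable_toReal_of_lintegral_ne_top hm hfin).const_mul lam
  have i12 : Integrable (fun ω => θ₁ * (Q.rnDeriv P₀ ω).toReal
    + θ₂ * (Qbar.rnDeriv P₀ ω).toReal) P₀ := i1.add i2
  have i123 : Integrable (fun ω => θ₁ * (Q.rnDeriv P₀ ω).toReal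
    + θ₂ * (Qbar.rnDeriv P₀ ω).toReal - lam * (φ₂ (Q.rnDeriv P₀ ω).toReal).toReal) P₀ :=
    i12.sub i3
  have hle : extIntegral P₀ (fun ω => (((-X ω * (Qbar.rnDeriv P₀ ω).toReal : ℝ) : EReal)
      - ((Q.rnDeriv P₀ ω * φ₁ (Qbar.rnDeriv Q ω).toReal : ℝ≥0∞) : EReal))
        + ((θ₁ * (Q.rnDeriv P₀ ω).toReal + θ₂ * (Qbar.rnDeriv P₀ ω).toReal
          - lam * (φ₂ (Q.rnDeriv P₀ ω).toReal).toReal : ℝ) : EReal))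
      ≤ extIntegral P₀ (fun ω => dualIntegrand φ₁ φ₂ lam θ₁ θ₂ (X ω)) := by
    refine extIntegral_mono ?_
    filter_upwards [Measure.rnDeriv_mul_rnDeriv (κ := P₀) hacb, hae] with ω h hc
    exact joint_integrand_le hφ₁ hφ₂ h hc lam θ₁ θ₂ (X ω)
  rw [extIntegral_add (aemeasurable_ball_integrand hm₁ hX) i123, integral_sub i12 i3,
    integral_add i1 i2, integral_const_mul, integral_const_mul, integral_const_mul,
    integral_rnDeriv_eq_one hac, integral_rnDeriv_eq_one (hacb.trans hac)] at hle
  refine (le_neg_add_of_add_le hle).trans ?_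
  gcongr
  linarith [mul_le_mul_of_nonneg_left hphi hlam]

/-! ### Measures given by densities -/

end Objectives

section OfDensity

variable {P₀ : Measure Ω} [IsProbabilityMeasure P₀] {φ₁ φ₂ : ℝ → ℝ≥0∞} {X g u : Ω → ℝ}

omit [IsProbabilityMeasure P₀] in
lemma isProbabilityMeasure_ofDensity (hg : Integrable g P₀) (hg0 : ∀ ω, 0 ≤ g ω)
    (hg1 : ∫ ω, g ω ∂P₀ = 1) : IsProbabilityMeasure (ofDensity P₀ g) := by
  refine ⟨?_⟩
  rw [ofDensity, withDensity_apply _ MeasurableSet.univ, Measure.restrict_univ,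
    ← ofReal_integral_eq_lintegral_ofReal hg (.of_forall hg0), hg1, ENNReal.ofReal_one]

omit [IsProbabilityMeasure P₀] in
lemma ofDensity_mul (hg : AEMeasurable g P₀) (hu : AEMeasurable u P₀) (hg0 : ∀ ω, 0 ≤ g ω) :
    ofDensity P₀ (fun ω => g ω * u ω)
      = (ofDensity P₀ g).withDensity fun ω => ENNReal.ofReal (u ω) := by
  rw [ofDensity, ofDensity, ← withDensity_mul₀ hg.ennreal_ofReal hu.ennreal_ofReal]
  congr 1
  ext ω
  exact ENNReal.ofReal_mul (hg0 ω)

omit [IsProbabilityMeasure P₀] in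
lemma ofDensity_absolutelyContinuous : ofDensity P₀ g ≪ P₀ :=
  withDensity_absolutelyContinuous _ _

omit [IsProbabilityMeasure P₀] in
lemma ofDensity_mul_absolutelyContinuous (hg : AEMeasurable g P₀) (hu : AEMeasurable u P₀)
    (hg0 : ∀ ω, 0 ≤ g ω) : ofDensity P₀ (fun ω => g ω * u ω) ≪ ofDensity P₀ g := by
  rw [ofDensity_mul hg hu hg0]
  exact withDensity_absolutelyContinuous _ _

lemma rnDeriv_ofDensity (hg : AEMeasurable g P₀) :
    (ofDensity P₀ g).rnDeriv P₀ =ᵐ[P₀] fun ω => ENNReal.ofReal (g ω) :=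
  Measure.rnDeriv_withDensity₀ P₀ hg.ennreal_ofReal

/-- The density `dQbar/dQ` is identified with `u` only `Q`-almost everywhere, that is, where `g >
0`. The factor `dQ/dP₀` removes the remaining set. -/
lemma mul_phi_rnDeriv_ofDensity (hg : Integrable g P₀) (hu : AEMeasurable u P₀)
    (hg0 : ∀ ω, 0 ≤ g ω) (hu0 : ∀ ω, 0 ≤ u ω) (hg1 : ∫ ω, g ω ∂P₀ = 1)
    (hφu : ∀ ω, φ₁ (u ω) < ⊤) :
    ∀ᵐ ω ∂P₀, (ofDensity P₀ g).rnDeriv P₀ ω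
        * φ₁ ((ofDensity P₀ fun ω => g ω * u ω).rnDeriv (ofDensity P₀ g) ω).toReal
      = ENNReal.ofReal (g ω * (φ₁ (u ω)).toReal) := by
  have := isProbabilityMeasure_ofDensity hg hg0 hg1
  have hu' : AEMeasurable (fun ω => ENNReal.ofReal (u ω)) (ofDensity P₀ g) :=
    hu.ennreal_ofReal.mono_ac ofDensity_absolutelyContinuous
  have h1 := Measure.rnDeriv_withDensity₀ (ofDensity P₀ g) hu'
  rw [← ofDensity_mul hg.aemeasurable hu hg0, Filter.EventuallyEq] at h1
  nth_rewrite 3 [ofDensity] at h1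
  rw [ae_withDensity_iff' hg.aemeasurable.ennreal_ofReal] at h1
  filter_upwards [h1, rnDeriv_ofDensity hg.aemeasurable] with ω h2 h3
  rw [h3, ENNReal.ofReal_mul (hg0 ω), ENNReal.ofReal_toReal (hφu ω).ne]
  by_cases h0 : ENNReal.ofReal (g ω) = 0
  · simp [h0]
  · rw [h2 h0, ENNReal.toReal_ofReal (hu0 ω)]

lemma divergence_ofDensity (hg : AEMeasurable g P₀) (hg0 : ∀ ω, 0 ≤ g ω) :
    divergence φ₂ (ofDensity P₀ g) P₀ = ∫⁻ ω, φ₂ (g ω) ∂P₀ := by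
  rw [divergence, if_pos ofDensity_absolutelyContinuous]
  refine lintegral_congr_ae ?_
  filter_upwards [rnDeriv_ofDensity hg] with ω hω
  rw [hω, ENNReal.toReal_ofReal (hg0 ω)]

lemma divergence_ofDensity_mul (hm₁ : Measurable φ₁) (hg : Integrable g P₀)
    (hu : AEMeasurable u P₀) (hg0 : ∀ ω, 0 ≤ g ω) (hu0 : ∀ ω, 0 ≤ u ω) (hg1 : ∫ ω, g ω ∂P₀ = 1)
    (hgu : Integrable (fun ω => g ω * u ω) P₀) (hgu1 : ∫ ω, g ω * u ω ∂P₀ = 1)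
    (hφu : ∀ ω, φ₁ (u ω) < ⊤) :
    divergence φ₁ (ofDensity P₀ fun ω => g ω * u ω) (ofDensity P₀ g)
      = ∫⁻ ω, ENNReal.ofReal (g ω * (φ₁ (u ω)).toReal) ∂P₀ := by
  have := isProbabilityMeasure_ofDensity hg hg0 hg1
  have := isProbabilityMeasure_ofDensity hgu (fun ω => mul_nonneg (hg0 ω) (hu0 ω)) hgu1
  rw [divergence_eq_lintegral_mul (P₀ := P₀) ofDensity_absolutelyContinuous
    (ofDensity_mul_absolutelyContinuous hg.aemeasurable hu hg0) hm₁]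
  exact lintegral_congr_ae (mul_phi_rnDeriv_ofDensity hg hu hg0 hu0 hg1 hφu)

lemma ballObjectiveJoint_ofDensity (hg : Integrable g P₀) (hu : AEMeasurable u P₀)
    (hg0 : ∀ ω, 0 ≤ g ω) (hu0 : ∀ ω, 0 ≤ u ω) (hg1 : ∫ ω, g ω ∂P₀ = 1)
    (hφu : ∀ ω, φ₁ (u ω) < ⊤) :
    ballObjectiveJoint P₀ φ₁ X (ofDensity P₀ g) (ofDensity P₀ fun ω => g ω * u ω)
      = extIntegral P₀ fun ω =>
        ((-X ω * (g ω * u ω) - g ω * (φ₁ (u ω)).toReal : ℝ) : EReal) := by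
  refine extIntegral_congr ?_
  filter_upwards [mul_phi_rnDeriv_ofDensity hg hu hg0 hu0 hg1 hφu,
    rnDeriv_ofDensity (hg.aemeasurable.mul hu)] with ω h1 h2
  have h2' : (ofDensity P₀ fun ω => g ω * u ω).rnDeriv P₀ ω = ENNReal.ofReal (g ω * u ω) := h2
  rw [h1, h2', ENNReal.toReal_ofReal (mul_nonneg (hg0 ω) (hu0 ω)), EReal.coe_ennreal_ofReal,
    max_eq_left (mul_nonneg (hg0 ω) ENNReal.toReal_nonneg), EReal.coe_sub]

lemma penObjectiveJoint_ofDensity (hg : Integrable g P₀) (hu : AEMeasurable u P₀)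
    (hg0 : ∀ ω, 0 ≤ g ω) (hu0 : ∀ ω, 0 ≤ u ω) (hg1 : ∫ ω, g ω ∂P₀ = 1)
    (hφu : ∀ ω, φ₁ (u ω) < ⊤) (hφg : ∀ ω, φ₂ (g ω) < ⊤) :
    penObjectiveJoint P₀ φ₁ φ₂ X (ofDensity P₀ g) (ofDensity P₀ fun ω => g ω * u ω)
      = extIntegral P₀ fun ω =>
        ((-X ω * (g ω * u ω) - g ω * (φ₁ (u ω)).toReal - (φ₂ (g ω)).toReal : ℝ) : EReal) := by
  refine extIntegral_congr ?_
  filter_upwards [mul_phi_rnDeriv_ofDensity hg hu hg0 hu0 hg1 hφu,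
    rnDeriv_ofDensity (hg.aemeasurable.mul hu), rnDeriv_ofDensity hg.aemeasurable] with ω h1 h2 h3
  have h2' : (ofDensity P₀ fun ω => g ω * u ω).rnDeriv P₀ ω = ENNReal.ofReal (g ω * u ω) := h2
  rw [h1, h2', h3, ENNReal.toReal_ofReal (mul_nonneg (hg0 ω) (hu0 ω)), EReal.coe_ennreal_ofReal,
    max_eq_left (mul_nonneg (hg0 ω) ENNReal.toReal_nonneg), ENNReal.toReal_ofReal (hg0 ω),
    EReal.coe_sub, EReal.coe_sub, EReal.coe_ennreal_toReal (hφg ω).ne]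

omit [IsProbabilityMeasure P₀] in
lemma penFeasible_ofDensity (hg : Integrable g P₀) (hu : AEMeasurable u P₀)
    (hg0 : ∀ ω, 0 ≤ g ω) (hu0 : ∀ ω, 0 ≤ u ω) (hg1 : ∫ ω, g ω ∂P₀ = 1)
    (hgu : Integrable (fun ω => g ω * u ω) P₀) (hgu1 : ∫ ω, g ω * u ω ∂P₀ = 1) :
    PenFeasible P₀ (ofDensity P₀ g) (ofDensity P₀ fun ω => g ω * u ω) :=
  ⟨isProbabilityMeasure_ofDensity hg hg0 hg1,
    isProbabilityMeasure_ofDensity hgu (fun ω => mul_nonneg (hg0 ω) (hu0 ω)) hgu1,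
    ofDensity_absolutelyContinuous, ofDensity_mul_absolutelyContinuous hg.aemeasurable hu hg0⟩

lemma divergence_ofDensity_eq_ofReal (hg : AEMeasurable g P₀) (hg0 : ∀ ω, 0 ≤ g ω)
    (hφg : ∀ ω, φ₂ (g ω) < ⊤) (hi : Integrable (fun ω => (φ₂ (g ω)).toReal) P₀) :
    divergence φ₂ (ofDensity P₀ g) P₀ = ENNReal.ofReal (∫ ω, (φ₂ (g ω)).toReal ∂P₀) := by
  rw [divergence_ofDensity hg hg0,
    ofReal_integral_eq_lintegral_ofReal hi (.of_forall fun _ => ENNReal.toReal_nonneg)]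
  exact lintegral_congr fun ω => (ENNReal.ofReal_toReal (hφg ω).ne).symm

/-! ### Primal values of admissible pairs -/

variable (hφ₁ : IsDivergenceFunction φ₁) (hm₁ : Measurable φ₁) (hm₂ : Measurable φ₂)
  (hX : Integrable X P₀)

include hφ₁ hm₁ hX

/-- Bounded pairs have finite divergences, so their termwise and joint objectives agree and
normalized pairs are genuine competitors in the primal problem. -/
lemma AdmissiblePair.le_robustOCEBall (h : AdmissiblePair φ₁ φ₂ g u) (hm₂ : Measurable φ₂)
    (hg1 : ∫ ω, g ω ∂P₀ = 1) (hgu1 : ∫ ω, g ω * u ω ∂P₀ = 1) {r : ℝ}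
    (hr : ∫ ω, (φ₂ (g ω)).toReal ∂P₀ ≤ r) :
    ((∫ ω, (-X ω * (g ω * u ω) - g ω * (φ₁ (u ω)).toReal) ∂P₀ : ℝ) : EReal)
      ≤ robustOCEBall P₀ φ₁ φ₂ X r := by
  have hg0 : ∀ ω, 0 ≤ g ω := fun ω => (h.pos ω).le
  have hu0 := h.u_nonneg hφ₁
  have hf := penFeasible_ofDensity h.integrable_g h.meas_u.aemeasurable hg0 hu0 hg1
    (h.integrable_mul hφ₁) hgu1
  have := hf.prob
  have := hf.prob_bar
  rw [← extIntegral_coe (h.integrable_ball hφ₁ hm₁ hX), ← ballObjectiveJoint_ofDensity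
    h.integrable_g h.meas_u.aemeasurable hg0 hu0 hg1 h.dom₁, ← ballObjective_eq_joint hf.ac
    hf.ac_bar hm₁ hX.aemeasurable]
  · refine le_iSup_of_le _ (le_iSup_of_le _ (le_iSup_of_le ⟨hf.prob, hf.prob_bar, ?_, hf.ac_bar⟩
      le_rfl))
    rw [divergence_ofDensity_eq_ofReal h.meas_g.aemeasurable hg0 h.dom₂ (h.integrable_phi hm₂)]
    exact ENNReal.ofReal_le_ofReal hr
  · right
    rw [divergence_ofDensity_mul hm₁ h.integrable_g h.meas_u.aemeasurable hg0 hu0 hg1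
      (h.integrable_mul hφ₁) hgu1 h.dom₁, ← ofReal_integral_eq_lintegral_ofReal
      (h.integrable_mul_phi hm₁) (.of_forall fun ω => mul_nonneg (hg0 ω) ENNReal.toReal_nonneg)]
    exact ENNReal.ofReal_lt_top

lemma AdmissiblePair.le_robustOCEPen (h : AdmissiblePair φ₁ φ₂ g u) (hm₂ : Measurable φ₂)
    (hg1 : ∫ ω, g ω ∂P₀ = 1) (hgu1 : ∫ ω, g ω * u ω ∂P₀ = 1) :
    ((∫ ω, (-X ω * (g ω * u ω) - g ω * (φ₁ (u ω)).toReal) ∂P₀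
      - ∫ ω, (φ₂ (g ω)).toReal ∂P₀ : ℝ) : EReal) ≤ robustOCEPen P₀ φ₁ φ₂ X := by
  have hg0 : ∀ ω, 0 ≤ g ω := fun ω => (h.pos ω).le
  have hu0 := h.u_nonneg hφ₁
  have hf := penFeasible_ofDensity h.integrable_g h.meas_u.aemeasurable hg0 hu0 hg1
    (h.integrable_mul hφ₁) hgu1
  have := hf.prob
  have := hf.prob_bar
  have ib := h.integrable_ball hφ₁ hm₁ hX
  have ip := h.integrable_phi hm₂ (P₀ := P₀)
  have ibp : Integrable (fun ω => -X ω * (g ω * u ω) - g ω * (φ₁ (u ω)).toReal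
    - (φ₂ (g ω)).toReal) P₀ := ib.sub ip
  rw [← integral_sub ib ip, ← extIntegral_coe ibp]
  refine le_trans (le_of_eq ?_) (le_iSup_of_le (ofDensity P₀ g) (le_iSup_of_le _
    (le_iSup_of_le hf le_rfl)))
  rw [penObjective_eq_joint hf.ac hf.ac_bar hm₁ hm₂ hX.aemeasurable, penObjectiveJoint_ofDensity
    h.integrable_g h.meas_u.aemeasurable hg0 hu0 hg1 h.dom₁ h.dom₂]
  · right
    rw [divergence_ofDensity_mul hm₁ h.integrable_g h.meas_u.aemeasurable hg0 hu0 hg1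
      (h.integrable_mul hφ₁) hgu1 h.dom₁, ← ofReal_integral_eq_lintegral_ofReal
      (h.integrable_mul_phi hm₁) (.of_forall fun ω => mul_nonneg (hg0 ω) ENNReal.toReal_nonneg),
      divergence_ofDensity_eq_ofReal h.meas_g.aemeasurable hg0 h.dom₂ ip]
    exact ENNReal.add_lt_top.2 ⟨ENNReal.ofReal_lt_top, ENNReal.ofReal_lt_top⟩

end OfDensity

/-! ### Strong duality -/

section StrongDuality

variable {P₀ : Measure Ω} [IsProbabilityMeasure P₀] {φ₁ φ₂ : ℝ → ℝ≥0∞} {X : Ω → ℝ}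
  (hφ₁ : IsDivergenceFunction φ₁) (hφ₂ : IsDivergenceFunction φ₂)
  (hm₁ : Measurable φ₁) (hm₂ : Measurable φ₂) (hX : Integrable X P₀)

include hφ₁ hφ₂ in
variable (P₀) in
/-- Constant densities near `1` realize all nearby values of the constraints. -/
lemma exists_admissiblePair_near_one {r : ℝ} (hr : 0 < r) (d₁ d₂ d₃ : ℝ) :
    ∃ t : ℝ, 0 < t ∧ ∃ g u : Ω → ℝ, AdmissiblePair φ₁ φ₂ g u ∧ ∫ ω, g ω ∂P₀ = 1 + t * d₁ ∧
      ∫ ω, g ω * u ω ∂P₀ = 1 + t * d₂ ∧ ∫ ω, (φ₂ (g ω)).toReal ∂P₀ ≤ r + t * d₃ := by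
  have c1 : Filter.Tendsto (fun t : ℝ => 1 + t * d₁) (nhds 0) (nhds 1) := by
    have : Continuous fun t : ℝ => 1 + t * d₁ := by fun_prop
    simpa using this.tendsto 0
  have c2 : Filter.Tendsto (fun t : ℝ => (1 + t * d₂) / (1 + t * d₁)) (nhds 0) (nhds 1) := by
    have : Filter.Tendsto (fun t : ℝ => 1 + t * d₂) (nhds 0) (nhds 1) := by
      have : Continuous fun t : ℝ => 1 + t * d₂ := by fun_prop
      simpa using this.tendsto 0
    have h := this.div c1 one_ne_zero
    rwa [div_one] at h
  have c3 : Filter.Tendsto (fun t : ℝ => r + t * d₃) (nhds 0) (nhds r) := by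
    have : Continuous fun t : ℝ => r + t * d₃ := by fun_prop
    simpa using this.tendsto 0
  -- Slater's condition: near `1` the divergence drops below `r / 2` while the perturbed budget
  -- stays above `r / 2`.
  have h : ∀ᶠ t in nhds (0 : ℝ), 0 < 1 + t * d₁ ∧ φ₂ (1 + t * d₁) < ⊤ ∧
      φ₁ ((1 + t * d₂) / (1 + t * d₁)) < ⊤ ∧ (φ₂ (1 + t * d₁)).toReal < r / 2 ∧
      r / 2 < r + t * d₃ := by
    filter_upwards [c1.eventually_const_lt one_pos, c1.eventually hφ₂.lt_top_near_one,
      c2.eventually hφ₁.lt_top_near_one, c1.eventually (hφ₂.eventually_toReal_lt (half_pos hr)),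
      c3.eventually_const_lt (half_lt_self hr)] with t h1 h2 h3 h4 h5
    exact ⟨h1, h2, h3, h4, h5⟩
  obtain ⟨t, ht, ht0⟩ := ((h.filter_mono nhdsWithin_le_nhds).and
    (self_mem_nhdsWithin : Set.Ioi (0 : ℝ) ∈ nhdsWithin 0 (Set.Ioi 0))).exists
  obtain ⟨h1, h2, h3, h4, h5⟩ := ht
  refine ⟨t, ht0, _, _, AdmissiblePair.const h1 h2 h3, by simp, ?_, ?_⟩
  · simp [mul_div_cancel₀ _ h1.ne']
  · simpa using (h4.trans h5).le

include hφ₁ hφ₂ in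
lemma admissiblePair_one : AdmissiblePair φ₁ φ₂ (fun _ : Ω => (1 : ℝ)) (fun _ => 1) :=
  AdmissiblePair.const one_pos hφ₂.one_lt_top hφ₁.one_lt_top

lemma eq_top_or_exists_coe_of_coe_le {ρ : EReal} {c : ℝ} (h : (c : EReal) ≤ ρ) :
    ρ = ⊤ ∨ ∃ x : ℝ, ρ = x := by
  induction ρ with
  | bot => exact absurd (le_bot_iff.1 h) (EReal.coe_ne_bot _)
  | top => exact Or.inl rfl
  | coe x => exact Or.inr ⟨x, rfl⟩

include hφ₁ hφ₂ hm₁ hm₂ hX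

lemma exists_coe_le_robustOCEBall {r : ℝ} (hr : 0 < r) :
    ∃ c : ℝ, (c : EReal) ≤ robustOCEBall P₀ φ₁ φ₂ X r :=
  ⟨_, (admissiblePair_one hφ₁ hφ₂).le_robustOCEBall hφ₁ hm₁ hX hm₂ (by simp) (by simp)
    (by simpa [hφ₂.map_one] using hr.le)⟩

/-- If the primal value is `⊤` any multiplier works. Otherwise a supporting hyperplane to the
perturbed values, taken over the point `(1, 1)`, supplies the multipliers. -/
theorem exists_dual_le_robustOCEPen : ∃ θ₁ θ₂ : ℝ, ((-θ₁ - θ₂ : ℝ) : EReal)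
    + extIntegral P₀ (fun ω => dualIntegrand φ₁ φ₂ 1 θ₁ θ₂ (X ω)) ≤ robustOCEPen P₀ φ₁ φ₂ X := by
  rcases eq_top_or_exists_coe_of_coe_le ((admissiblePair_one hφ₁ hφ₂).le_robustOCEPen hφ₁ hm₁ hX hm₂
    (by simp) (by simp)) with h | ⟨ρ, hρ⟩
  · exact ⟨0, 0, h ▸ le_top⟩
  -- The inequality on the value makes this a hypograph. It is needed for convexity, since mixing
  -- pairs can only improve the objective.
  set A : Set ((ℝ × ℝ) × ℝ) := {p | ∃ g u : Ω → ℝ, AdmissiblePair φ₁ φ₂ g u ∧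
    ∫ ω, g ω ∂P₀ = p.1.1 ∧ ∫ ω, g ω * u ω ∂P₀ = p.1.2 ∧
    p.2 ≤ ∫ ω, (-X ω * (g ω * u ω) - g ω * (φ₁ (u ω)).toReal) ∂P₀
      - ∫ ω, (φ₂ (g ω)).toReal ∂P₀} with hA
  have hconv : Convex ℝ A := by
    rintro p ⟨g, u, h, h1, h2, h3⟩ p' ⟨g', u', h', h1', h2', h3'⟩ a b ha hb hab
    obtain ⟨k, v, hkv, e1, e2, e3, e4⟩ := h.exists_combo hφ₁ hφ₂ hm₁ hm₂ h' hX ha hb hab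
    refine ⟨k, v, hkv, ?_, ?_, ?_⟩
    · simp [e1, h1, h1']
    · simp [e2, h2, h2']
    · simp only [Prod.snd_add, Prod.smul_snd, smul_eq_mul]
      linarith [mul_le_mul_of_nonneg_left h3 ha, mul_le_mul_of_nonneg_left h3' hb]
  obtain ⟨ℓ, hℓ⟩ := exists_linear_le_of_convex hconv (x₀ := (1, 1)) (ρ := ρ) (fun d => by
      obtain ⟨t, ht, g, u, hgu, h1, h2, -⟩ :=
        exists_admissiblePair_near_one P₀ hφ₁ hφ₂ one_pos d.1 d.2 0
      exact ⟨t, ht, _, g, u, hgu, by simpa using h1, by simpa using h2, le_rfl⟩) (by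
      rintro c ⟨g, u, hgu, h1, h2, h3⟩
      have := hgu.le_robustOCEPen hφ₁ hm₁ hX hm₂ h1 h2
      rw [hρ, EReal.coe_le_coe_iff] at this
      exact h3.trans this)
  have hlin : ∀ x y : ℝ, ℓ (x, y) = x * ℓ (1, 0) + y * ℓ (0, 1) := fun x y => by
    rw [← smul_eq_mul, ← smul_eq_mul, ← map_smul, ← map_smul, ← map_add]
    simp
  -- The Lagrangian adds `θ₁ ∫ g + θ₂ ∫ g u`, which must cancel the slope of the hyperplane; hence
  -- the signs.
  refine ⟨-ℓ (1, 0), -ℓ (0, 1), ?_⟩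
  have := extIntegral_dualIntegrand_le hφ₁ hφ₂ hm₁ hm₂ hX zero_le_one (θ₁ := -ℓ (1, 0))
    (θ₂ := -ℓ (0, 1)) (K := ρ - ℓ (1, 0) - ℓ (0, 1)) fun g u hgu => by
      have h := hℓ (_, _) _ ⟨g, u, hgu, rfl, rfl, le_rfl⟩
      rw [Prod.mk_sub_mk, hlin] at h
      rw [hgu.integral_lagrangian hφ₁ hm₁ hm₂ hX]
      linarith
  calc _ ≤ ((- -ℓ (1, 0) - -ℓ (0, 1) : ℝ) : EReal) + ((ρ - ℓ (1, 0) - ℓ (0, 1) : ℝ) : EReal) := by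
        gcongr
    _ = robustOCEPen P₀ φ₁ φ₂ X := by
        rw [hρ, ← EReal.coe_add]
        congr 1
        ring

theorem exists_dual_le_robustOCEBall {r : ℝ} (hr : 0 < r) :
    ∃ θ₁ θ₂ lam : ℝ, 0 ≤ lam ∧ ((-θ₁ - θ₂ + lam * r : ℝ) : EReal)
      + extIntegral P₀ (fun ω => dualIntegrand φ₁ φ₂ lam θ₁ θ₂ (X ω))
        ≤ robustOCEBall P₀ φ₁ φ₂ X r := by
  obtain ⟨c₀, hc₀⟩ := exists_coe_le_robustOCEBall hφ₁ hφ₂ hm₁ hm₂ hX hr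
  rcases eq_top_or_exists_coe_of_coe_le hc₀ with h | ⟨ρ, hρ⟩
  · exact ⟨0, 0, 0, le_rfl, h ▸ le_top⟩
  -- The divergence enters as an inequality, so the set is closed under increasing the budget.
  -- Convexity uses this, and so does the sign of the third multiplier.
  set A : Set ((ℝ × ℝ × ℝ) × ℝ) := {p | ∃ g u : Ω → ℝ, AdmissiblePair φ₁ φ₂ g u ∧
    ∫ ω, g ω ∂P₀ = p.1.1 ∧ ∫ ω, g ω * u ω ∂P₀ = p.1.2.1 ∧
    ∫ ω, (φ₂ (g ω)).toReal ∂P₀ ≤ p.1.2.2 ∧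
    p.2 ≤ ∫ ω, (-X ω * (g ω * u ω) - g ω * (φ₁ (u ω)).toReal) ∂P₀} with hA
  have hconv : Convex ℝ A := by
    rintro p ⟨g, u, h, h1, h2, h3, h4⟩ p' ⟨g', u', h', h1', h2', h3', h4'⟩ a b ha hb hab
    obtain ⟨k, v, hkv, e1, e2, e3, e4⟩ := h.exists_combo hφ₁ hφ₂ hm₁ hm₂ h' hX ha hb hab
    refine ⟨k, v, hkv, ?_, ?_, ?_, ?_⟩
    · simp [e1, h1, h1']
    · simp [e2, h2, h2']
    · simp only [Prod.fst_add, Prod.snd_add, Prod.smul_fst, Prod.smul_snd, smul_eq_mul]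
      linarith [mul_le_mul_of_nonneg_left h3 ha, mul_le_mul_of_nonneg_left h3' hb]
    · simp only [Prod.snd_add, Prod.smul_snd, smul_eq_mul]
      linarith [mul_le_mul_of_nonneg_left h4 ha, mul_le_mul_of_nonneg_left h4' hb]
  have hle : ∀ c, ((1, 1, r), c) ∈ A → c ≤ ρ := by
    rintro c ⟨g, u, hgu, h1, h2, h3, h4⟩
    have := hgu.le_robustOCEBall hφ₁ hm₁ hX hm₂ h1 h2 h3
    rw [hρ, EReal.coe_le_coe_iff] at this
    exact h4.trans this
  obtain ⟨ℓ, hℓ⟩ := exists_linear_le_of_convex hconv (x₀ := (1, 1, r)) (ρ := ρ) (fun d => by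
      obtain ⟨t, ht, g, u, hgu, h1, h2, h3⟩ :=
        exists_admissiblePair_near_one P₀ hφ₁ hφ₂ hr d.1 d.2.1 d.2.2
      exact ⟨t, ht, _, g, u, hgu, by simpa using h1, by simpa using h2, by simpa using h3,
        le_rfl⟩) hle
  have hlin : ∀ x y z : ℝ,
      ℓ (x, y, z) = x * ℓ (1, 0, 0) + y * ℓ (0, 1, 0) + z * ℓ (0, 0, 1) := fun x y z => by
    rw [← smul_eq_mul, ← smul_eq_mul, ← smul_eq_mul, ← map_smul, ← map_smul, ← map_smul,
      ← map_add, ← map_add]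
    simp
  have hlam : 0 ≤ ℓ (0, 0, 1) := by
    by_contra! hneg
    set c := ∫ ω, (-X ω * (1 * 1) - 1 * (φ₁ 1).toReal) ∂P₀ with hc
    have hmem : ∀ z : ℝ, 0 ≤ z → ((1, 1, z), c) ∈ A := fun z hz =>
      ⟨_, _, admissiblePair_one hφ₁ hφ₂, by simp, by simp, by simpa [hφ₂.map_one] using hz, le_rfl⟩
    have h0 := hle c (hmem r hr.le)
    -- Increasing the budget by this amount at the constant pair `1` would lower the hyperplane to
    -- `c - 1`, below the attained value `c`.
    have hz : 0 ≤ (ρ - c + 1) / -ℓ (0, 0, 1) := div_nonneg (by linarith) (by linarith)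
    have := hℓ _ _ (hmem (r + (ρ - c + 1) / -ℓ (0, 0, 1)) (by linarith))
    rw [Prod.mk_sub_mk, Prod.mk_sub_mk, hlin, add_sub_cancel_left, sub_self, zero_mul, zero_add,
      div_mul_eq_mul_div, div_neg, mul_div_cancel_right₀ _ hneg.ne] at this
    linarith
  refine ⟨-ℓ (1, 0, 0), -ℓ (0, 1, 0), ℓ (0, 0, 1), hlam, ?_⟩
  have := extIntegral_dualIntegrand_le hφ₁ hφ₂ hm₁ hm₂ hX hlam (θ₁ := -ℓ (1, 0, 0))
    (θ₂ := -ℓ (0, 1, 0)) (K := ρ - ℓ (1, 0, 0) - ℓ (0, 1, 0) - ℓ (0, 0, 1) * r)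
    fun g u hgu => by
      have h := hℓ (_, _, _) _ ⟨g, u, hgu, rfl, rfl, le_rfl, le_rfl⟩
      rw [Prod.mk_sub_mk, Prod.mk_sub_mk, hlin] at h
      rw [hgu.integral_lagrangian hφ₁ hm₁ hm₂ hX]
      linarith
  calc _ ≤ ((- -ℓ (1, 0, 0) - -ℓ (0, 1, 0) + ℓ (0, 0, 1) * r : ℝ) : EReal)
        + ((ρ - ℓ (1, 0, 0) - ℓ (0, 1, 0) - ℓ (0, 0, 1) * r : ℝ) : EReal) := by
        gcongr
    _ = robustOCEBall P₀ φ₁ φ₂ X r := by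
        rw [hρ, ← EReal.coe_add]
        congr 1
        ring

/-! ### The dual problems -/

lemma robustOCEPen_le_dual (θ₁ θ₂ : ℝ) : robustOCEPen P₀ φ₁ φ₂ X ≤ ((-θ₁ - θ₂ : ℝ) : EReal)
    + extIntegral P₀ (fun ω => dualIntegrand φ₁ φ₂ 1 θ₁ θ₂ (X ω)) := by
  refine iSup_le fun Q => iSup_le fun Qbar => iSup_le fun h => ?_
  have := h.prob
  have := h.prob_bar
  exact (penObjective_le_joint h.ac h.ac_bar hm₁ hm₂ hX.aemeasurable).trans
    (penObjectiveJoint_le_dual hφ₁ hφ₂ hm₁ hm₂ hX.aemeasurable h.ac h.ac_bar θ₁ θ₂)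

omit hφ₁ hφ₂ hm₁ hm₂ hX [IsProbabilityMeasure P₀] in
lemma BallFeasible.ac {r : ℝ} {Q Qbar : Measure Ω} (h : BallFeasible P₀ φ₂ r Q Qbar) : Q ≪ P₀ := by
  have hd := h.div_le
  by_contra hn
  rw [divergence, if_neg hn] at hd
  exact ENNReal.ofReal_ne_top (top_le_iff.1 hd)

lemma robustOCEBall_le_dual {r : ℝ} (hr : 0 < r) (θ₁ θ₂ : ℝ) {lam : ℝ} (hlam : 0 ≤ lam) :
    robustOCEBall P₀ φ₁ φ₂ X r ≤ ((-θ₁ - θ₂ + lam * r : ℝ) : EReal)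
      + extIntegral P₀ (fun ω => dualIntegrand φ₁ φ₂ lam θ₁ θ₂ (X ω)) := by
  refine iSup_le fun Q => iSup_le fun Qbar => iSup_le fun h => ?_
  have := h.prob
  have := h.prob_bar
  exact (ballObjective_le_joint h.ac h.ac_bar hm₁ hX.aemeasurable).trans
    (ballObjectiveJoint_le_dual hφ₁ hφ₂ hm₁ hm₂ hX.aemeasurable hr.le h.div_le h.ac_bar θ₁ θ₂ hlam)

omit hφ₁ hφ₂ hm₁ hm₂ hX [MeasurableSpace Ω] in
lemma betaPen_eq (θ₁ θ₂ : ℝ) (ω : Ω) :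
    betaPen φ₁ φ₂ X θ₁ θ₂ ω = dualIntegrand φ₁ φ₂ 1 θ₁ θ₂ (X ω) :=
  conjugate_eq_supportConjugate _ _

omit hφ₁ hφ₂ hm₁ hm₂ hX [IsProbabilityMeasure P₀] in
lemma dualPen_eq (θ₁ θ₂ : ℝ) : dualPen P₀ φ₁ φ₂ X θ₁ θ₂ = ((-θ₁ - θ₂ : ℝ) : EReal)
    + extIntegral P₀ (fun ω => dualIntegrand φ₁ φ₂ 1 θ₁ θ₂ (X ω)) := by
  rw [dualPen]
  congr 2
  ext ω
  exact betaPen_eq θ₁ θ₂ ω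

omit hm₁ hm₂ hX [IsProbabilityMeasure P₀] in
lemma closedDualBall_eq (r θ₁ θ₂ : ℝ) {lam : ℝ} (hlam : 0 ≤ lam) :
    closedDualBall P₀ φ₁ φ₂ X r θ₁ θ₂ lam = ((-θ₁ - θ₂ + lam * r : ℝ) : EReal)
      + extIntegral P₀ (fun ω => dualIntegrand φ₁ φ₂ lam θ₁ θ₂ (X ω)) := by
  rw [closedDualBall]
  congr 2
  ext ω
  exact hφ₂.closedScaledConjugate_eq hlam (inner_ne_bot hφ₁ _ _)

omit hm₁ hm₂ hX [MeasurableSpace Ω] in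
lemma betaBall_eq (θ₁ θ₂ : ℝ) {lam : ℝ} (hlam : 0 < lam) (ω : Ω) :
    betaBall φ₁ φ₂ X θ₁ θ₂ lam ω = dualIntegrand φ₁ φ₂ lam θ₁ θ₂ (X ω) :=
  hφ₂.scaledConjugate_eq hlam (inner_ne_bot hφ₁ _ _)

omit hm₁ hm₂ hX [IsProbabilityMeasure P₀] in
lemma closedDualBall_eq_dualBall (r θ₁ θ₂ : ℝ) {lam : ℝ} (hlam : 0 < lam) :
    closedDualBall P₀ φ₁ φ₂ X r θ₁ θ₂ lam = dualBall P₀ φ₁ φ₂ X r θ₁ θ₂ lam := by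
  rw [closedDualBall_eq hφ₁ hφ₂ r θ₁ θ₂ hlam.le, dualBall]
  congr 2
  ext ω
  exact (betaBall_eq hφ₁ hφ₂ θ₁ θ₂ hlam ω).symm

omit hm₁ hm₂ hX [IsProbabilityMeasure P₀] in
-- The two conventions differ only at `lam = 0`, where the support function is the smaller one.
lemma closedDualBall_le_dualBall (r θ₁ θ₂ : ℝ) {lam : ℝ} (hlam : 0 ≤ lam) :
    closedDualBall P₀ φ₁ φ₂ X r θ₁ θ₂ lam ≤ dualBall P₀ φ₁ φ₂ X r θ₁ θ₂ lam := by
  rw [closedDualBall_eq hφ₁ hφ₂ r θ₁ θ₂ hlam, dualBall]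
  gcongr
  exact extIntegral_mono (.of_forall fun ω =>
    hφ₂.supportConjugate_le_scaledConjugate hlam (inner_ne_bot hφ₁ _ _))

omit hm₁ hm₂ hX [IsProbabilityMeasure P₀] in
lemma closedDualBall_eq_dualBall_of_dom (hdom : ∀ t : ℝ, 0 < t → φ₂ t < ⊤) (r θ₁ θ₂ : ℝ) {lam : ℝ}
    (hlam : 0 ≤ lam) :
    closedDualBall P₀ φ₁ φ₂ X r θ₁ θ₂ lam = dualBall P₀ φ₁ φ₂ X r θ₁ θ₂ lam := by
  rcases hlam.eq_or_lt with rfl | h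
  · rw [closedDualBall_eq hφ₁ hφ₂ r θ₁ θ₂ hlam, dualBall]
    congr 2
    ext ω
    exact (hφ₂.scaledConjugate_zero_eq hdom (inner_ne_bot hφ₁ _ _)).symm
  · exact closedDualBall_eq_dualBall hφ₁ hφ₂ r θ₁ θ₂ h

theorem exists_dualPen_eq : ∃ θ₁ θ₂ : ℝ,
    dualPen P₀ φ₁ φ₂ X θ₁ θ₂ = robustOCEPen P₀ φ₁ φ₂ X := by
  obtain ⟨θ₁, θ₂, h⟩ := exists_dual_le_robustOCEPen hφ₁ hφ₂ hm₁ hm₂ hX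
  rw [← dualPen_eq] at h
  refine ⟨θ₁, θ₂, h.antisymm ?_⟩
  rw [dualPen_eq]
  exact robustOCEPen_le_dual hφ₁ hφ₂ hm₁ hm₂ hX θ₁ θ₂

lemma robustOCEPen_le_dualPen (θ₁ θ₂ : ℝ) :
    robustOCEPen P₀ φ₁ φ₂ X ≤ dualPen P₀ φ₁ φ₂ X θ₁ θ₂ := by
  rw [dualPen_eq]
  exact robustOCEPen_le_dual hφ₁ hφ₂ hm₁ hm₂ hX θ₁ θ₂

theorem robustOCEPen_eq_iInf :
    robustOCEPen P₀ φ₁ φ₂ X = ⨅ (θ₁ : ℝ) (θ₂ : ℝ), dualPen P₀ φ₁ φ₂ X θ₁ θ₂ := by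
  refine le_antisymm (le_iInf fun θ₁ => le_iInf fun θ₂ =>
    robustOCEPen_le_dualPen hφ₁ hφ₂ hm₁ hm₂ hX θ₁ θ₂) ?_
  obtain ⟨θ₁, θ₂, h⟩ := exists_dualPen_eq hφ₁ hφ₂ hm₁ hm₂ hX
  exact (iInf_le_of_le θ₁ (iInf_le _ θ₂)).trans h.le

lemma robustOCEBall_le_closedDualBall {r : ℝ} (hr : 0 < r) (θ₁ θ₂ : ℝ) {lam : ℝ}
    (hlam : 0 ≤ lam) :
    robustOCEBall P₀ φ₁ φ₂ X r ≤ closedDualBall P₀ φ₁ φ₂ X r θ₁ θ₂ lam := by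
  rw [closedDualBall_eq hφ₁ hφ₂ r θ₁ θ₂ hlam]
  exact robustOCEBall_le_dual hφ₁ hφ₂ hm₁ hm₂ hX hr θ₁ θ₂ hlam

theorem exists_closedDualBall_eq {r : ℝ} (hr : 0 < r) : ∃ θ₁ θ₂ lam : ℝ, 0 ≤ lam ∧
    closedDualBall P₀ φ₁ φ₂ X r θ₁ θ₂ lam = robustOCEBall P₀ φ₁ φ₂ X r := by
  obtain ⟨θ₁, θ₂, lam, hlam, h⟩ := exists_dual_le_robustOCEBall hφ₁ hφ₂ hm₁ hm₂ hX hr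
  rw [← closedDualBall_eq hφ₁ hφ₂ r θ₁ θ₂ hlam] at h
  exact ⟨θ₁, θ₂, lam, hlam,
    h.antisymm (robustOCEBall_le_closedDualBall hφ₁ hφ₂ hm₁ hm₂ hX hr θ₁ θ₂ hlam)⟩

/-- The closed dual is attained at some `lam ≥ 0`. If `lam > 0` the two duals agree there; if `lam =
0` the value is approached through positive multipliers. -/
theorem robustOCEBall_eq_iInf {r : ℝ} (hr : 0 < r) :
    robustOCEBall P₀ φ₁ φ₂ X r
      = ⨅ (θ₁ : ℝ) (θ₂ : ℝ) (lam : ℝ) (_ : 0 ≤ lam), dualBall P₀ φ₁ φ₂ X r θ₁ θ₂ lam := by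
  refine le_antisymm (le_iInf fun θ₁ => le_iInf fun θ₂ => le_iInf fun lam => le_iInf fun hlam =>
    (robustOCEBall_le_closedDualBall hφ₁ hφ₂ hm₁ hm₂ hX hr θ₁ θ₂ hlam).trans
      (closedDualBall_le_dualBall hφ₁ hφ₂ r θ₁ θ₂ hlam)) ?_
  obtain ⟨θ₁, θ₂, lam, hlam, h⟩ := exists_closedDualBall_eq hφ₁ hφ₂ hm₁ hm₂ hX hr
  have hinf : ∀ μ : ℝ, 0 < μ → (⨅ (θ₁ : ℝ) (θ₂ : ℝ) (lam : ℝ) (_ : 0 ≤ lam),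
      dualBall P₀ φ₁ φ₂ X r θ₁ θ₂ lam) ≤ closedDualBall P₀ φ₁ φ₂ X r θ₁ θ₂ μ := fun μ hμ =>
    (iInf_le_of_le θ₁ (iInf_le_of_le θ₂ (iInf_le_of_le μ (iInf_le _ hμ.le)))).trans
      (closedDualBall_eq_dualBall hφ₁ hφ₂ r θ₁ θ₂ hμ).ge
  rcases hlam.eq_or_lt with rfl | hpos
  · refine EReal.le_of_forall_lt_iff_le.1 fun z hz => ?_
    obtain ⟨c, hc⟩ := exists_coe_le_robustOCEBall hφ₁ hφ₂ hm₁ hm₂ hX hr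
    rcases eq_top_or_exists_coe_of_coe_le hc with htop | ⟨ρ, hρ⟩
    · simp [htop] at hz
    rw [hρ, EReal.coe_lt_coe_iff] at hz
    -- This multiplier makes the extra cost `lam r` equal to `z - ρ`, and the integrand at a
    -- positive `lam` is at most the one at `0`.
    refine (hinf ((z - ρ) / r) (div_pos (sub_pos.2 hz) hr)).trans ?_
    calc closedDualBall P₀ φ₁ φ₂ X r θ₁ θ₂ ((z - ρ) / r)
        ≤ ((-θ₁ - θ₂ + (z - ρ) / r * r : ℝ) : EReal)
          + extIntegral P₀ (fun ω => dualIntegrand φ₁ φ₂ 0 θ₁ θ₂ (X ω)) := by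
          have hμ : 0 ≤ (z - ρ) / r := (div_pos (sub_pos.2 hz) hr).le
          rw [closedDualBall_eq hφ₁ hφ₂ r θ₁ θ₂ hμ]
          gcongr
          exact extIntegral_mono (.of_forall fun ω => supportConjugate_anti hμ _)
      _ = ((z - ρ : ℝ) : EReal) + closedDualBall P₀ φ₁ φ₂ X r θ₁ θ₂ 0 := by
          rw [closedDualBall_eq hφ₁ hφ₂ r θ₁ θ₂ le_rfl, ← add_assoc, ← EReal.coe_add,
            div_mul_cancel₀ _ hr.ne']
          congr 2
          ring
      _ = (z : EReal) := by
          rw [h, hρ, ← EReal.coe_add, sub_add_cancel]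
      _ ≤ (z : EReal) := le_rfl
  · exact (hinf lam hpos).trans h.le

end StrongDuality

/-! ### Differentiable conjugates -/

section Conjugate

variable {φ φ₁ φ₂ : ℝ → ℝ≥0∞}

/-- The conjugate as a real function. -/
noncomputable def realConjugate (φ : ℝ → ℝ≥0∞) (s : ℝ) : ℝ := (conjugate φ (s : EReal)).toReal

lemma coe_realConjugate (hφ : IsDivergenceFunction φ) (hfin : ∀ s : ℝ, conjugate φ (s : EReal) < ⊤)
    (s : ℝ) : (realConjugate φ s : EReal) = conjugate φ (s : EReal) :=
  EReal.coe_toReal (hfin s).ne ((EReal.bot_lt_coe s).trans_le (hφ.le_conjugate _)).ne'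

lemma le_realConjugate (hφ : IsDivergenceFunction φ)
    (hfin : ∀ s : ℝ, conjugate φ (s : EReal) < ⊤) {t : ℝ} (ht : φ t < ⊤) (s : ℝ) :
    t * s - (φ t).toReal ≤ realConjugate φ s := by
  rw [← EReal.coe_le_coe_iff, coe_realConjugate hφ hfin]
  exact le_conjugate_of_lt_top ht s

/-- Finiteness of the conjugate at `s + 1` confines the near-maximizers to a compact interval, on
which lower semicontinuity provides a maximizer. -/
lemma exists_realConjugate_eq (hφ : IsDivergenceFunction φ) (hlsc : LowerSemicontinuous φ)
    (hfin : ∀ s : ℝ, conjugate φ (s : EReal) < ⊤) (s : ℝ) :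
    ∃ t, φ t < ⊤ ∧ realConjugate φ s = t * s - (φ t).toReal := by
  -- For `t > B`, the inequality `t (s + 1) - φ t ≤ φ*(s + 1)` gives `t s - φ t ≤ φ*(s + 1) - t <
  -- φ*(s) - 1`.
  set B := max 1 (realConjugate φ (s + 1) - realConjugate φ s + 1) with hB
  have hB1 : 1 ≤ B := le_max_left _ _
  have hfar : ∀ t, φ t < ⊤ → B < t → t * s - (φ t).toReal ≤ realConjugate φ s - 1 := by
    intro t ht hBt
    have h1 := le_realConjugate hφ hfin ht (s + 1)
    have h2 : realConjugate φ (s + 1) - realConjugate φ s + 1 ≤ B := le_max_right _ _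
    linarith
  -- Adding `B * |s|` keeps `B * |s| - t * s` nonnegative on `[0, B]`, so the minimization takes
  -- place in `ℝ≥0∞` and `ENNReal.ofReal` truncates nothing there.
  have hk : LowerSemicontinuous fun t => φ t + ENNReal.ofReal (B * |s| - t * s) :=
    hlsc.add (ENNReal.continuous_ofReal.comp (by fun_prop)).lowerSemicontinuous
  have h1B : (1 : ℝ) ∈ Set.Icc 0 B := ⟨by norm_num, hB1⟩
  obtain ⟨t₀, ht₀, hmin⟩ := (hk.lowerSemicontinuousOn (Set.Icc 0 B)).exists_isMinOn
    ⟨1, h1B⟩ isCompact_Icc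
  have hnn : ∀ t ∈ Set.Icc 0 B, 0 ≤ B * |s| - t * s := fun t ht => by
    have : t * s ≤ t * |s| := mul_le_mul_of_nonneg_left (le_abs_self s) ht.1
    have : t * |s| ≤ B * |s| := mul_le_mul_of_nonneg_right ht.2 (abs_nonneg s)
    linarith
  have hdom : φ t₀ < ⊤ := by
    have h1 := hmin h1B
    simp only [Set.mem_ofPred_eq, hφ.map_one, zero_add] at h1
    exact (le_self_add.trans h1).trans_lt ENNReal.ofReal_lt_top
  have hnear : ∀ t, φ t < ⊤ → t ∈ Set.Icc 0 B →
      t * s - (φ t).toReal ≤ t₀ * s - (φ t₀).toReal := fun t ht htB => by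
    have h1 := hmin htB
    simp only [Set.mem_ofPred_eq] at h1
    have h2 := ENNReal.toReal_mono (by finiteness) h1
    rw [ENNReal.toReal_add (by finiteness) (by finiteness),
      ENNReal.toReal_add (by finiteness) (by finiteness), ENNReal.toReal_ofReal (hnn t₀ ht₀),
      ENNReal.toReal_ofReal (hnn t htB)] at h2
    linarith
  refine ⟨t₀, hdom, le_antisymm ?_ (le_realConjugate hφ hfin hdom s)⟩
  have hle : realConjugate φ s ≤ max (t₀ * s - (φ t₀).toReal) (realConjugate φ s - 1) := by
    rw [← EReal.coe_le_coe_iff, coe_realConjugate hφ hfin, conjugate_eq_supportConjugate]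
    refine iSup_le fun ⟨t, ht⟩ => ?_
    rw [one_mul, ← EReal.coe_mul, ← EReal.coe_sub, EReal.coe_le_coe_iff]
    rcases le_or_gt t B with h | h
    · exact (hnear t ht ⟨hφ.nonneg_of_lt_top ht, h⟩).trans (le_max_left _ _)
    · exact (hfar t ht h).trans (le_max_right _ _)
  rcases le_max_iff.1 hle with h | h
  · exact h
  · linarith

/-- The derivative of a differentiable conjugate is a maximizer in its definition. -/
lemma realConjugate_eq_deriv (hφ : IsDivergenceFunction φ) (hlsc : LowerSemicontinuous φ)
    (hd : DifferentiableConjugate φ) (s : ℝ) :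
    φ (deriv (realConjugate φ) s) < ⊤ ∧ realConjugate φ s
      = deriv (realConjugate φ) s * s - (φ (deriv (realConjugate φ) s)).toReal := by
  obtain ⟨t, ht, heq⟩ := exists_realConjugate_eq hφ hlsc hd.1 s
  have hder : HasDerivAt (fun y => realConjugate φ y - t * y)
      (deriv (realConjugate φ) s - t * 1) s :=
    (hd.2 s).hasDerivAt.sub ((hasDerivAt_id s).const_mul t)
  -- A maximizer `t` at `s` is a subgradient of the conjugate, so differentiability leaves only `t =
  -- deriv (realConjugate φ) s`.
  have hmin : IsLocalMin (fun y => realConjugate φ y - t * y) s := .of_forall fun y => by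
    have := le_realConjugate hφ hd.1 ht y
    simp only
    linarith
  have h0 := hmin.hasDerivAt_eq_zero hder
  have : deriv (realConjugate φ) s = t := by linarith
  rw [this]
  exact ⟨ht, heq⟩

/-! ### The dual integrand as a real function -/

/-- The real value of the dual integrand, for `lam > 0`. -/
noncomputable def realIntegrand (φ₁ φ₂ : ℝ → ℝ≥0∞) (lam θ₁ θ₂ x : ℝ) : ℝ :=
  lam * realConjugate φ₂ ((realConjugate φ₁ (θ₂ - x) + θ₁) / lam)

/-- The maximizing density ratio `dQbar/dQ`. -/
noncomputable def innerMaximizer (φ₁ : ℝ → ℝ≥0∞) (θ₂ x : ℝ) : ℝ :=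
  deriv (realConjugate φ₁) (θ₂ - x)

/-- The maximizing density `dQ/dP₀`. -/
noncomputable def outerMaximizer (φ₁ φ₂ : ℝ → ℝ≥0∞) (lam θ₁ θ₂ x : ℝ) : ℝ :=
  deriv (realConjugate φ₂) ((realConjugate φ₁ (θ₂ - x) + θ₁) / lam)

variable (hφ₁ : IsDivergenceFunction φ₁) (hφ₂ : IsDivergenceFunction φ₂)
  (hlsc₁ : LowerSemicontinuous φ₁) (hlsc₂ : LowerSemicontinuous φ₂)
  (hd₁ : DifferentiableConjugate φ₁) (hd₂ : DifferentiableConjugate φ₂)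

include hφ₁ hφ₂ hd₁ hd₂ in
lemma dualIntegrand_eq_coe {lam : ℝ} (hlam : 0 < lam) (θ₁ θ₂ x : ℝ) :
    dualIntegrand φ₁ φ₂ lam θ₁ θ₂ x = (realIntegrand φ₁ φ₂ lam θ₁ θ₂ x : EReal) := by
  rw [dualIntegrand, ← hφ₂.mul_conjugate_div hlam (inner_ne_bot hφ₁ _ _),
    ← coe_realConjugate hφ₁ hd₁.1, ← EReal.coe_add, ← EReal.coe_div,
    ← coe_realConjugate hφ₂ hd₂.1, ← EReal.coe_mul, realIntegrand]

include hφ₁ hlsc₁ hd₁ in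
lemma innerMaximizer_lt_top (θ₂ x : ℝ) : φ₁ (innerMaximizer φ₁ θ₂ x) < ⊤ :=
  (realConjugate_eq_deriv hφ₁ hlsc₁ hd₁ _).1

include hφ₂ hlsc₂ hd₂ in
lemma outerMaximizer_lt_top (lam θ₁ θ₂ x : ℝ) : φ₂ (outerMaximizer φ₁ φ₂ lam θ₁ θ₂ x) < ⊤ :=
  (realConjugate_eq_deriv hφ₂ hlsc₂ hd₂ _).1

include hφ₁ hφ₂ hlsc₁ hlsc₂ hd₁ hd₂ in
lemma realIntegrand_eq_lagrangian {lam : ℝ} (hlam : 0 < lam) (θ₁ θ₂ x : ℝ) :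
    realIntegrand φ₁ φ₂ lam θ₁ θ₂ x = lagrangian φ₁ φ₂ lam θ₁ θ₂ x
      (outerMaximizer φ₁ φ₂ lam θ₁ θ₂ x) (innerMaximizer φ₁ θ₂ x) := by
  have e1 : realConjugate φ₁ (θ₂ - x) = innerMaximizer φ₁ θ₂ x * (θ₂ - x)
      - (φ₁ (innerMaximizer φ₁ θ₂ x)).toReal := (realConjugate_eq_deriv hφ₁ hlsc₁ hd₁ _).2
  rw [lagrangian, ← e1, realIntegrand, (realConjugate_eq_deriv hφ₂ hlsc₂ hd₂ _).2, outerMaximizer]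
  field_simp

include hφ₁ hφ₂ hd₁ hd₂ in
lemma lagrangian_le_realIntegrand {lam : ℝ} (hlam : 0 < lam) (θ₁ θ₂ x : ℝ) {t u : ℝ}
    (ht : φ₂ t < ⊤) (hu : φ₁ u < ⊤) :
    lagrangian φ₁ φ₂ lam θ₁ θ₂ x t u ≤ realIntegrand φ₁ φ₂ lam θ₁ θ₂ x := by
  rw [← EReal.coe_le_coe_iff, ← dualIntegrand_eq_coe hφ₁ hφ₂ hd₁ hd₂ hlam]
  exact lagrangian_le_dualIntegrand hφ₂ ht hu lam θ₁ θ₂ x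

include hφ₁ hφ₂ hlsc₁ hlsc₂ hd₁ hd₂ in
-- The integrand is a maximum of Lagrangians, each affine in `(lam, θ₁, θ₂)`. The maximizer at the
-- intermediate point serves as a test point at both ends.
lemma convexOn_realIntegrand_line {lam : ℝ} (θ₁ θ₂ x e₁ e₂ e₃ : ℝ) {δ : ℝ}
    (hpos : ∀ h ∈ Set.Icc (-δ) δ, 0 < lam + h * e₃) :
    ConvexOn ℝ (Set.Icc (-δ) δ) fun h =>
      realIntegrand φ₁ φ₂ (lam + h * e₃) (θ₁ + h * e₁) (θ₂ + h * e₂) x := by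
  refine ⟨convex_Icc _ _, fun h hh k hk a b ha hb hab => ?_⟩
  have hm := convex_Icc (-δ) δ hh hk ha hb hab
  simp only [smul_eq_mul] at hm ⊢
  rw [realIntegrand_eq_lagrangian hφ₁ hφ₂ hlsc₁ hlsc₂ hd₁ hd₂ (hpos _ hm)]
  set t := outerMaximizer φ₁ φ₂ (lam + (a * h + b * k) * e₃) (θ₁ + (a * h + b * k) * e₁)
    (θ₂ + (a * h + b * k) * e₂) x with htdef
  set u := innerMaximizer φ₁ (θ₂ + (a * h + b * k) * e₂) x with hudef
  have ht : φ₂ t < ⊤ := outerMaximizer_lt_top hφ₂ hlsc₂ hd₂ _ _ _ _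
  have hu : φ₁ u < ⊤ := innerMaximizer_lt_top hφ₁ hlsc₁ hd₁ _ _
  have h1 := mul_le_mul_of_nonneg_left (lagrangian_le_realIntegrand hφ₁ hφ₂ hd₁ hd₂ (hpos h hh)
    (θ₁ + h * e₁) (θ₂ + h * e₂) x ht hu) ha
  have h2 := mul_le_mul_of_nonneg_left (lagrangian_le_realIntegrand hφ₁ hφ₂ hd₁ hd₂ (hpos k hk)
    (θ₁ + k * e₁) (θ₂ + k * e₂) x ht hu) hb
  refine le_trans (le_of_eq ?_) (add_le_add h1 h2)
  obtain rfl : b = 1 - a := by linarith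
  simp only [lagrangian]
  ring

include hφ₂ hlsc₂ hd₁ hd₂ in
-- The envelope formula: the coefficients of the direction are those of the Lagrangian at the
-- maximizer. For `lam` it rests on `φ*(s) - s φ*'(s) = -φ(φ*'(s))`.
lemma hasDerivAt_realIntegrand_line {lam : ℝ} (hlam : 0 < lam) (θ₁ θ₂ x e₁ e₂ e₃ : ℝ) :
    HasDerivAt (fun h => realIntegrand φ₁ φ₂ (lam + h * e₃) (θ₁ + h * e₁) (θ₂ + h * e₂) x)
      (outerMaximizer φ₁ φ₂ lam θ₁ θ₂ x * e₁
        + outerMaximizer φ₁ φ₂ lam θ₁ θ₂ x * innerMaximizer φ₁ θ₂ x * e₂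
        - (φ₂ (outerMaximizer φ₁ φ₂ lam θ₁ θ₂ x)).toReal * e₃) 0 := by
  have lin : ∀ p e : ℝ, HasDerivAt (fun h : ℝ => p + h * e) e 0 := fun p e => by
    simpa using ((hasDerivAt_id (0 : ℝ)).mul_const e).const_add p
  have hN : HasDerivAt (fun h : ℝ => realConjugate φ₁ (θ₂ + h * e₂ - x) + (θ₁ + h * e₁))
      (innerMaximizer φ₁ θ₂ x * e₂ + e₁) 0 := by
    refine HasDerivAt.add ?_ (lin θ₁ e₁)
    have hin : HasDerivAt (fun h : ℝ => θ₂ + h * e₂ - x) e₂ 0 := (lin θ₂ e₂).sub_const x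
    have hout : HasDerivAt (realConjugate φ₁) (innerMaximizer φ₁ θ₂ x) (θ₂ + 0 * e₂ - x) := by
      rw [zero_mul, add_zero]
      exact (hd₁.2 _).hasDerivAt
    exact hout.comp 0 hin
  have hL := lin lam e₃
  have hL0 : lam + 0 * e₃ ≠ 0 := by simpa using hlam.ne'
  have hdiv := hN.div hL hL0
  have hout : HasDerivAt (realConjugate φ₂) (outerMaximizer φ₁ φ₂ lam θ₁ θ₂ x)
      ((realConjugate φ₁ (θ₂ + 0 * e₂ - x) + (θ₁ + 0 * e₁)) / (lam + 0 * e₃)) := by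
    simp only [zero_mul, add_zero]
    exact (hd₂.2 _).hasDerivAt
  have := hL.mul (hout.comp 0 hdiv)
  refine this.congr_deriv ?_
  simp only [Function.comp, Pi.div_apply, zero_mul, add_zero]
  rw [(realConjugate_eq_deriv hφ₂ hlsc₂ hd₂ ((realConjugate φ₁ (θ₂ - x) + θ₁) / lam)).2,
    outerMaximizer]
  field_simp
  ring

include hd₁ hd₂ in
lemma continuous_realIntegrand (lam θ₁ θ₂ : ℝ) : Continuous (realIntegrand φ₁ φ₂ lam θ₁ θ₂) := by
  have h1 : Continuous (realConjugate φ₁) := hd₁.2.continuous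
  have h2 : Continuous (realConjugate φ₂) := hd₂.2.continuous
  unfold realIntegrand
  fun_prop

lemma measurable_innerMaximizer (θ₂ : ℝ) : Measurable (innerMaximizer φ₁ θ₂) :=
  (measurable_deriv _).comp (measurable_id.const_sub θ₂)

include hφ₁ hφ₂ hd₁ hd₂ in
lemma le_realIntegrand {lam : ℝ} (hlam : 0 < lam) (θ₁ θ₂ x : ℝ) :
    θ₂ - x + θ₁ ≤ realIntegrand φ₁ φ₂ lam θ₁ θ₂ x := by
  have := lagrangian_le_realIntegrand hφ₁ hφ₂ hd₁ hd₂ hlam θ₁ θ₂ x hφ₂.one_lt_top hφ₁.one_lt_top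
  simpa [lagrangian, hφ₁.map_one, hφ₂.map_one] using this

end Conjugate

/-! ### First-order conditions -/

section FirstOrder

variable {P₀ : Measure Ω}

/-- Convexity traps the difference quotients on `(0, δ]` between the integrable quotients at `-δ`
and `δ`, so dominated convergence applies without further assumptions. Optimality bounds every
quotient's integral below by `c`. -/
lemma le_integral_deriv_of_convexOn {b : ℝ → Ω → ℝ} {d : Ω → ℝ} {δ c : ℝ} (hδ : 0 < δ)
    (hconv : ∀ ω, ConvexOn ℝ (Set.Icc (-δ) δ) fun h => b h ω)
    (hint : ∀ h ∈ Set.Icc (-δ) δ, Integrable (b h) P₀)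
    (hder : ∀ ω, HasDerivAt (fun h => b h ω) (d ω) 0)
    (hopt : ∀ h ∈ Set.Icc (-δ) δ, ∫ ω, b 0 ω ∂P₀ + h * c ≤ ∫ ω, b h ω ∂P₀) :
    Integrable d P₀ ∧ c ≤ ∫ ω, d ω ∂P₀ := by
  have m0 : (0 : ℝ) ∈ Set.Icc (-δ) δ := ⟨by linarith, hδ.le⟩
  have mδ : δ ∈ Set.Icc (-δ) δ := ⟨by linarith, le_rfl⟩
  have mnδ : -δ ∈ Set.Icc (-δ) δ := ⟨le_rfl, by linarith⟩
  set h : ℕ → ℝ := fun n => δ / (n + 1) with hh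
  have hpos : ∀ n, 0 < h n := fun n => by positivity
  have hle : ∀ n, h n ≤ δ := fun n =>
    div_le_self hδ.le (by linarith [(Nat.cast_nonneg n : (0 : ℝ) ≤ n)])
  have mh : ∀ n, h n ∈ Set.Icc (-δ) δ := fun n => ⟨by linarith [hpos n], hle n⟩
  set q : ℕ → Ω → ℝ := fun n ω => (b (h n) ω - b 0 ω) / h n with hq
  have hqi : ∀ n, Integrable (q n) P₀ := fun n => ((hint _ (mh n)).sub (hint 0 m0)).div_const _
  set hi : Ω → ℝ := fun ω => (b δ ω - b 0 ω) / δ with hhi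
  set lo : Ω → ℝ := fun ω => (b (-δ) ω - b 0 ω) / (-δ) with hlo
  have ihi : Integrable hi P₀ := ((hint _ mδ).sub (hint 0 m0)).div_const _
  have ilo : Integrable lo P₀ := ((hint _ mnδ).sub (hint 0 m0)).div_const _
  have hub : ∀ n ω, q n ω ≤ hi ω := fun n ω => by
    simpa [hq, hhi] using (hconv ω).secant_mono m0 (mh n) mδ (hpos n).ne' hδ.ne' (hle n)
  have hlb : ∀ n ω, lo ω ≤ q n ω := fun n ω => by
    have := (hconv ω).secant_mono m0 mnδ (mh n) (by linarith) (hpos n).ne' (by linarith [hpos n])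
    rwa [sub_zero, sub_zero] at this
  have hbound : ∀ n, ∀ᵐ ω ∂P₀, ‖q n ω‖ ≤ |lo ω| + |hi ω| := fun n => .of_forall fun ω => by
    rw [Real.norm_eq_abs, abs_le]
    have := hub n ω
    have := hlb n ω
    constructor <;> linarith [neg_abs_le (lo ω), le_abs_self (hi ω), abs_nonneg (lo ω),
      abs_nonneg (hi ω)]
  have hh0 : Filter.Tendsto h Filter.atTop (nhdsWithin 0 {0}ᶜ) := by
    refine tendsto_nhdsWithin_iff.2 ⟨?_, .of_forall fun n => (hpos n).ne'⟩
    simpa [hh, div_eq_mul_inv] using tendsto_one_div_add_atTop_nhds_zero_nat.const_mul δ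
  have hlim : ∀ ω, Filter.Tendsto (fun n => q n ω) Filter.atTop (nhds (d ω)) := fun ω => by
    have := (hasDerivAt_iff_tendsto_slope_zero.1 (hder ω)).comp hh0
    refine this.congr fun n => ?_
    simp [hq, div_eq_inv_mul]
  have ib : Integrable (fun ω => |lo ω| + |hi ω|) P₀ := ilo.abs.add ihi.abs
  have hdi : Integrable d P₀ := by
    refine ib.mono' (aestronglyMeasurable_of_tendsto_ae Filter.atTop (fun n => (hqi n).1)
      (.of_forall hlim)) ?_
    filter_upwards [ae_all_iff.2 hbound] with ω hω
    exact le_of_tendsto (hlim ω).norm (.of_forall hω)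
  refine ⟨hdi, ?_⟩
  have := tendsto_integral_of_dominated_convergence _ (fun n => (hqi n).1) ib hbound
    (.of_forall hlim)
  refine ge_of_tendsto this (.of_forall fun n => ?_)
  rw [hq, integral_div, le_div_iff₀ (hpos n), integral_sub (hint _ (mh n)) (hint 0 m0)]
  linarith [hopt _ (mh n)]

/-- Differentiation under the integral at a minimum, for an integrand that is convex along a line:
if `∫ b h - h c` is minimal at `h = 0`, then the derivative of `b` has integral `c`. -/
theorem integral_deriv_eq_of_convexOn {b : ℝ → Ω → ℝ} {d : Ω → ℝ} {δ c : ℝ} (hδ : 0 < δ)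
    (hconv : ∀ ω, ConvexOn ℝ (Set.Icc (-δ) δ) fun h => b h ω)
    (hint : ∀ h ∈ Set.Icc (-δ) δ, Integrable (b h) P₀)
    (hder : ∀ ω, HasDerivAt (fun h => b h ω) (d ω) 0)
    (hopt : ∀ h ∈ Set.Icc (-δ) δ, ∫ ω, b 0 ω ∂P₀ + h * c ≤ ∫ ω, b h ω ∂P₀) :
    Integrable d P₀ ∧ ∫ ω, d ω ∂P₀ = c := by
  obtain ⟨hi, hle⟩ := le_integral_deriv_of_convexOn hδ hconv hint hder hopt
  have hneg : ∀ h ∈ Set.Icc (-δ) δ, -h ∈ Set.Icc (-δ) δ := fun h hh =>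
    ⟨by linarith [hh.2], by linarith [hh.1]⟩
  -- The opposite inequality is the same one-sided bound for the reversed line `h ↦ -h`.
  have h2 := (le_integral_deriv_of_convexOn (b := fun h => b (-h)) (d := fun ω => -d ω) (c := -c) hδ
    (fun ω => ⟨convex_Icc _ _, fun x hx y hy s t hs ht hst => by
      have := (hconv ω).2 (hneg x hx) (hneg y hy) hs ht hst
      simp only [smul_eq_mul] at this ⊢
      rwa [show -(s * x + t * y) = s * -x + t * -y by ring]⟩)
    (fun h hh => hint _ (hneg h hh))
    (fun ω => by
      have h1 : HasDerivAt (fun h => b h ω) (d ω) (-0) := by rw [neg_zero]; exact hder ω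
      have h2 := h1.comp (0 : ℝ) (hasDerivAt_neg (0 : ℝ))
      simpa [Function.comp_def] using h2)
    (fun h hh => by
      have := hopt _ (hneg h hh)
      simpa using this)).2
  rw [integral_neg] at h2
  exact ⟨hi, by linarith⟩

end FirstOrder

/-! ### Minimizers of the dual problems and maximizers of the primal problems -/

section Minimizers

variable {P₀ : Measure Ω} [IsProbabilityMeasure P₀] {φ₁ φ₂ : ℝ → ℝ≥0∞} {X : Ω → ℝ}
  (hφ₁ : IsDivergenceFunction φ₁) (hφ₂ : IsDivergenceFunction φ₂)
  (hlsc₁ : LowerSemicontinuous φ₁) (hlsc₂ : LowerSemicontinuous φ₂)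
  (hd₁ : DifferentiableConjugate φ₁) (hd₂ : DifferentiableConjugate φ₂)
  (hX : Integrable X P₀)

include hφ₂ hlsc₂ hd₁ hd₂ in
omit [MeasurableSpace Ω] in
lemma hasDerivAt_realIntegrand_left {lam : ℝ} (hlam : 0 < lam) (θ₁ θ₂ x : ℝ) :
    HasDerivAt (fun y => realIntegrand φ₁ φ₂ lam y θ₂ x) (outerMaximizer φ₁ φ₂ lam θ₁ θ₂ x) θ₁ := by
  have h := hasDerivAt_realIntegrand_line hφ₂ hlsc₂ hd₁ hd₂ hlam θ₁ θ₂ x 1 0 0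
  rw [← sub_self θ₁] at h
  simpa using h.comp_sub_const θ₁ θ₁

include hφ₂ hlsc₂ hd₁ hd₂ in
omit [MeasurableSpace Ω] in
lemma hasDerivAt_realIntegrand_right {lam : ℝ} (hlam : 0 < lam) (θ₁ θ₂ x : ℝ) :
    HasDerivAt (fun y => realIntegrand φ₁ φ₂ lam θ₁ y x)
      (outerMaximizer φ₁ φ₂ lam θ₁ θ₂ x * innerMaximizer φ₁ θ₂ x) θ₂ := by
  have h := hasDerivAt_realIntegrand_line hφ₂ hlsc₂ hd₁ hd₂ hlam θ₁ θ₂ x 0 1 0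
  rw [← sub_self θ₂] at h
  simpa using h.comp_sub_const θ₂ θ₂

include hφ₁ hφ₂ hd₁ hd₂ hX

omit hX [IsProbabilityMeasure P₀] in
lemma extIntegral_dualIntegrand_eq {lam : ℝ} (hlam : 0 < lam) (θ₁ θ₂ : ℝ) :
    extIntegral P₀ (fun ω => dualIntegrand φ₁ φ₂ lam θ₁ θ₂ (X ω))
      = extIntegral P₀ (fun ω => (realIntegrand φ₁ φ₂ lam θ₁ θ₂ (X ω) : EReal)) := by
  congr 1
  ext ω
  exact dualIntegrand_eq_coe hφ₁ hφ₂ hd₁ hd₂ hlam θ₁ θ₂ (X ω)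

lemma integrable_realIntegrand {lam : ℝ} (hlam : 0 < lam) {θ₁ θ₂ : ℝ}
    (hfin : extIntegral P₀ (fun ω => dualIntegrand φ₁ φ₂ lam θ₁ θ₂ (X ω)) < ⊤) :
    Integrable (fun ω => realIntegrand φ₁ φ₂ lam θ₁ θ₂ (X ω)) P₀ := by
  rw [extIntegral_dualIntegrand_eq hφ₁ hφ₂ hd₁ hd₂ hlam] at hfin
  have hlow : Integrable (fun ω => θ₂ - X ω + θ₁) P₀ :=
    ((integrable_const θ₂).sub hX).add (integrable_const θ₁)
  exact integrable_of_extIntegral_lt_top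
    ((continuous_realIntegrand hd₁ hd₂ lam θ₁ θ₂).measurable.comp_aemeasurable hX.aemeasurable)
    hlow (.of_forall fun ω => le_realIntegrand hφ₁ hφ₂ hd₁ hd₂ hlam θ₁ θ₂ (X ω)) hfin

lemma extIntegral_dualIntegrand_eq_integral {lam : ℝ} (hlam : 0 < lam) {θ₁ θ₂ : ℝ}
    (hfin : extIntegral P₀ (fun ω => dualIntegrand φ₁ φ₂ lam θ₁ θ₂ (X ω)) < ⊤) :
    extIntegral P₀ (fun ω => dualIntegrand φ₁ φ₂ lam θ₁ θ₂ (X ω))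
      = ((∫ ω, realIntegrand φ₁ φ₂ lam θ₁ θ₂ (X ω) ∂P₀ : ℝ) : EReal) := by
  rw [← extIntegral_coe (integrable_realIntegrand hφ₁ hφ₂ hd₁ hd₂ hX hlam hfin),
    extIntegral_dualIntegrand_eq hφ₁ hφ₂ hd₁ hd₂ hlam]

include hlsc₁ hlsc₂

/-- The first-order condition in the direction `(e₁, e₂, e₃)` at a minimizer of the dual. -/
lemma first_order_condition {θ₁ θ₂ lam r e₁ e₂ e₃ δ : ℝ} (hδ : 0 < δ)
    (hpos : ∀ h ∈ Set.Icc (-δ) δ, 0 < lam + h * e₃)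
    (hfin : ∀ h ∈ Set.Icc (-δ) δ, extIntegral P₀ (fun ω =>
      dualIntegrand φ₁ φ₂ (lam + h * e₃) (θ₁ + h * e₁) (θ₂ + h * e₂) (X ω)) < ⊤)
    (hopt : ∀ h ∈ Set.Icc (-δ) δ, ((-θ₁ - θ₂ + lam * r : ℝ) : EReal)
        + extIntegral P₀ (fun ω => dualIntegrand φ₁ φ₂ lam θ₁ θ₂ (X ω))
      ≤ ((-(θ₁ + h * e₁) - (θ₂ + h * e₂) + (lam + h * e₃) * r : ℝ) : EReal)
        + extIntegral P₀ (fun ω =>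
          dualIntegrand φ₁ φ₂ (lam + h * e₃) (θ₁ + h * e₁) (θ₂ + h * e₂) (X ω))) :
    Integrable (fun ω => outerMaximizer φ₁ φ₂ lam θ₁ θ₂ (X ω) * e₁
        + outerMaximizer φ₁ φ₂ lam θ₁ θ₂ (X ω) * innerMaximizer φ₁ θ₂ (X ω) * e₂
        - (φ₂ (outerMaximizer φ₁ φ₂ lam θ₁ θ₂ (X ω))).toReal * e₃) P₀ ∧
      ∫ ω, (outerMaximizer φ₁ φ₂ lam θ₁ θ₂ (X ω) * e₁
        + outerMaximizer φ₁ φ₂ lam θ₁ θ₂ (X ω) * innerMaximizer φ₁ θ₂ (X ω) * e₂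
        - (φ₂ (outerMaximizer φ₁ φ₂ lam θ₁ θ₂ (X ω))).toReal * e₃) ∂P₀ = e₁ + e₂ - r * e₃ := by
  have m0 : (0 : ℝ) ∈ Set.Icc (-δ) δ := ⟨by linarith, hδ.le⟩
  have hlam : 0 < lam := by simpa using hpos 0 m0
  have hfin0 : extIntegral P₀ (fun ω => dualIntegrand φ₁ φ₂ lam θ₁ θ₂ (X ω)) < ⊤ := by
    simpa using hfin 0 m0
  refine integral_deriv_eq_of_convexOn (b := fun h ω =>
    realIntegrand φ₁ φ₂ (lam + h * e₃) (θ₁ + h * e₁) (θ₂ + h * e₂) (X ω)) hδ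
    (fun ω => convexOn_realIntegrand_line hφ₁ hφ₂ hlsc₁ hlsc₂ hd₁ hd₂ θ₁ θ₂ (X ω) e₁ e₂ e₃ hpos)
    (fun h hh => integrable_realIntegrand hφ₁ hφ₂ hd₁ hd₂ hX (hpos h hh) (hfin h hh))
    (fun ω => hasDerivAt_realIntegrand_line hφ₂ hlsc₂ hd₁ hd₂ hlam θ₁ θ₂ (X ω) e₁ e₂ e₃)
    (fun h hh => ?_)
  have h1 := hopt h hh
  rw [extIntegral_dualIntegrand_eq_integral hφ₁ hφ₂ hd₁ hd₂ hX hlam hfin0,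
    extIntegral_dualIntegrand_eq_integral hφ₁ hφ₂ hd₁ hd₂ hX (hpos h hh) (hfin h hh),
    ← EReal.coe_add, ← EReal.coe_add, EReal.coe_le_coe_iff] at h1
  simp only [zero_mul, add_zero]
  linarith

omit hX in
-- Equality in Fenchel's inequality at the maximizers, solved for the primal integrand.
lemma realIntegrand_decomposition {lam : ℝ} (hlam : 0 < lam) (θ₁ θ₂ x : ℝ) :
    -x * (outerMaximizer φ₁ φ₂ lam θ₁ θ₂ x * innerMaximizer φ₁ θ₂ x)
        - outerMaximizer φ₁ φ₂ lam θ₁ θ₂ x * (φ₁ (innerMaximizer φ₁ θ₂ x)).toReal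
      = realIntegrand φ₁ φ₂ lam θ₁ θ₂ x - θ₁ * outerMaximizer φ₁ φ₂ lam θ₁ θ₂ x
        - θ₂ * (outerMaximizer φ₁ φ₂ lam θ₁ θ₂ x * innerMaximizer φ₁ θ₂ x)
        + lam * (φ₂ (outerMaximizer φ₁ φ₂ lam θ₁ θ₂ x)).toReal := by
  rw [realIntegrand_eq_lagrangian hφ₁ hφ₂ hlsc₁ hlsc₂ hd₁ hd₂ hlam, lagrangian]
  ring

/-- The normalizations turn the integrated Fenchel equality into equality of the joint primal value
with the dual value, and weak duality makes that value maximal. Only the joint objective is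
controlled in general, since the separate terms may be infinite. -/
theorem attainsPen_of_first_order {θ₁ θ₂ : ℝ}
    (hfin : extIntegral P₀ (fun ω => dualIntegrand φ₁ φ₂ 1 θ₁ θ₂ (X ω)) < ⊤)
    (hval : dualPen P₀ φ₁ φ₂ X θ₁ θ₂ = robustOCEPen P₀ φ₁ φ₂ X)
    (hg : Integrable (fun ω => outerMaximizer φ₁ φ₂ 1 θ₁ θ₂ (X ω)) P₀)
    (hg1 : ∫ ω, outerMaximizer φ₁ φ₂ 1 θ₁ θ₂ (X ω) ∂P₀ = 1)
    (hgu : Integrable (fun ω =>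
      outerMaximizer φ₁ φ₂ 1 θ₁ θ₂ (X ω) * innerMaximizer φ₁ θ₂ (X ω)) P₀)
    (hgu1 : ∫ ω, outerMaximizer φ₁ φ₂ 1 θ₁ θ₂ (X ω) * innerMaximizer φ₁ θ₂ (X ω) ∂P₀ = 1) :
    AttainsPen P₀ φ₁ φ₂ X (ofDensity P₀ fun ω => outerMaximizer φ₁ φ₂ 1 θ₁ θ₂ (X ω))
      (ofDensity P₀ fun ω =>
        outerMaximizer φ₁ φ₂ 1 θ₁ θ₂ (X ω) * innerMaximizer φ₁ θ₂ (X ω)) := by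
  have hm₁ := hlsc₁.measurable
  have hm₂ := hlsc₂.measurable
  have hφg : ∀ ω, φ₂ (outerMaximizer φ₁ φ₂ 1 θ₁ θ₂ (X ω)) < ⊤ := fun ω =>
    outerMaximizer_lt_top hφ₂ hlsc₂ hd₂ _ _ _ _
  have hφu : ∀ ω, φ₁ (innerMaximizer φ₁ θ₂ (X ω)) < ⊤ := fun ω =>
    innerMaximizer_lt_top hφ₁ hlsc₁ hd₁ _ _
  have hg0 := fun ω => hφ₂.nonneg_of_lt_top (hφg ω)
  have hu0 := fun ω => hφ₁.nonneg_of_lt_top (hφu ω)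
  have mu : AEMeasurable (fun ω => innerMaximizer φ₁ θ₂ (X ω)) P₀ :=
    (measurable_innerMaximizer θ₂).comp_aemeasurable hX.aemeasurable
  have hf := penFeasible_ofDensity hg mu hg0 hu0 hg1 hgu hgu1
  have hG := integrable_realIntegrand hφ₁ hφ₂ hd₁ hd₂ hX one_pos hfin
  have hjoint : penObjectiveJoint P₀ φ₁ φ₂ X
      (ofDensity P₀ fun ω => outerMaximizer φ₁ φ₂ 1 θ₁ θ₂ (X ω)) (ofDensity P₀ fun ω =>
        outerMaximizer φ₁ φ₂ 1 θ₁ θ₂ (X ω) * innerMaximizer φ₁ θ₂ (X ω))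
      = dualPen P₀ φ₁ φ₂ X θ₁ θ₂ := by
    rw [penObjectiveJoint_ofDensity hg mu hg0 hu0 hg1 hφu hφg, dualPen_eq,
      extIntegral_dualIntegrand_eq_integral hφ₁ hφ₂ hd₁ hd₂ hX one_pos hfin]
    simp_rw [realIntegrand_decomposition hφ₁ hφ₂ hlsc₁ hlsc₂ hd₁ hd₂ one_pos, one_mul,
      add_sub_cancel_right]
    have i1 := hG.sub (hg.const_mul θ₁)
    have i2 := i1.sub (hgu.const_mul θ₂)
    refine (extIntegral_coe i2).trans ?_
    rw [integral_sub' i1 (hgu.const_mul θ₂), integral_sub' hG (hg.const_mul θ₁),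
      integral_const_mul, integral_const_mul, hg1, hgu1, ← EReal.coe_add]
    congr 1
    ring
  have := hf.prob
  have := hf.prob_bar
  refine ⟨hf, hjoint.trans hval, fun Q' Qbar' h' => ?_, fun h => ?_⟩
  · have := h'.prob
    have := h'.prob_bar
    rw [hjoint, dualPen_eq]
    exact penObjectiveJoint_le_dual hφ₁ hφ₂ hm₁ hm₂ hX.aemeasurable h'.ac h'.ac_bar θ₁ θ₂
  · rw [penObjective_eq_joint hf.ac hf.ac_bar hm₁ hm₂ hX.aemeasurable h]
    exact hjoint.trans hval

/-- The identity `∫ φ₂(g) = r` gives feasibility, and it cancels the term `lam r` of the dual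
against `lam ∫ φ₂(g)`: this is complementary slackness. -/
theorem attainsBall_of_first_order {θ₁ θ₂ lam r : ℝ} (hlam : 0 < lam) (hr : 0 < r)
    (hfin : extIntegral P₀ (fun ω => dualIntegrand φ₁ φ₂ lam θ₁ θ₂ (X ω)) < ⊤)
    (hval : dualBall P₀ φ₁ φ₂ X r θ₁ θ₂ lam = robustOCEBall P₀ φ₁ φ₂ X r)
    (hg : Integrable (fun ω => outerMaximizer φ₁ φ₂ lam θ₁ θ₂ (X ω)) P₀)
    (hg1 : ∫ ω, outerMaximizer φ₁ φ₂ lam θ₁ θ₂ (X ω) ∂P₀ = 1)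
    (hgu : Integrable (fun ω =>
      outerMaximizer φ₁ φ₂ lam θ₁ θ₂ (X ω) * innerMaximizer φ₁ θ₂ (X ω)) P₀)
    (hgu1 : ∫ ω, outerMaximizer φ₁ φ₂ lam θ₁ θ₂ (X ω) * innerMaximizer φ₁ θ₂ (X ω) ∂P₀ = 1)
    (hφ : Integrable (fun ω => (φ₂ (outerMaximizer φ₁ φ₂ lam θ₁ θ₂ (X ω))).toReal) P₀)
    (hφr : ∫ ω, (φ₂ (outerMaximizer φ₁ φ₂ lam θ₁ θ₂ (X ω))).toReal ∂P₀ = r) :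
    AttainsBall P₀ φ₁ φ₂ X r (ofDensity P₀ fun ω => outerMaximizer φ₁ φ₂ lam θ₁ θ₂ (X ω))
      (ofDensity P₀ fun ω =>
        outerMaximizer φ₁ φ₂ lam θ₁ θ₂ (X ω) * innerMaximizer φ₁ θ₂ (X ω)) := by
  have hm₁ := hlsc₁.measurable
  have hm₂ := hlsc₂.measurable
  have hφg : ∀ ω, φ₂ (outerMaximizer φ₁ φ₂ lam θ₁ θ₂ (X ω)) < ⊤ := fun ω =>
    outerMaximizer_lt_top hφ₂ hlsc₂ hd₂ _ _ _ _
  have hφu : ∀ ω, φ₁ (innerMaximizer φ₁ θ₂ (X ω)) < ⊤ := fun ω =>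
    innerMaximizer_lt_top hφ₁ hlsc₁ hd₁ _ _
  have hg0 := fun ω => hφ₂.nonneg_of_lt_top (hφg ω)
  have hu0 := fun ω => hφ₁.nonneg_of_lt_top (hφu ω)
  have mu : AEMeasurable (fun ω => innerMaximizer φ₁ θ₂ (X ω)) P₀ :=
    (measurable_innerMaximizer θ₂).comp_aemeasurable hX.aemeasurable
  have hpf := penFeasible_ofDensity hg mu hg0 hu0 hg1 hgu hgu1
  have hf : BallFeasible P₀ φ₂ r (ofDensity P₀ fun ω => outerMaximizer φ₁ φ₂ lam θ₁ θ₂ (X ω))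
      (ofDensity P₀ fun ω =>
        outerMaximizer φ₁ φ₂ lam θ₁ θ₂ (X ω) * innerMaximizer φ₁ θ₂ (X ω)) :=
    ⟨hpf.prob, hpf.prob_bar,
      (divergence_ofDensity_eq_ofReal hg.aemeasurable hg0 hφg hφ).le.trans_eq (by rw [hφr]),
      hpf.ac_bar⟩
  have hG := integrable_realIntegrand hφ₁ hφ₂ hd₁ hd₂ hX hlam hfin
  have hdual : ∀ y z : ℝ, dualBall P₀ φ₁ φ₂ X r y z lam = ((-y - z + lam * r : ℝ) : EReal)
      + extIntegral P₀ (fun ω => dualIntegrand φ₁ φ₂ lam y z (X ω)) := fun y z => by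
    rw [← closedDualBall_eq_dualBall hφ₁ hφ₂ r y z hlam, closedDualBall_eq hφ₁ hφ₂ r y z hlam.le]
  have hjoint : ballObjectiveJoint P₀ φ₁ X
      (ofDensity P₀ fun ω => outerMaximizer φ₁ φ₂ lam θ₁ θ₂ (X ω)) (ofDensity P₀ fun ω =>
        outerMaximizer φ₁ φ₂ lam θ₁ θ₂ (X ω) * innerMaximizer φ₁ θ₂ (X ω))
      = dualBall P₀ φ₁ φ₂ X r θ₁ θ₂ lam := by
    rw [ballObjectiveJoint_ofDensity hg mu hg0 hu0 hg1 hφu, hdual,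
      extIntegral_dualIntegrand_eq_integral hφ₁ hφ₂ hd₁ hd₂ hX hlam hfin]
    simp_rw [realIntegrand_decomposition hφ₁ hφ₂ hlsc₁ hlsc₂ hd₁ hd₂ hlam]
    have i1 := hG.sub (hg.const_mul θ₁)
    have i2 := i1.sub (hgu.const_mul θ₂)
    have i3 := i2.add (hφ.const_mul lam)
    refine (extIntegral_coe i3).trans ?_
    rw [integral_add' i2 (hφ.const_mul lam), integral_sub' i1 (hgu.const_mul θ₂),
      integral_sub' hG (hg.const_mul θ₁),
      integral_const_mul, integral_const_mul, integral_const_mul, hg1, hgu1, hφr, ← EReal.coe_add]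
    congr 1
    ring
  have := hf.prob
  have := hf.prob_bar
  refine ⟨hf, hjoint.trans hval, fun Q' Qbar' h' => ?_, fun h => ?_⟩
  · have := h'.prob
    have := h'.prob_bar
    rw [hjoint, hdual]
    exact ballObjectiveJoint_le_dual hφ₁ hφ₂ hm₁ hm₂ hX.aemeasurable hr.le h'.div_le h'.ac_bar
      θ₁ θ₂ hlam.le
  · rw [ballObjective_eq_joint hf.ac hf.ac_bar hm₁ hX.aemeasurable h]
    exact hjoint.trans hval

omit [MeasurableSpace Ω] hφ₁ hφ₂ hlsc₁ hlsc₂ hd₁ hd₂ hX [IsProbabilityMeasure P₀] in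
lemma exists_Icc_subset_of_mem_interior {E : Type*} [TopologicalSpace E] {S : Set E} {p : E}
    (hp : p ∈ interior S) {f : ℝ → E} (hf : Continuous f) (hf0 : f 0 = p) :
    ∃ δ > 0, ∀ h ∈ Set.Icc (-δ) δ, f h ∈ S := by
  have h0 : ∀ᶠ h in nhds (0 : ℝ), f h ∈ S :=
    hf.continuousAt.eventually (by rw [hf0]; exact mem_interior_iff_mem_nhds.1 hp)
  obtain ⟨ε, hε, hball⟩ := Metric.eventually_nhds_iff.1 h0
  refine ⟨ε / 2, half_pos hε, fun h hh => hball ?_⟩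
  rw [Real.dist_eq, sub_zero]
  exact (abs_le.2 hh).trans_lt (half_lt_self hε)

theorem exists_attainsPen {θ₁ θ₂ : ℝ}
    (hmin : ∀ θ₁' θ₂' : ℝ, dualPen P₀ φ₁ φ₂ X θ₁ θ₂ ≤ dualPen P₀ φ₁ φ₂ X θ₁' θ₂')
    (hint : (θ₁, θ₂) ∈ interior (domPen P₀ φ₁ φ₂ X)) :
    ∃ g gbar : Ω → ℝ,
      (∀ ω, HasDerivAt (fun u => (betaPen φ₁ φ₂ X u θ₂ ω).toReal) (g ω) θ₁) ∧
      (∀ ω, HasDerivAt (fun u => (betaPen φ₁ φ₂ X θ₁ u ω).toReal) (gbar ω) θ₂) ∧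
      (∀ ω, 0 ≤ g ω) ∧ (∀ ω, 0 ≤ gbar ω) ∧ AEMeasurable g P₀ ∧ AEMeasurable gbar P₀ ∧
      AttainsPen P₀ φ₁ φ₂ X (ofDensity P₀ g) (ofDensity P₀ gbar) := by
  have hm₁ := hlsc₁.measurable
  have hm₂ := hlsc₂.measurable
  have hdom : ∀ y z : ℝ, (y, z) ∈ domPen P₀ φ₁ φ₂ X →
      extIntegral P₀ (fun ω => dualIntegrand φ₁ φ₂ 1 y z (X ω)) < ⊤ := fun y z hp => by
    simp_rw [← betaPen_eq]
    exact hp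
  -- The general condition with `lam = 1`, `e₃ = 0` and `r = 0`; the vanishing products keep its
  -- shape.
  have hfoc : ∀ e₁ e₂ : ℝ, Integrable (fun ω => outerMaximizer φ₁ φ₂ 1 θ₁ θ₂ (X ω) * e₁
        + outerMaximizer φ₁ φ₂ 1 θ₁ θ₂ (X ω) * innerMaximizer φ₁ θ₂ (X ω) * e₂
        - (φ₂ (outerMaximizer φ₁ φ₂ 1 θ₁ θ₂ (X ω))).toReal * 0) P₀ ∧
      ∫ ω, (outerMaximizer φ₁ φ₂ 1 θ₁ θ₂ (X ω) * e₁
        + outerMaximizer φ₁ φ₂ 1 θ₁ θ₂ (X ω) * innerMaximizer φ₁ θ₂ (X ω) * e₂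
        - (φ₂ (outerMaximizer φ₁ φ₂ 1 θ₁ θ₂ (X ω))).toReal * 0) ∂P₀ = e₁ + e₂ - 0 * 0 := by
    intro e₁ e₂
    obtain ⟨δ, hδ, hS⟩ := exists_Icc_subset_of_mem_interior hint
      (f := fun h => (θ₁ + h * e₁, θ₂ + h * e₂)) (by fun_prop) (by simp)
    refine first_order_condition hφ₁ hφ₂ hlsc₁ hlsc₂ hd₁ hd₂ hX hδ (fun h _ => by simp)
      (fun h hh => ?_) (fun h hh => ?_)
    · simpa using hdom _ _ (hS h hh)
    · have := hmin (θ₁ + h * e₁) (θ₂ + h * e₂)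
      rw [dualPen_eq, dualPen_eq] at this
      simpa using this
  obtain ⟨hg, hg1⟩ := hfoc 1 0
  obtain ⟨hgu, hgu1⟩ := hfoc 0 1
  simp only [mul_one, mul_zero, add_zero, zero_add, sub_zero] at hg hg1 hgu hgu1
  have hG : ∀ y z ω, (betaPen φ₁ φ₂ X y z ω).toReal = realIntegrand φ₁ φ₂ 1 y z (X ω) :=
    fun y z ω => by
      rw [betaPen_eq, dualIntegrand_eq_coe hφ₁ hφ₂ hd₁ hd₂ one_pos, EReal.toReal_coe]
  have hg0 : ∀ ω, 0 ≤ outerMaximizer φ₁ φ₂ 1 θ₁ θ₂ (X ω) := fun ω =>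
    hφ₂.nonneg_of_lt_top (outerMaximizer_lt_top hφ₂ hlsc₂ hd₂ _ _ _ _)
  have hu0 : ∀ ω, 0 ≤ innerMaximizer φ₁ θ₂ (X ω) := fun ω =>
    hφ₁.nonneg_of_lt_top (innerMaximizer_lt_top hφ₁ hlsc₁ hd₁ _ _)
  refine ⟨fun ω => outerMaximizer φ₁ φ₂ 1 θ₁ θ₂ (X ω),
    fun ω => outerMaximizer φ₁ φ₂ 1 θ₁ θ₂ (X ω) * innerMaximizer φ₁ θ₂ (X ω),
    fun ω => ?_, fun ω => ?_, hg0, fun ω => mul_nonneg (hg0 ω) (hu0 ω),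
    hg.aemeasurable, hgu.aemeasurable, attainsPen_of_first_order hφ₁ hφ₂ hlsc₁ hlsc₂ hd₁ hd₂ hX
      (hdom _ _ (interior_subset hint)) ?_ hg hg1 hgu hgu1⟩
  · simp_rw [hG]
    exact hasDerivAt_realIntegrand_left hφ₂ hlsc₂ hd₁ hd₂ one_pos θ₁ θ₂ (X ω)
  · simp_rw [hG]
    exact hasDerivAt_realIntegrand_right hφ₂ hlsc₂ hd₁ hd₂ one_pos θ₁ θ₂ (X ω)
  · obtain ⟨y, z, hyz⟩ := exists_dualPen_eq hφ₁ hφ₂ hm₁ hm₂ hX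
    exact (hyz ▸ hmin y z).antisymm (robustOCEPen_le_dualPen hφ₁ hφ₂ hm₁ hm₂ hX θ₁ θ₂)

theorem exists_attainsBall {θ₁ θ₂ lam r : ℝ} (hr : 0 < r)
    (hmin : ∀ θ₁' θ₂' lam' : ℝ, 0 ≤ lam' →
      dualBall P₀ φ₁ φ₂ X r θ₁ θ₂ lam ≤ dualBall P₀ φ₁ φ₂ X r θ₁' θ₂' lam')
    (hint : (θ₁, θ₂, lam) ∈ interior (domBall P₀ φ₁ φ₂ X)) :
    ∃ g gbar : Ω → ℝ,
      (∀ ω, HasDerivAt (fun u => (betaBall φ₁ φ₂ X u θ₂ lam ω).toReal) (g ω) θ₁) ∧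
      (∀ ω, HasDerivAt (fun u => (betaBall φ₁ φ₂ X θ₁ u lam ω).toReal) (gbar ω) θ₂) ∧
      (∀ ω, 0 ≤ g ω) ∧ (∀ ω, 0 ≤ gbar ω) ∧ AEMeasurable g P₀ ∧ AEMeasurable gbar P₀ ∧
      AttainsBall P₀ φ₁ φ₂ X r (ofDensity P₀ g) (ofDensity P₀ gbar) := by
  have hm₁ := hlsc₁.measurable
  have hm₂ := hlsc₂.measurable
  -- An interior point can move down in `lam` while staying in a set where `lam ≥ 0`.
  have hlam : 0 < lam := by
    obtain ⟨δ, hδ, hS⟩ := exists_Icc_subset_of_mem_interior hint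
      (f := fun h => (θ₁, θ₂, lam + h)) (by fun_prop) (by simp)
    have : 0 ≤ lam + -δ := (hS (-δ) ⟨le_rfl, by linarith⟩).1
    linarith
  have hint' : (θ₁, θ₂, lam) ∈ interior (domBall P₀ φ₁ φ₂ X ∩ {p | 0 < p.2.2}) := by
    rw [interior_inter, IsOpen.interior_eq (isOpen_lt continuous_const (by fun_prop))]
    exact ⟨hint, hlam⟩
  have hdom : ∀ y z μ : ℝ, (y, z, μ) ∈ domBall P₀ φ₁ φ₂ X ∩ {p | 0 < p.2.2} →
      extIntegral P₀ (fun ω => dualIntegrand φ₁ φ₂ μ y z (X ω)) < ⊤ := fun y z μ hp => by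
    simp_rw [← betaBall_eq hφ₁ hφ₂ y z hp.2]
    exact hp.1.2
  have hdual : ∀ y z μ : ℝ, 0 < μ → dualBall P₀ φ₁ φ₂ X r y z μ = ((-y - z + μ * r : ℝ) : EReal)
      + extIntegral P₀ (fun ω => dualIntegrand φ₁ φ₂ μ y z (X ω)) := fun y z μ hμ => by
    rw [← closedDualBall_eq_dualBall hφ₁ hφ₂ r y z hμ, closedDualBall_eq hφ₁ hφ₂ r y z hμ.le]
  have hfoc : ∀ e₁ e₂ e₃ : ℝ, Integrable (fun ω => outerMaximizer φ₁ φ₂ lam θ₁ θ₂ (X ω) * e₁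
        + outerMaximizer φ₁ φ₂ lam θ₁ θ₂ (X ω) * innerMaximizer φ₁ θ₂ (X ω) * e₂
        - (φ₂ (outerMaximizer φ₁ φ₂ lam θ₁ θ₂ (X ω))).toReal * e₃) P₀ ∧
      ∫ ω, (outerMaximizer φ₁ φ₂ lam θ₁ θ₂ (X ω) * e₁
        + outerMaximizer φ₁ φ₂ lam θ₁ θ₂ (X ω) * innerMaximizer φ₁ θ₂ (X ω) * e₂
        - (φ₂ (outerMaximizer φ₁ φ₂ lam θ₁ θ₂ (X ω))).toReal * e₃) ∂P₀ = e₁ + e₂ - r * e₃ := by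
    intro e₁ e₂ e₃
    obtain ⟨δ, hδ, hS⟩ := exists_Icc_subset_of_mem_interior hint'
      (f := fun h => (θ₁ + h * e₁, θ₂ + h * e₂, lam + h * e₃)) (by fun_prop) (by simp)
    refine first_order_condition hφ₁ hφ₂ hlsc₁ hlsc₂ hd₁ hd₂ hX hδ (fun h hh => (hS h hh).2)
      (fun h hh => hdom _ _ _ (hS h hh)) (fun h hh => ?_)
    rw [← hdual _ _ _ hlam, ← hdual _ _ _ (hS h hh).2]
    exact hmin _ _ _ (hS h hh).1.1
  obtain ⟨hg, hg1⟩ := hfoc 1 0 0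
  obtain ⟨hgu, hgu1⟩ := hfoc 0 1 0
  -- The direction `-1` in `lam` yields integrability of `φ₂(g)` and the binding constraint `∫ φ₂(g)
  -- = r`.
  obtain ⟨hp, hp1⟩ := hfoc 0 0 (-1)
  simp only [mul_one, mul_zero, add_zero, zero_add, sub_zero, zero_sub, mul_neg, neg_neg]
    at hg hg1 hgu hgu1 hp hp1
  have hG : ∀ y z ω, (betaBall φ₁ φ₂ X y z lam ω).toReal = realIntegrand φ₁ φ₂ lam y z (X ω) :=
    fun y z ω => by
      rw [betaBall_eq hφ₁ hφ₂ y z hlam, dualIntegrand_eq_coe hφ₁ hφ₂ hd₁ hd₂ hlam,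
        EReal.toReal_coe]
  have hg0 : ∀ ω, 0 ≤ outerMaximizer φ₁ φ₂ lam θ₁ θ₂ (X ω) := fun ω =>
    hφ₂.nonneg_of_lt_top (outerMaximizer_lt_top hφ₂ hlsc₂ hd₂ _ _ _ _)
  have hu0 : ∀ ω, 0 ≤ innerMaximizer φ₁ θ₂ (X ω) := fun ω =>
    hφ₁.nonneg_of_lt_top (innerMaximizer_lt_top hφ₁ hlsc₁ hd₁ _ _)
  refine ⟨fun ω => outerMaximizer φ₁ φ₂ lam θ₁ θ₂ (X ω),
    fun ω => outerMaximizer φ₁ φ₂ lam θ₁ θ₂ (X ω) * innerMaximizer φ₁ θ₂ (X ω),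
    fun ω => ?_, fun ω => ?_, hg0, fun ω => mul_nonneg (hg0 ω) (hu0 ω),
    hg.aemeasurable, hgu.aemeasurable, attainsBall_of_first_order hφ₁ hφ₂ hlsc₁ hlsc₂ hd₁ hd₂ hX
      hlam hr (hdom _ _ _ (interior_subset hint')) ?_ hg hg1 hgu hgu1 hp hp1⟩
  · simp_rw [hG]
    exact hasDerivAt_realIntegrand_left hφ₂ hlsc₂ hd₁ hd₂ hlam θ₁ θ₂ (X ω)
  · simp_rw [hG]
    exact hasDerivAt_realIntegrand_right hφ₂ hlsc₂ hd₁ hd₂ hlam θ₁ θ₂ (X ω)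
  · refine le_antisymm ?_ ((robustOCEBall_le_closedDualBall hφ₁ hφ₂ hm₁ hm₂ hX hr θ₁ θ₂
      hlam.le).trans (closedDualBall_le_dualBall hφ₁ hφ₂ r θ₁ θ₂ hlam.le))
    rw [robustOCEBall_eq_iInf hφ₁ hφ₂ hm₁ hm₂ hX hr]
    exact le_iInf fun y => le_iInf fun z => le_iInf fun μ => le_iInf fun hμ => hmin y z μ hμ

end Minimizers

end RobustOCE

theorem theorem1 {Ω : Type*} [MeasurableSpace Ω] (P₀ : Measure Ω) [IsProbabilityMeasure P₀]
    (X : Ω → ℝ) (hX : Integrable X P₀) (φ₁ φ₂ : ℝ → ℝ≥0∞)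
    (hφ₁ : RobustOCE.IsDivergenceFunction φ₁) (hφ₂ : RobustOCE.IsDivergenceFunction φ₂)
    (hlsc₁ : LowerSemicontinuous φ₁) (hlsc₂ : LowerSemicontinuous φ₂) (r : ℝ) (hr : 0 < r) :
    RobustOCE.robustOCEPen P₀ φ₁ φ₂ X
        = (⨅ (θ₁ : ℝ) (θ₂ : ℝ), RobustOCE.dualPen P₀ φ₁ φ₂ X θ₁ θ₂) ∧
    RobustOCE.robustOCEBall P₀ φ₁ φ₂ X r
        = (⨅ (θ₁ : ℝ) (θ₂ : ℝ) (lam : ℝ) (_ : 0 ≤ lam),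
            RobustOCE.dualBall P₀ φ₁ φ₂ X r θ₁ θ₂ lam) ∧
    (RobustOCE.DifferentiableConjugate φ₁ → RobustOCE.DifferentiableConjugate φ₂ →
      -- the penalized problem
      ((interior (RobustOCE.domPen P₀ φ₁ φ₂ X)).Nonempty →
        (∃ θ₁ θ₂ : ℝ, ∀ θ₁' θ₂' : ℝ,
          RobustOCE.dualPen P₀ φ₁ φ₂ X θ₁ θ₂ ≤ RobustOCE.dualPen P₀ φ₁ φ₂ X θ₁' θ₂') ∧
        (∀ θ₁ θ₂ : ℝ,
          (∀ θ₁' θ₂' : ℝ,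
            RobustOCE.dualPen P₀ φ₁ φ₂ X θ₁ θ₂ ≤ RobustOCE.dualPen P₀ φ₁ φ₂ X θ₁' θ₂') →
          (θ₁, θ₂) ∈ interior (RobustOCE.domPen P₀ φ₁ φ₂ X) →
          ∃ g gbar : Ω → ℝ,
            (∀ ω, HasDerivAt (fun u => (RobustOCE.betaPen φ₁ φ₂ X u θ₂ ω).toReal) (g ω) θ₁) ∧
            (∀ ω, HasDerivAt (fun u => (RobustOCE.betaPen φ₁ φ₂ X θ₁ u ω).toReal) (gbar ω) θ₂) ∧
            (∀ ω, 0 ≤ g ω) ∧ (∀ ω, 0 ≤ gbar ω) ∧ AEMeasurable g P₀ ∧ AEMeasurable gbar P₀ ∧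
            RobustOCE.AttainsPen P₀ φ₁ φ₂ X
              (RobustOCE.ofDensity P₀ g) (RobustOCE.ofDensity P₀ gbar))) ∧
      -- the problem over the divergence ball
      ((interior (RobustOCE.domBall P₀ φ₁ φ₂ X)).Nonempty →
        ((∀ t : ℝ, 0 < t → φ₂ t < ⊤) →
          ∃ θ₁ θ₂ lam : ℝ, 0 ≤ lam ∧ ∀ θ₁' θ₂' lam' : ℝ, 0 ≤ lam' →
            RobustOCE.dualBall P₀ φ₁ φ₂ X r θ₁ θ₂ lam
              ≤ RobustOCE.dualBall P₀ φ₁ φ₂ X r θ₁' θ₂' lam') ∧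
        (∃ θ₁ θ₂ lam : ℝ, 0 ≤ lam ∧
          RobustOCE.closedDualBall P₀ φ₁ φ₂ X r θ₁ θ₂ lam
            = RobustOCE.robustOCEBall P₀ φ₁ φ₂ X r ∧
          ∀ θ₁' θ₂' lam' : ℝ, 0 ≤ lam' →
            RobustOCE.closedDualBall P₀ φ₁ φ₂ X r θ₁ θ₂ lam
              ≤ RobustOCE.closedDualBall P₀ φ₁ φ₂ X r θ₁' θ₂' lam') ∧
        (∀ θ₁ θ₂ lam : ℝ,
          (∀ θ₁' θ₂' lam' : ℝ, 0 ≤ lam' →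
            RobustOCE.dualBall P₀ φ₁ φ₂ X r θ₁ θ₂ lam
              ≤ RobustOCE.dualBall P₀ φ₁ φ₂ X r θ₁' θ₂' lam') →
          (θ₁, θ₂, lam) ∈ interior (RobustOCE.domBall P₀ φ₁ φ₂ X) →
          ∃ g gbar : Ω → ℝ,
            (∀ ω, HasDerivAt
              (fun u => (RobustOCE.betaBall φ₁ φ₂ X u θ₂ lam ω).toReal) (g ω) θ₁) ∧
            (∀ ω, HasDerivAt
              (fun u => (RobustOCE.betaBall φ₁ φ₂ X θ₁ u lam ω).toReal) (gbar ω) θ₂) ∧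
            (∀ ω, 0 ≤ g ω) ∧ (∀ ω, 0 ≤ gbar ω) ∧ AEMeasurable g P₀ ∧ AEMeasurable gbar P₀ ∧
            RobustOCE.AttainsBall P₀ φ₁ φ₂ X r
              (RobustOCE.ofDensity P₀ g) (RobustOCE.ofDensity P₀ gbar)))) := by
  have hm₁ := hlsc₁.measurable
  have hm₂ := hlsc₂.measurable
  -- One closed-dual minimizer serves both attainment claims: if `(0, ∞)` lies in the domain of
  -- `φ₂`, the two dual objectives coincide for all `lam ≥ 0`.
  obtain ⟨θ₁, θ₂, lam, hlam, hval⟩ := RobustOCE.exists_closedDualBall_eq hφ₁ hφ₂ hm₁ hm₂ hX hr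
  have hclosed : ∀ θ₁' θ₂' lam' : ℝ, 0 ≤ lam' →
      RobustOCE.closedDualBall P₀ φ₁ φ₂ X r θ₁ θ₂ lam
        ≤ RobustOCE.closedDualBall P₀ φ₁ φ₂ X r θ₁' θ₂' lam' := fun θ₁' θ₂' lam' h =>
    hval.le.trans (RobustOCE.robustOCEBall_le_closedDualBall hφ₁ hφ₂ hm₁ hm₂ hX hr θ₁' θ₂' h)
  refine ⟨RobustOCE.robustOCEPen_eq_iInf hφ₁ hφ₂ hm₁ hm₂ hX,
    RobustOCE.robustOCEBall_eq_iInf hφ₁ hφ₂ hm₁ hm₂ hX hr, fun hd₁ hd₂ => ⟨fun _ => ⟨?_, ?_⟩,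
    fun _ => ⟨fun hdom => ⟨θ₁, θ₂, lam, hlam, fun θ₁' θ₂' lam' h => ?_⟩,
      ⟨θ₁, θ₂, lam, hlam, hval, hclosed⟩, ?_⟩⟩⟩
  · obtain ⟨y, z, hyz⟩ := RobustOCE.exists_dualPen_eq hφ₁ hφ₂ hm₁ hm₂ hX
    exact ⟨y, z, fun y' z' =>
      hyz.le.trans (RobustOCE.robustOCEPen_le_dualPen hφ₁ hφ₂ hm₁ hm₂ hX y' z')⟩
  · exact fun y z hmin hint =>
      RobustOCE.exists_attainsPen hφ₁ hφ₂ hlsc₁ hlsc₂ hd₁ hd₂ hX hmin hint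
  · rw [← RobustOCE.closedDualBall_eq_dualBall_of_dom hφ₁ hφ₂ hdom r θ₁ θ₂ hlam,
      ← RobustOCE.closedDualBall_eq_dualBall_of_dom hφ₁ hφ₂ hdom r θ₁' θ₂' h]
    exact hclosed θ₁' θ₂' lam' h
  · exact fun y z μ hmin hint =>
      RobustOCE.exists_attainsBall hφ₁ hφ₂ hlsc₁ hlsc₂ hd₁ hd₂ hX hr hmin hint
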